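/- All graphs are finite and simple. A cut of $G$ is a set $S\subseteq V(G)$; its size is the number of edges with exactly one endpoint in $S$. Two adjacent vertices $u,v$ are twins if $N_G(u)\setminus\{v\}=N_G(v)\setminus\{u\}$; a bubble of $G$ is an inclusion-maximal set of pairwise twins. A clique-width decomposition $T$ of $G$ is a rooted binary tree representing an expression with value $G$ (for some labelling of the vertices) over the operations $\ell(v)$ (a single vertex $v$ with label $\ell$), disjoint union, $\eta_{i,j}$ (join every vertex labelled $i$ to every other vertex labelled $j$; $i=j$ is allowed) and $\rho_{i\to j}$ (relabel $i$ to $j$). Let $\mathcal L(T)$ be the set of labels used in $T$, let $w(T)=|\mathcal L(T)|$ be its width, and for a node $t$ let $V_{t,\ell}$ be the set of vertices with label $\ell$ in the value of the subexpression rooted at $t$. For positive integers $\alpha,\beta,\delta$, $T$ is an $(\alpha,\beta,\delta)$-clique-width decomposition of $G$ if for every node $t$ there is a set $L_t\subseteq\mathcal L(T)$ of at most $\delta$ labels such that the independence number of $G[\bigcup_{\ell\notin L_t}V_{t,\ell}]$ is at most $\alpha$ and, for every $\ell\in\mathcal L(T)\setminus L_t$, at most $\beta$ bubbles of $G$ meet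 $V_{t,\ell}$. Let $\mathrm{cw}_{\alpha,\beta,\delta}(G)$ be the smallest width of an $(\alpha,\beta,\delta)$-clique-width decomposition of $G$, and $\infty$ if there is none. **Theorem.** For all positive integers $\alpha,\beta,\delta$: 1. MaxCut (given $G$ and $m$, does $G$ have a cut of size at least $m$?), where $G$ is provided together with an $(\alpha,\beta,\delta)$-clique-width decomposition of smallest width, is fixed-parameter tractable when parameterized by $\mathrm{cw}_{\alpha,\beta,\delta}(G)$: it is decided by an algorithm in time $f(\mathrm{cw}_{\alpha,\beta,\delta}(G))\cdot|I|^{c}$ for some computable function $f$ and some constant $c$ (which may depend on $\alpha,\beta,\delta$), where $|I|$ is the size of the instance. 2. More precisely, there is an algorithm that, given a graph $G$ and any $(\alpha,\beta,\delta)$-clique-width decomposition $T$ of $G$, computes a maximum cut of $G$ in time $$O^*\bigl((\beta\cdot w(T))^{O(\alpha)}\cdot 2^{\beta\cdot w(T)}\bigr),$$ where, for fixed $\alpha,\beta,\delta$, $O^*$ hides a factor polynomial in the size of the input, and the constant in the exponent $O(\alpha)$ is absolute. In particular, if $T$ has smallest width, the time is $O^*\bigl((\beta\cdot \mathrm{cw}_{\alpha,\beta,\delta}(G))^{O(\alpha)}\cdot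 2^{\beta\cdot \mathrm{cw}_{\alpha,\beta,\delta}(G)}\bigr)$. Running time is the number of unit-cost primitive operations of a program in the WHILE language on binary trees (reading a variable, forming a pair, taking a component, testing for nil, assigning); integers in the input are encoded in binary and graphs by adjacency matrices. -/

import Mathlib

namespace MaxCutCW

/-! ### Cuts -/

/-- The edges of `G` with exactly one endpoint in `S`. -/
def cutSet {V : Type*} (G : SimpleGraph V) (S : Set V) : Set (Sym2 V) :=
  {e | ∃ u v, G.Adj u v ∧ u ∈ S ∧ v ∉ S ∧ e = s(u, v)}

noncomputable def cutSize {V : Type*} (G : SimpleGraph V) (S : Set V) : ℕ :=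
  (cutSet G S).ncard

/-- `S` is a maximum cut of the (finite) graph `G`. -/
def IsMaxCut {V : Type*} (G : SimpleGraph V) (S : Set V) : Prop :=
  ∀ S' : Set V, cutSize G S' ≤ cutSize G S

/-! ### Bubbles -/

/-- Two adjacent vertices with the same other neighbours. -/
def Twins {V : Type*} (G : SimpleGraph V) (u v : V) : Prop :=
  G.Adj u v ∧ G.neighborSet u \ {v} = G.neighborSet v \ {u}

/-- A bubble is an inclusion-maximal set of pairwise twins. -/
def IsBubble {V : Type*} (G : SimpleGraph V) (B : Set V) : Prop :=
  Maximal (fun B' : Set V => B'.Pairwise (Twins G)) B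

/-- The number of bubbles of `G` that meet `U`. The bubbles partition the vertex set, so if `U` is
a union of bubbles then this is the number of bubbles that `U` consists of. -/
noncomputable def numBubbles {V : Type*} (G : SimpleGraph V) (U : Set V) : ℕ :=
  {B : Set V | IsBubble G B ∧ (B ∩ U).Nonempty}.ncard

/-! ### Clique-width decompositions -/

/-- Clique-width expressions with vertices from `V` and labels from `ℕ`, that is, rooted binary
trees over the four operations: `ℓ(v)`, disjoint union, `η_{i,j}` and `ρ_{i → j}`. -/
inductive Decomp (V : Type) : Type
  | vertex (l : ℕ) (v : V) : Decomp V
  | union (s t : Decomp V) : Decomp V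
  | join (i j : ℕ) (t : Decomp V) : Decomp V
  | relabel (i j : ℕ) (t : Decomp V) : Decomp V

namespace Decomp

variable {V : Type} [DecidableEq V]

/-- The label of a vertex in the labelled graph that is the value of the expression; `none` if the
vertex does not belong to that graph. -/
def label : Decomp V → V → Option ℕ
  | vertex l v => fun u => if u = v then some l else none
  | union s t => fun u => (s.label u).or (t.label u)
  | join _ _ t => t.label
  | relabel i j t => fun u => (t.label u).map (fun l => if l = i then j else l)

/-- The edges of the value of the expression. The operation `η_{i,j}` joins every vertex labelled
`i` to every (other) vertex labelled `j`; the case `i = j` is allowed. -/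
def graph : Decomp V → SimpleGraph V
  | vertex _ _ => ⊥
  | union s t => s.graph ⊔ t.graph
  | join i j t =>
      t.graph ⊔ SimpleGraph.fromRel (fun u v => t.label u = some i ∧ t.label v = some j)
  | relabel _ _ t => t.graph

/-- All unions in the expression are unions of vertex-disjoint graphs. -/
def WellFormed : Decomp V → Prop
  | vertex _ _ => True
  | union s t => s.WellFormed ∧ t.WellFormed ∧ ∀ u, s.label u = none ∨ t.label u = none
  | join _ _ t => t.WellFormed
  | relabel _ _ t => t.WellFormed

/-- The set of all labels that are used by the expression. -/
def labels : Decomp V → Finset ℕ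
  | vertex l _ => {l}
  | union s t => s.labels ∪ t.labels
  | join i j t => {i, j} ∪ t.labels
  | relabel i j t => {i, j} ∪ t.labels

/-- The number of labels that are used by the expression. -/
def width (T : Decomp V) : ℕ := T.labels.card

/-- The nodes of the decomposition, each given as the subtree rooted at it. -/
def nodes : Decomp V → Set (Decomp V)
  | vertex l v => {vertex l v}
  | union s t => {union s t} ∪ s.nodes ∪ t.nodes
  | join i j t => {join i j t} ∪ t.nodes
  | relabel i j t => {relabel i j t} ∪ t.nodes

/-- The vertices with label `l` at the root of `t`. -/
def labelClass (t : Decomp V) (l : ℕ) : Set V := {v | t.label v = some l}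

/-- `T` is a clique-width decomposition of `G`: its value is `G` with some labelling. -/
def IsDecompOf (T : Decomp V) (G : SimpleGraph V) : Prop :=
  T.WellFormed ∧ (∀ v, T.label v ≠ none) ∧ T.graph = G

/-- `T` is an `(α, β, δ)`-clique-width decomposition of `G`. -/
def IsABDDecompOf (T : Decomp V) (G : SimpleGraph V) (α β δ : ℕ) : Prop :=
  T.IsDecompOf G ∧
  ∀ t ∈ T.nodes, ∃ L : Finset ℕ, L ⊆ T.labels ∧ L.card ≤ δ ∧
    (G.induce (⋃ l ∈ T.labels \ L, t.labelClass l)).indepNum ≤ α ∧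
    ∀ l ∈ T.labels \ L, numBubbles G (t.labelClass l) ≤ β

end Decomp

/-- The smallest width of an `(α, β, δ)`-clique-width decomposition of `G`, and `⊤` if there is no
such decomposition. -/
noncomputable def cw {V : Type} [DecidableEq V] (α β δ : ℕ) (G : SimpleGraph V) : ℕ∞ :=
  sInf {w : ℕ∞ | ∃ T : Decomp V, T.IsABDDecompOf G α β δ ∧ w = T.width}

/-! ### Model of computation

Programs of the standard imperative language WHILE over binary trees (S-expressions). Every
primitive operation (reading a variable, forming a pair, taking a component of a pair, testing for
`nil`, an assignment) costs one unit of time, as on a random access machine that holds trees as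
linked records. -/

/-- The data that programs work on: `nil` and ordered pairs. -/
abbrev Data : Type := BinaryTree Unit

namespace Data

/-- First component of a pair. -/
def hd : Data → Data
  | .nil => .nil
  | .node _ a _ => a

/-- Second component of a pair. -/
def tl : Data → Data
  | .nil => .nil
  | .node _ _ b => b

end Data

abbrev Store : Type := ℕ → Data

inductive Expr : Type
  | var (x : ℕ) : Expr
  | nil : Expr
  | cons (e₁ e₂ : Expr) : Expr
  | hd (e : Expr) : Expr
  | tl (e : Expr) : Expr

namespace Expr

def eval (σ : Store) : Expr → Data
  | var x => σ x
  | nil => .nil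
  | cons e₁ e₂ => .node () (e₁.eval σ) (e₂.eval σ)
  | hd e => (e.eval σ).hd
  | tl e => (e.eval σ).tl

/-- The number of operations in the evaluation of an expression. -/
def cost : Expr → ℕ
  | var _ => 1
  | nil => 1
  | cons e₁ e₂ => e₁.cost + e₂.cost + 1
  | hd e => e.cost + 1
  | tl e => e.cost + 1

end Expr

/-- Programs: assignments, sequential composition, conditionals and `while` loops. A condition
counts as true if its value is not `nil`. -/
inductive Program : Type
  | assign (x : ℕ) (e : Expr) : Program
  | seq (p q : Program) : Program
  | ite (e : Expr) (p q : Program) : Program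
  | loop (e : Expr) (p : Program) : Program

/-- `Steps p σ σ' n`: started on the store `σ`, the program `p` halts with the store `σ'` after
exactly `n` time steps. -/
inductive Steps : Program → Store → Store → ℕ → Prop
  | assign (x : ℕ) (e : Expr) (σ : Store) :
      Steps (.assign x e) σ (Function.update σ x (e.eval σ)) (e.cost + 1)
  | seq {p q : Program} {σ₁ σ₂ σ₃ : Store} {m n : ℕ} :
      Steps p σ₁ σ₂ m → Steps q σ₂ σ₃ n → Steps (.seq p q) σ₁ σ₃ (m + n)
  | ite_true {e : Expr} {p q : Program} {σ σ' : Store} {n : ℕ} :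
      e.eval σ ≠ .nil → Steps p σ σ' n → Steps (.ite e p q) σ σ' (e.cost + 1 + n)
  | ite_false {e : Expr} {p q : Program} {σ σ' : Store} {n : ℕ} :
      e.eval σ = .nil → Steps q σ σ' n → Steps (.ite e p q) σ σ' (e.cost + 1 + n)
  | loop_true {e : Expr} {p : Program} {σ₁ σ₂ σ₃ : Store} {m n : ℕ} :
      e.eval σ₁ ≠ .nil → Steps p σ₁ σ₂ m → Steps (.loop e p) σ₂ σ₃ n →
      Steps (.loop e p) σ₁ σ₃ (e.cost + 1 + m + n)
  | loop_false {e : Expr} {p : Program} {σ : Store} :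
      e.eval σ = .nil → Steps (.loop e p) σ σ (e.cost + 1)

/-- On input `d` (given in variable `0`, all other variables being `nil`), the program `p` halts
after exactly `n` steps with output `out` (in variable `0`). -/
def Program.Outputs (p : Program) (d out : Data) (n : ℕ) : Prop :=
  ∃ σ : Store, Steps p (Function.update (fun _ => .nil) 0 d) σ n ∧ σ 0 = out

/-- The size of an input. -/
def Data.size (d : Data) : ℕ := d.numLeaves

/-! ### Parameterized problems -/

/-- A parameterized decision problem: instances with their encodings, parameters and the
distinguished set of yes-instances. -/
structure ParamProblem where
  Inst : Type
  encode : Inst → Data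
  param : Inst → ℕ
  Yes : Inst → Prop

/-- Fixed-parameter tractability: one program decides every instance `I` with parameter `k` in time
at most `f k * |I| ^ c`, for a computable function `f` and a constant `c`. -/
def ParamProblem.InFPT (Q : ParamProblem) : Prop :=
  ∃ (p : Program) (f : ℕ → ℕ) (c : ℕ), Computable f ∧
    ∀ I : Q.Inst, ∃ (out : Data) (n : ℕ), p.Outputs (Q.encode I) out n ∧
      (out ≠ .nil ↔ Q.Yes I) ∧ n ≤ f (Q.param I) * (Q.encode I).size ^ c

/-! ### Encodings -/

def encBool : Bool → Data
  | false => .nil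
  | true => .node () .nil .nil

def encList : List Data → Data
  | [] => .nil
  | a :: l => .node () a (encList l)

/-- Binary encoding of natural numbers, least significant bit first. -/
def encNat (n : ℕ) : Data := encList (n.bits.map encBool)

/-- A graph is encoded by its adjacency matrix. -/
noncomputable def encGraph {n : ℕ} (G : SimpleGraph (Fin n)) : Data := by
  classical
  exact encList ((List.finRange n).map fun u =>
    encList ((List.finRange n).map fun v => encBool (decide (G.Adj u v))))

def encVertices {n : ℕ} (l : List (Fin n)) : Data := encList (l.map fun v => encNat v)

def encDecomp {n : ℕ} : Decomp (Fin n) → Data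
  | .vertex l v => encList [encNat 0, encNat l, encNat v]
  | .union s t => encList [encNat 1, encDecomp s, encDecomp t]
  | .join i j t => encList [encNat 2, encNat i, encNat j, encDecomp t]
  | .relabel i j t => encList [encNat 3, encNat i, encNat j, encDecomp t]

/-- A graph together with a clique-width decomposition. -/
noncomputable def encInput {n : ℕ} (G : SimpleGraph (Fin n)) (T : Decomp (Fin n)) : Data :=
  encList [encGraph G, encDecomp T]

/-! ### The problem -/

/-- An instance of MaxCut: a graph `G` with `cw α β δ G < ⊤`, provided with an
`(α, β, δ)`-clique-width decomposition of smallest width, and a target `m`. -/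
structure MaxCutInstance (α β δ : ℕ) where
  n : ℕ
  G : SimpleGraph (Fin n)
  T : Decomp (Fin n)
  isDecomp : T.IsABDDecompOf G α β δ
  optimal : (T.width : ℕ∞) = cw α β δ G
  m : ℕ

/-- MaxCut parameterized by `cw α β δ G`: is there a cut of size at least `m`? -/
noncomputable def maxCutByCW (α β δ : ℕ) : ParamProblem where
  Inst := MaxCutInstance α β δ
  encode I := encList [encGraph I.G, encDecomp I.T, encNat I.m]
  param I := (cw α β δ I.G).toNat
  Yes I := ∃ S : Set (Fin I.n), I.m ≤ cutSize I.G S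

end MaxCutCW

/-!
The algorithm is dynamic programming over the decomposition `T`. The table of a node is a list of
vertex sets `W` of the labelled graph at that node, at least one of which is "as good as" a fixed
maximum cut `S`: it has as many vertices with each label as `S`, and it cuts at least as many edges
within the node (`Dominates`). Relabelling and joining keep the tables unchanged, since the sizes of
cuts are always measured in the whole graph `G`. At a disjoint union two such sets for the children
combine, because adjacency in `G` between the two sides depends only on the labels
(`labelAdj_nodeLab`), so that the number of cut edges between the sides depends only on the label
counts (`cross_eq_of_counts`).

The tables must remain small, so at a union only those combinations of label counts are tried that
come from a small family of guesses `X` for the intersection of `S` with the node. For this the cut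
`S` is chosen in a normal form (`exists_normalized_maxCut`): within each bubble it consists of the
last vertices, and any two bubbles that it splits are nonadjacent. Outside of the exceptional labels
`L` there are at most `β * w(T)` bubbles, and at most `α` of them are split, because representatives
of the split bubbles form an independent set. Hence `S` is described there by one bit for each bubble
and by at most `α` suffixes of bubbles. In the at most `δ` classes in `L` only the number of
vertices matters, so that a suffix of the class can stand for its intersection with `S`
(`exists_guess`). This makes `2 ^ (β * w(T))` times polynomially many guesses. For each of them the
best sets with the same label counts are looked up in the tables of the children, which are stored as
tries with the unary label counts as keys, so that a search takes polynomial time, however large the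
table is.

The size of the input bounds `w(T)`, and for fixed `α`, `β` and `δ` the exponent of the polynomial
factor may depend on `α`. The polynomially many choices for the split bubbles, and with them the
factor `(β * w(T)) ^ O(α)`, are therefore part of the polynomial factor, and the absolute constant
`c` can be taken to be `0`.

Running times are verified compositionally: `CT f t` says that some program computes `f` in time `t`
on top of a stack, polynomial-time computability (`Poly`) is closed under the usual operations on
lists, and only the table operations need explicit bounds (`ct_table`, `length_nodeTable_le`,
`ct_machine`, `ct_solve`).
-/


/-! ### Programs that act on the top of a stack -/

namespace MaxCutCW

open Function

/-- Types whose elements are represented by trees. -/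
class Enc (α : Type) where
  /-- The tree that represents an element. -/
  enc : α → Data

open Enc (enc)

instance : Enc Bool := ⟨encBool⟩
instance : Enc ℕ := ⟨encNat⟩
instance : Enc Unit := ⟨fun _ => .nil⟩
instance {α : Type} [Enc α] : Enc (List α) := ⟨fun l => encList (l.map enc)⟩
instance {α β : Type} [Enc α] [Enc β] : Enc (α × β) := ⟨fun x => .node () (enc x.1) (enc x.2)⟩

/-- The store `σ` with variable `0` set to a stack with top element `a` and remainder `r`. -/
def top (σ : Store) (a r : Data) : Store := update σ 0 (.node () a r)

/-- `p` replaces the top `a` of the stack by `b` in at most `n` steps, and has no other effect. -/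
def Runs (p : Program) (a b : Data) (n : ℕ) : Prop :=
  ∀ (σ : Store) (r : Data), ∃ m ≤ n, Steps p (top σ a r) (top σ b r) m

/-- Some program computes `f`, in time at most `t`. All programs built here use variable `0` only,
as a stack whose top element is the argument; the rest of the stack holds the intermediate results
of the surrounding computation. -/
def CT {α β : Type} [Enc α] [Enc β] (f : α → β) (t : α → ℕ) : Prop :=
  ∃ p : Program, ∀ a, Runs p (enc a) (enc (f a)) (t a)

@[simp] theorem top_zero (σ : Store) (a r : Data) : top σ a r 0 = .node () a r := by
  simp [top]

@[simp] theorem update_top (σ : Store) (a r a' r' : Data) :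
    update (top σ a r) 0 (.node () a' r') = top σ a' r' := by
  simp [top]

/-- The stack as an expression. -/
abbrev Expr.st : Expr := .var 0

theorem Runs.mono {p : Program} {a b : Data} {n m : ℕ} (h : Runs p a b n) (hm : n ≤ m) :
    Runs p a b m := fun σ r => by
  obtain ⟨k, hk, hs⟩ := h σ r
  exact ⟨k, hk.trans hm, hs⟩

theorem Runs.seq {p q : Program} {a b c : Data} {n m : ℕ} (h : Runs p a b n) (h' : Runs q b c m) :
    Runs (.seq p q) a c (n + m) := fun σ r => by
  obtain ⟨k, hk, hs⟩ := h σ r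
  obtain ⟨k', hk', hs'⟩ := h' σ r
  exact ⟨k + k', by omega, hs.seq hs'⟩

theorem steps_assign_top {e : Expr} {σ : Store} {a r a' r' : Data}
    (h : e.eval (top σ a r) = .node () a' r') :
    Steps (.assign 0 e) (top σ a r) (top σ a' r') (e.cost + 1) := by
  have := Steps.assign 0 e (top σ a r)
  rwa [h, update_top] at this

theorem Runs.assign {e : Expr} {a b : Data}
    (h : ∀ σ r, e.eval (top σ a r) = .node () b r) : Runs (.assign 0 e) a b (e.cost + 1) :=
  fun σ r => ⟨_, le_rfl, steps_assign_top (h σ r)⟩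

/-- Run `p` and then `q` on copies of the top element and form the pair of the results. -/
def pairProg (p q : Program) : Program :=
  .seq (.assign 0 (.cons (.hd .st) .st)) <| .seq p <|
  .seq (.assign 0 (.cons (.hd (.tl .st)) (.cons (.hd .st) (.tl (.tl .st))))) <| .seq q <|
  .assign 0 (.cons (.cons (.hd (.tl .st)) (.hd .st)) (.tl (.tl .st)))

theorem Runs.pair {p q : Program} {a b c : Data} {n m : ℕ} (hp : Runs p a b n)
    (hq : Runs q a c m) : Runs (pairProg p q) a (.node () b c) (n + m + 40) := fun σ r => by
  obtain ⟨k, hk, hs⟩ := hp σ (.node () a r)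
  obtain ⟨k', hk', hs'⟩ := hq σ (.node () b r)
  refine ⟨_, ?_, (steps_assign_top (r' := .node () a r) ?_).seq <| hs.seq <|
    (steps_assign_top (r' := .node () b r) ?_).seq <| hs'.seq <| steps_assign_top ?_⟩
  · simp [Expr.cost]; omega
  all_goals simp [Expr.eval, Data.hd, Data.tl]

/-- Run `c` on a copy of the top element and branch on the result. -/
def iteProg (c p q : Program) : Program :=
  .seq (.assign 0 (.cons (.hd .st) .st)) <| .seq c <|
  .ite (.hd .st) (.seq (.assign 0 (.tl .st)) p) (.seq (.assign 0 (.tl .st)) q)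

theorem Runs.ite {c p q : Program} {a b : Data} {t : Bool} {n m : ℕ}
    (hc : Runs c a (encBool t) n) (hp : t = true → Runs p a b m) (hq : t = false → Runs q a b m) :
    Runs (iteProg c p q) a b (n + m + 20) := fun σ r => by
  obtain ⟨k, hk, hs⟩ := hc σ (.node () a r)
  cases t
  · obtain ⟨k', hk', hs'⟩ := hq rfl σ r
    refine ⟨_, ?_, (steps_assign_top (r' := .node () a r) ?_).seq <| hs.seq <|
      .ite_false ?_ <| (steps_assign_top ?_).seq hs'⟩
    · simp [Expr.cost]; omega
    all_goals simp [Expr.eval, Data.hd, Data.tl, encBool]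
  · obtain ⟨k', hk', hs'⟩ := hp rfl σ r
    refine ⟨_, ?_, (steps_assign_top (r' := .node () a r) ?_).seq <| hs.seq <|
      .ite_true ?_ <| (steps_assign_top ?_).seq hs'⟩
    · simp [Expr.cost]; omega
    all_goals simp [Expr.eval, Data.hd, Data.tl, encBool]

/-- The time of a fold whose step `s` takes time `ts`, with constant overhead `c` per element. -/
def foldTime {β γ : Type} (s : β → γ → β) (ts : β → γ → ℕ) (c : ℕ) : β → List γ → ℕ
  | _, [] => c
  | b, a :: l => c + ts b a + foldTime s ts c (s b a) l

/-- A bound for the time of a fold from a bound for its steps. The invariant `I` relates the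
accumulated value to the remainder of the list. -/
theorem foldTime_le {β γ : Type} {s : β → γ → β} {ts : β → γ → ℕ} {c K : ℕ} (I : β → List γ → Prop)
    (hI : ∀ b a l, I b (a :: l) → I (s b a) l) (hts : ∀ b a l, I b (a :: l) → ts b a ≤ K)
    (b : β) (l : List γ) (hb : I b l) : foldTime s ts c b l ≤ c + (c + K) * l.length := by
  induction l generalizing b with
  | nil => simp [foldTime]
  | cons a l ih =>
    have := ih _ (hI b a l hb)
    have := hts b a l hb
    simp only [foldTime, List.length_cons]
    rw [Nat.mul_add]
    omega

section CT

variable {α β γ δ : Type} [Enc α] [Enc β] [Enc γ] [Enc δ]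

theorem CT.mono {f : α → β} {t t' : α → ℕ} (h : CT f t) (ht : ∀ a, t a ≤ t' a) : CT f t' := by
  obtain ⟨p, hp⟩ := h
  exact ⟨p, fun a => (hp a).mono (ht a)⟩

theorem CT.congr {f g : α → β} {t : α → ℕ} (h : CT f t) (hg : ∀ a, f a = g a) : CT g t := by
  rwa [← funext hg]

theorem CT.comp {f : α → β} {g : β → γ} {t : α → ℕ} {u : β → ℕ} (hg : CT g u) (hf : CT f t) :
    CT (fun a => g (f a)) (fun a => t a + u (f a)) := by
  obtain ⟨p, hp⟩ := hf
  obtain ⟨q, hq⟩ := hg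
  exact ⟨.seq p q, fun a => (hp a).seq (hq (f a))⟩

theorem CT.pair {f : α → β} {g : α → γ} {t u : α → ℕ} (hf : CT f t) (hg : CT g u) :
    CT (fun a => (f a, g a)) (fun a => t a + u a + 40) := by
  obtain ⟨p, hp⟩ := hf
  obtain ⟨q, hq⟩ := hg
  exact ⟨pairProg p q, fun a => (hp a).pair (hq a)⟩

/-- A conditional; only the time of the selected branch counts. -/
theorem CT.ite' {c : α → Bool} {f g : α → β} {t u v : α → ℕ} (hc : CT c t) (hf : CT f u)
    (hg : CT g v) : CT (fun a => if c a then f a else g a)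
      (fun a => t a + (if c a then u a else v a) + 20) := by
  obtain ⟨r, hr⟩ := hc
  obtain ⟨p, hp⟩ := hf
  obtain ⟨q, hq⟩ := hg
  refine ⟨iteProg r p q, fun a => (hr a).ite (fun h => ?_) (fun h => ?_)⟩
  · simpa [h] using (hp a)
  · simpa [h] using (hq a)

theorem CT.ite {c : α → Bool} {f g : α → β} {t u v : α → ℕ} (hc : CT c t) (hf : CT f u)
    (hg : CT g v) : CT (fun a => if c a then f a else g a) (fun a => t a + (u a + v a) + 20) :=
  (CT.ite' hc hf hg).mono fun a => by split <;> omega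

/-- Functions that are given by a single expression in the top of the stack. -/
theorem CT.expr {f : α → β} (e : Expr)
    (h : ∀ σ r a, e.eval (top σ (enc a) r) = enc (f a)) : CT f (fun _ => e.cost + 4) :=
  ⟨.assign 0 (.cons e (.tl .st)), fun a => (Runs.assign fun σ r => by
    simp [Expr.eval, h, Data.tl]).mono (by simp [Expr.cost])⟩

/-- Iteration of `step` as long as the condition `C` holds; `T` bounds the running time. -/
theorem CT.loop {F : α → α} {T : α → ℕ} (e : Expr) (C : α → Prop) (step : α → α) (ts : α → ℕ)
    (p : Program) (he : ∀ a σ r, e.eval (top σ (enc a) r) ≠ .nil ↔ C a)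
    (hp : ∀ a, C a → Runs p (enc a) (enc (step a)) (ts a))
    (hF : ∀ a, C a → F a = F (step a)) (hF' : ∀ a, ¬ C a → F a = a)
    (hT : ∀ a, C a → e.cost + 1 + ts a + T (step a) ≤ T a) (hT' : ∀ a, ¬ C a → e.cost + 1 ≤ T a) :
    CT F T := by
  refine ⟨.loop e p, fun a σ r => ?_⟩
  induction h : T a using Nat.strong_induction_on generalizing a with
  | _ n ih =>
    by_cases hC : C a
    · obtain ⟨k, hk, hs⟩ := hp a hC σ r
      have h1 := hT a hC
      obtain ⟨k', hk', hs'⟩ := ih (T (step a)) (by omega) (step a) rfl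
      refine ⟨_, ?_, .loop_true ((he a σ r).2 hC) hs (by rw [hF a hC]; exact hs')⟩
      omega
    · refine ⟨_, ?_, by rw [hF' a hC]; exact .loop_false (not_not.1 fun h' => hC ((he a σ r).1 h'))⟩
      have := hT' a hC
      omega

theorem CT.id : CT (fun a : α => a) (fun _ => 6) :=
  (CT.expr (.hd .st) (by simp [Expr.eval, Data.hd])).mono (by simp [Expr.cost])

theorem CT.fst : CT (fun a : α × β => a.1) (fun _ => 8) :=
  (CT.expr (.hd (.hd .st)) (by simp [Expr.eval, Data.hd, enc])).mono (by simp [Expr.cost])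

theorem CT.snd : CT (fun a : α × β => a.2) (fun _ => 8) :=
  (CT.expr (.tl (.hd .st)) (by simp [Expr.eval, Data.hd, Data.tl, enc])).mono
    (by simp [Expr.cost])

/-- The expression with a given constant value. -/
def constExpr : Data → Expr
  | .nil => .nil
  | .node _ a b => .cons (constExpr a) (constExpr b)

theorem constExpr_eval (d : Data) (σ : Store) : (constExpr d).eval σ = d := by
  induction d with
  | nil => rfl
  | node _ a b iha ihb => simp [constExpr, Expr.eval, iha, ihb]

theorem CT.const (b : β) : ∃ k, CT (fun _ : α => b) (fun _ => k) :=
  ⟨_, CT.expr (constExpr (enc b)) fun _ _ _ => constExpr_eval _ _⟩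

@[simp] theorem enc_nil : enc ([] : List α) = .nil := rfl
@[simp] theorem enc_cons (a : α) (l : List α) : enc (a :: l) = .node () (enc a) (enc l) := rfl
@[simp] theorem enc_pair (a : α) (b : β) : enc (a, b) = .node () (enc a) (enc b) := rfl
@[simp] theorem enc_true : enc true = .node () .nil .nil := rfl
@[simp] theorem enc_false : enc false = .nil := rfl

theorem CT.cons : CT (fun x : α × List α => x.1 :: x.2) (fun _ => 6) :=
  (CT.expr (.hd .st) (by simp [Expr.eval, Data.hd])).mono (by simp [Expr.cost])

theorem CT.tail : CT (fun l : List α => l.tail) (fun _ => 8) :=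
  (CT.expr (.tl (.hd .st)) (by
    rintro _ _ (_ | ⟨a, l⟩) <;> simp [Expr.eval, Data.hd, Data.tl])).mono
    (by simp [Expr.cost])

/-- The head of a list; the empty list yields the default value, provided that its code is
`nil`. -/
theorem CT.headD (d : α) (hd : enc d = .nil) : CT (fun l : List α => l.headD d) (fun _ => 8) :=
  (CT.expr (.hd (.hd .st)) (by
    rintro _ _ (_ | ⟨a, l⟩) <;> simp [Expr.eval, Data.hd, hd])).mono
    (by simp [Expr.cost])

theorem CT.isEmpty : CT (fun l : List α => l.isEmpty) (fun _ => 30) := by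
  refine ⟨.ite (.hd .st) (.assign 0 (.cons .nil (.tl .st)))
    (.assign 0 (.cons (.cons .nil .nil) (.tl .st))), fun a σ r => ?_⟩
  cases a with
  | nil => exact ⟨_, by simp [Expr.cost], .ite_false (by simp [Expr.eval, Data.hd])
      (steps_assign_top (by simp [Expr.eval, Data.tl]))⟩
  | cons a l => exact ⟨_, by simp [Expr.cost], .ite_true (by simp [Expr.eval, Data.hd])
      (steps_assign_top (by simp [Expr.eval, Data.tl]))⟩

/-- A left fold over a list, whose step may use a context. -/
theorem CT.foldl {s : α → β → γ → β} {ts : α × (β × γ) → ℕ}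
    (hs : CT (fun x : α × (β × γ) => s x.1 x.2.1 x.2.2) ts) :
    CT (fun x : α × (β × List γ) => x.2.2.foldl (s x.1) x.2.1)
      (fun x => foldTime (s x.1) (fun b c => ts (x.1, b, c)) 100 x.2.1 x.2.2 + 20) := by
  obtain ⟨p, hp⟩ := hs
  let e : Expr := .tl (.tl (.hd .st))
  -- put the context, the accumulated value and the first element on top of the stack, apply `p`, and
  -- replace the old accumulated value and the list
  let q : Program :=
    .seq (.assign 0 (.cons (.cons (.hd (.hd .st)) (.cons (.hd (.tl (.hd .st)))
      (.hd (.tl (.tl (.hd .st)))))) .st)) <| .seq p <|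
    .assign 0 (.cons (.cons (.hd (.hd (.tl .st))) (.cons (.hd .st)
      (.tl (.tl (.tl (.hd (.tl .st))))))) (.tl (.tl .st)))
  have hloop : CT (fun x : α × (β × List γ) => (x.1, x.2.2.foldl (s x.1) x.2.1, ([] : List γ)))
      (fun x => foldTime (s x.1) (fun b c => ts (x.1, b, c)) 100 x.2.1 x.2.2) := by
    refine CT.loop e (fun x => x.2.2 ≠ [])
      (fun x => match x.2.2 with | [] => x | c :: l => (x.1, s x.1 x.2.1 c, l))
      (fun x => match x.2.2 with | [] => 0 | c :: _ => ts (x.1, x.2.1, c) + 80) q ?_ ?_ ?_ ?_ ?_ ?_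
    · rintro ⟨a, b, _ | ⟨c, l⟩⟩ σ r <;> simp [e, Expr.eval, Data.hd, Data.tl]
    · rintro ⟨a, b, _ | ⟨c, l⟩⟩ hl σ r
      · simp at hl
      · obtain ⟨k, hk, hs⟩ := hp (a, b, c) σ (.node () (enc (a, b, c :: l)) r)
        refine ⟨_, ?_, (steps_assign_top (r' := .node () (enc (a, b, c :: l)) r) ?_).seq <|
          hs.seq <| steps_assign_top ?_⟩
        · simp [Expr.cost]; omega
        all_goals simp [Expr.eval, Data.hd, Data.tl]
    · rintro ⟨a, b, _ | ⟨c, l⟩⟩ hl <;> simp at hl ⊢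
    · rintro ⟨a, b, _ | ⟨c, l⟩⟩ hl <;> simp at hl ⊢
    · rintro ⟨a, b, _ | ⟨c, l⟩⟩ hl
      · simp at hl
      · simp [foldTime, e, Expr.cost]; omega
    · rintro ⟨a, b, _ | ⟨c, l⟩⟩ hl
      · simp [foldTime, e, Expr.cost]
      · simp at hl
  exact (CT.comp (CT.comp CT.fst CT.snd) hloop).mono fun x => by simp

end CT

end MaxCutCW

/-! ### Polynomial-time functions -/

namespace MaxCutCW

open Enc (enc)

/-- The size of the representation of an element. -/
def sz {α : Type} [Enc α] (a : α) : ℕ := (enc a).size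

theorem eval_mono (P : Polynomial ℕ) {m n : ℕ} (h : m ≤ n) : P.eval m ≤ P.eval n := by
  simp only [Polynomial.eval_eq_sum_range]
  gcongr

section
variable {α β γ δ : Type} [Enc α] [Enc β] [Enc γ] [Enc δ]

theorem sz_pos (a : α) : 0 < sz a := BinaryTree.numLeaves_pos _

@[simp] theorem sz_pair (a : α) (b : β) : sz (a, b) = sz a + sz b := rfl
@[simp] theorem sz_nil : sz ([] : List α) = 1 := rfl
@[simp] theorem sz_cons (a : α) (l : List α) : sz (a :: l) = sz a + sz l := rfl

theorem sz_fst_le (x : α × β) : sz x.1 ≤ sz x := by cases x; simp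
theorem sz_snd_le (x : α × β) : sz x.2 ≤ sz x := by cases x; simp

theorem sz_eq_sum (l : List α) : sz l = (l.map sz).sum + 1 := by
  induction l with
  | nil => rfl
  | cons a l ih => simp [ih, Nat.add_assoc]

theorem length_lt_sz (l : List α) : l.length < sz l := by
  induction l with
  | nil => simp
  | cons a l ih => have := sz_pos a; simp; omega

theorem sz_mem_lt {a : α} {l : List α} (h : a ∈ l) : sz a < sz l := by
  have := List.single_le_sum (l := l.map sz) (by simp) _ (List.mem_map_of_mem h)
  rw [sz_eq_sum]; omega

theorem sz_append (l l' : List α) : sz (l ++ l') + 1 = sz l + sz l' := by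
  simp [sz_eq_sum]; omega

theorem sz_reverse (l : List α) : sz l.reverse = sz l := by
  simp [sz_eq_sum]

theorem sz_le_of_sublist {l l' : List α} (h : l.Sublist l') : sz l ≤ sz l' := by
  induction h with
  | slnil => rfl
  | cons a _ ih => simp; omega
  | cons_cons a _ ih => simp; omega

theorem sz_le_of_forall {l : List α} {K : ℕ} (h : ∀ a ∈ l, sz a ≤ K) : sz l ≤ l.length * K + 1 := by
  rw [sz_eq_sum]
  have := List.sum_le_card_nsmul (l.map sz) K (by simpa using h)
  simpa using this

/-! ### Linear-time list functions -/

theorem CT.revAppend : ∃ K, CT (fun x : List α × List α => x.1.reverse ++ x.2)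
    (fun x => K * (x.1.length + 1)) := by
  have h := CT.foldl (α := Unit) (β := List α) (γ := α) (s := fun _ b a => a :: b)
    ((CT.comp CT.cons (CT.pair (CT.comp CT.snd CT.snd) (CT.comp CT.fst CT.snd))))
  obtain ⟨k, hk⟩ := CT.const (α := List α × List α) ()
  have h' := CT.comp h (CT.pair hk (CT.pair CT.snd CT.fst))
  refine ⟨k + 1000, (h'.congr fun x => ?_).mono fun x => ?_⟩
  · simp
  · refine (Nat.add_le_add_left (Nat.add_le_add_right (foldTime_le (K := 78) (fun _ _ => True)
      (by simp) (by simp) _ _ trivial) _) _).trans ?_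
    nlinarith

theorem CT.reverse : ∃ K, CT (fun x : List α => x.reverse) (fun x => K * (x.length + 1)) := by
  obtain ⟨K, hK⟩ := CT.revAppend (α := α)
  obtain ⟨k, hk⟩ := CT.const (α := List α) ([] : List α)
  refine ⟨K + k + 100, ((CT.comp hK (CT.pair CT.id hk)).congr fun x => by simp).mono fun x => ?_⟩
  simp; nlinarith

theorem CT.append : ∃ K, CT (fun x : List α × List α => x.1 ++ x.2)
    (fun x => K * (x.1.length + 1)) := by
  obtain ⟨K, hK⟩ := CT.revAppend (α := α)
  obtain ⟨K', hK'⟩ := CT.reverse (α := α)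
  refine ⟨K + K' + 100, ((CT.comp hK (CT.pair (CT.comp hK' CT.fst) CT.snd)).congr
    fun x => by simp).mono fun x => ?_⟩
  simp; nlinarith

/-- The time of a `flatMap`: proportional to the number of elements of the two lists and the time
of the evaluations of the function. -/
theorem CT.flatMap {f : α → γ → List δ} {tf : α × γ → ℕ}
    (hf : CT (fun x : α × γ => f x.1 x.2) tf) :
    ∃ K, CT (fun x : α × List γ => x.2.flatMap (f x.1))
      (fun x => K * (1 + (x.2.map fun c => tf (x.1, c) + (f x.1 c).length + 1).sum)) := by
  obtain ⟨K, hK⟩ := CT.revAppend (α := δ)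
  obtain ⟨K', hK'⟩ := CT.reverse (α := δ)
  obtain ⟨k, hk⟩ := CT.const (α := α × List γ) ([] : List δ)
  have h := CT.foldl (α := α) (β := List δ) (γ := γ) (s := fun a b c => (f a c).reverse ++ b)
    (CT.comp hK (CT.pair (CT.comp hf (CT.pair CT.fst (CT.comp CT.snd CT.snd)))
      (CT.comp CT.fst CT.snd)))
  have h' := CT.comp hK' (CT.comp h (CT.pair CT.fst (CT.pair hk CT.snd)))
  have e : ∀ (a : α) (l : List γ) (b : List δ),
      l.foldl (fun b c => (f a c).reverse ++ b) b = (l.flatMap (f a)).reverse ++ b := by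
    intro a l
    induction l with
    | nil => simp
    | cons c l ih => intro b; simp [ih]
  refine ⟨K + K' + k + 1000, (h'.congr fun x => ?_).mono fun x => ?_⟩
  · simp [e]
  · obtain ⟨a, l⟩ := x
    simp only [e, List.length_append, List.length_reverse, List.length_nil, List.length_flatMap]
    have key : ∀ b, foldTime (fun b c => (f a c).reverse ++ b)
        (fun b c => 8 + (8 + 8) + 40 + tf (a, c) + (8 + 8) + 40 + K * ((f a c).length + 1)) 100 b l ≤
        100 + (K + 300) * (l.map fun c => tf (a, c) + (f a c).length + 1).sum := by
      induction l with
      | nil => simp [foldTime]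
      | cons c l ih =>
        intro b
        have := ih ((f a c).reverse ++ b)
        simp only [foldTime, List.map_cons, List.sum_cons]
        nlinarith
    have h1 := key []
    have h2 : (l.map fun c => (f a c).length).sum ≤
        (l.map fun c => tf (a, c) + (f a c).length + 1).sum := by
      apply List.sum_le_sum
      intro c _
      omega
    set S := (l.map fun c => tf (a, c) + (f a c).length + 1).sum
    set S' := (l.map fun c => (f a c).length).sum
    refine (Nat.add_le_add (Nat.add_le_add_left (Nat.add_le_add_right h1 20) _) le_rfl).trans ?_
    nlinarith

/-! ### Closure properties of polynomial time -/

/-- `f` is computed in polynomial time, and its values have polynomial size. The second condition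
does not follow from the first one: programs can share subtrees. -/
@[fun_prop] def Poly (f : α → β) : Prop :=
  ∃ P : Polynomial ℕ, CT f (fun a => P.eval (sz a)) ∧ ∀ a, sz (f a) ≤ P.eval (sz a)

theorem Poly.mk' {f : α → β} (P Q : Polynomial ℕ) (h : CT f (fun a => P.eval (sz a)))
    (h' : ∀ a, sz (f a) ≤ Q.eval (sz a)) : Poly f :=
  ⟨P + Q, h.mono fun a => by simp, fun a => (h' a).trans (by simp)⟩

theorem Poly.congr {f g : α → β} (h : Poly f) (hg : ∀ a, f a = g a) : Poly g := by
  rwa [← funext hg]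

@[fun_prop] theorem Poly.id : Poly (fun a : α => a) :=
  .mk' 6 .X (CT.id.mono fun a => by simp) (by simp)

@[fun_prop] theorem Poly.const (b : β) : Poly (fun _ : α => b) := by
  obtain ⟨k, hk⟩ := CT.const (α := α) b
  exact .mk' (.C k) (.C (sz b)) (hk.mono fun a => by simp) (by simp)

@[fun_prop] theorem Poly.comp {g : β → γ} {f : α → β} (hg : Poly g) (hf : Poly f) :
    Poly (fun a => g (f a)) := by
  obtain ⟨P, hP, hP'⟩ := hf
  obtain ⟨Q, hQ, hQ'⟩ := hg
  refine .mk' (P + Q.comp P) (Q.comp P) ((hQ.comp hP).mono fun a => ?_) fun a => ?_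
  · simpa [Polynomial.eval_comp] using eval_mono Q (hP' a)
  · simpa [Polynomial.eval_comp] using (hQ' _).trans (eval_mono Q (hP' a))

@[fun_prop] theorem Poly.pair {f : α → β} {g : α → γ} (hf : Poly f) (hg : Poly g) :
    Poly (fun a => (f a, g a)) := by
  obtain ⟨P, hP, hP'⟩ := hf
  obtain ⟨Q, hQ, hQ'⟩ := hg
  refine .mk' (P + Q + 40) (P + Q) ((hP.pair hQ).mono fun a => by simp) fun a => ?_
  have := hP' a
  have := hQ' a
  simp; omega

@[fun_prop] theorem Poly.fst {f : α → β × γ} (hf : Poly f) : Poly (fun a => (f a).1) :=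
  Poly.comp (g := fun x : β × γ => x.1)
    (.mk' 8 .X (CT.fst.mono fun a => by simp) (by simp)) hf

@[fun_prop] theorem Poly.snd {f : α → β × γ} (hf : Poly f) : Poly (fun a => (f a).2) :=
  Poly.comp (g := fun x : β × γ => x.2)
    (.mk' 8 .X (CT.snd.mono fun a => by simp) (by simp)) hf

@[fun_prop] theorem Poly.cons {f : α → β} {g : α → List β} (hf : Poly f) (hg : Poly g) :
    Poly (fun a => f a :: g a) :=
  Poly.comp (g := fun x : β × List β => x.1 :: x.2)
    (.mk' 6 .X (CT.cons.mono fun a => by simp) (by simp)) (hf.pair hg)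

@[fun_prop] theorem Poly.tail {f : α → List β} (hf : Poly f) : Poly (fun a => (f a).tail) :=
  Poly.comp (g := fun x : List β => x.tail) (.mk' 8 .X (CT.tail.mono fun a => by simp)
    (fun l => by cases l <;> simp)) hf

theorem Poly.headD {f : α → List β} (d : β) (hd : enc d = .nil) (hf : Poly f) :
    Poly (fun a => (f a).headD d) :=
  Poly.comp (g := fun x : List β => x.headD d) (.mk' 8 .X ((CT.headD d hd).mono fun a => by simp)
    (fun l => by cases l <;> simp [sz, hd, Data.size])) hf

@[fun_prop] theorem Poly.headD_nil {f : α → List (List β)} (hf : Poly f) :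
    Poly (fun a => (f a).headD []) := hf.headD [] rfl

theorem sz_bool_le (b : Bool) : sz b ≤ 2 := by
  cases b <;> simp [sz, Data.size]

@[fun_prop] theorem Poly.isEmpty {f : α → List β} (hf : Poly f) : Poly (fun a => (f a).isEmpty) :=
  Poly.comp (g := fun x : List β => x.isEmpty) (.mk' 30 2 (CT.isEmpty.mono fun a => by simp)
    (fun l => by simpa using sz_bool_le _)) hf

@[fun_prop] theorem Poly.cond {c : α → Bool} {f g : α → β} (hc : Poly c) (hf : Poly f)
    (hg : Poly g) : Poly (fun a => if c a then f a else g a) := by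
  obtain ⟨P, hP, hP'⟩ := hf
  obtain ⟨Q, hQ, hQ'⟩ := hg
  obtain ⟨R, hR, hR'⟩ := hc
  refine .mk' (R + (P + Q) + 20) (P + Q) ((hR.ite hP hQ).mono fun a => by simp) fun a => ?_
  have := hP' a
  have := hQ' a
  split <;> simp <;> omega

/-- A left fold. A bound for the sizes of the partial results has to be given, because steps of
polynomial size can add up to a result of exponential size. -/
theorem Poly.foldl {l : α → List γ} {b : α → β} {s : α → β → γ → β} (hl : Poly l) (hb : Poly b)
    (hs : Poly (fun x : α × (β × γ) => s x.1 x.2.1 x.2.2)) (Q : Polynomial ℕ)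
    (hQ : ∀ a l₁, l₁ <+: l a → sz (l₁.foldl (s a) (b a)) ≤ Q.eval (sz a)) :
    Poly (fun a => (l a).foldl (s a) (b a)) := by
  obtain ⟨P, hP, hP'⟩ := hs
  obtain ⟨R, hR, hR'⟩ := hl
  obtain ⟨B, hB, hB'⟩ := hb
  refine .mk' (R + B + 500 + (200 + P.comp (.X + Q + R)) * R) Q
    (((CT.foldl hP).comp (CT.id.pair (hB.pair hR))).mono fun a => ?_) fun a =>
      hQ a _ (List.prefix_refl _)
  refine (Nat.add_le_add_left (Nat.add_le_add_right (foldTime_le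
    (K := P.eval (sz a + Q.eval (sz a) + R.eval (sz a)))
    (fun b' l' => ∃ l₁, l₁ ++ l' = l a ∧ b' = l₁.foldl (s a) (b a)) ?_ ?_ _ _ ?_) _) _).trans ?_
  · rintro b' c l' ⟨l₁, h1, rfl⟩
    exact ⟨l₁ ++ [c], by simp [h1], by simp⟩
  · rintro b' c l' ⟨l₁, h1, rfl⟩
    apply eval_mono
    have h2 := hQ a l₁ ⟨_, h1⟩
    have h3 : sz c < sz (l a) := sz_mem_lt (by rw [← h1]; simp)
    have h4 := hR' a
    simp; omega
  · exact ⟨[], by simp, by simp⟩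
  · have h1 : (l a).length ≤ R.eval (sz a) := ((length_lt_sz _).le.trans (hR' a))
    simp [Polynomial.eval_comp]
    nlinarith [Nat.mul_le_mul_left (100 + P.eval (sz a + Q.eval (sz a) + R.eval (sz a))) h1]

@[fun_prop] theorem Poly.flatMap {l : α → List γ} {f : α → γ → List δ} (hl : Poly l)
    (hf : Poly (fun x : α × γ => f x.1 x.2)) : Poly (fun a => (l a).flatMap (f a)) := by
  obtain ⟨P, hP, hP'⟩ := hf
  obtain ⟨R, hR, hR'⟩ := hl
  obtain ⟨K, hK⟩ := CT.flatMap hP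
  refine .mk' (R + 100 + .C K * (1 + R * (2 * P.comp (.X + R) + 1))) (R * P.comp (.X + R) + 1)
    ((hK.comp (CT.id.pair hR)).mono fun a => ?_) fun a => ?_
  · have h1 : ((l a).map fun c => P.eval (sz (a, c)) + (f a c).length + 1).sum ≤
        R.eval (sz a) * (2 * P.eval (sz a + R.eval (sz a)) + 1) := by
      refine (List.sum_le_card_nsmul _ (2 * P.eval (sz a + R.eval (sz a)) + 1) ?_).trans ?_
      · simp only [List.mem_map, forall_exists_index, and_imp]
        rintro _ c hc rfl
        have h2 := eval_mono P (show sz (a, c) ≤ sz a + R.eval (sz a) by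
          have := (sz_mem_lt hc).le.trans (hR' a); simpa)
        have h3 := (length_lt_sz _).le.trans (hP' (a, c))
        simp at h3
        simp at h2 ⊢; omega
      · simpa only [List.length_map, smul_eq_mul] using
          Nat.mul_le_mul_right _ ((length_lt_sz _).le.trans (hR' a))
    have := Nat.mul_le_mul_left K h1
    simp [Polynomial.eval_comp, Nat.mul_add] at this ⊢; omega
  · have h1 : ∀ l' : List γ, (∀ c ∈ l', c ∈ l a) →
        sz (l'.flatMap (f a)) ≤ l'.length * P.eval (sz a + R.eval (sz a)) + 1 := by
      intro l' hl'
      induction l' with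
      | nil => simp
      | cons c l' ih =>
        have h2 := eval_mono P (show sz (a, c) ≤ sz a + R.eval (sz a) by
          have := (sz_mem_lt (hl' c (by simp))).le.trans (hR' a); simpa)
        have h3 := hP' (a, c)
        have h4 := ih fun c hc => hl' c (by simp [hc])
        have h5 := sz_append (f a c) (l'.flatMap (f a))
        simp only [List.flatMap_cons, List.length_cons, Nat.add_mul]
        simp at h2 h3 h4 h5
        omega
    refine (h1 _ fun _ h => h).trans ?_
    simpa [Polynomial.eval_comp] using
      Nat.mul_le_mul_right _ ((length_lt_sz _).le.trans (hR' a))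

end
end MaxCutCW

/-! ### Polynomial-time list functions -/

namespace MaxCutCW

open Enc (enc)

section
variable {α β γ δ : Type} [Enc α] [Enc β] [Enc γ] [Enc δ]

@[fun_prop] theorem Poly.map {l : α → List γ} {f : α → γ → δ} (hl : Poly l)
    (hf : Poly (fun x : α × γ => f x.1 x.2)) : Poly (fun a => (l a).map (f a)) :=
  (Poly.flatMap (f := fun a c => [f a c]) hl (hf.cons (.const []))).congr fun a => by
    rw [List.map_eq_flatMap]

@[fun_prop] theorem Poly.filter {l : α → List γ} {p : α → γ → Bool} (hl : Poly l)
    (hp : Poly (fun x : α × γ => p x.1 x.2)) : Poly (fun a => (l a).filter (p a)) :=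
  (Poly.flatMap (f := fun a c => if p a c then [c] else []) hl
    (hp.cond (by fun_prop) (by fun_prop))).congr fun a => by
    induction l a with
    | nil => rfl
    | cons c l ih => simp [List.filter_cons, ih]; split <;> simp

@[fun_prop] theorem Poly.not {p : α → Bool} (hp : Poly p) : Poly (fun a => !p a) :=
  (hp.cond (.const false) (.const true)).congr fun a => by cases p a <;> rfl

@[fun_prop] theorem Poly.and {p q : α → Bool} (hp : Poly p) (hq : Poly q) :
    Poly (fun a => p a && q a) :=
  (hp.cond hq (.const false)).congr fun a => by cases p a <;> rfl

@[fun_prop] theorem Poly.or {p q : α → Bool} (hp : Poly p) (hq : Poly q) :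
    Poly (fun a => p a || q a) :=
  (hp.cond (.const true) hq).congr fun a => by cases p a <;> rfl

@[fun_prop] theorem Poly.any {l : α → List γ} {p : α → γ → Bool} (hl : Poly l)
    (hp : Poly (fun x : α × γ => p x.1 x.2)) : Poly (fun a => (l a).any (p a)) :=
  (hl.filter hp).isEmpty.not.congr fun a => by
    rw [Bool.eq_iff_iff]
    simp

@[fun_prop] theorem Poly.all {l : α → List γ} {p : α → γ → Bool} (hl : Poly l)
    (hp : Poly (fun x : α × γ => p x.1 x.2)) : Poly (fun a => (l a).all (p a)) :=
  (hl.any (p := fun a c => !p a c) (by fun_prop)).not.congr fun a => by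
    rw [Bool.eq_iff_iff]
    simp

@[fun_prop] theorem Poly.append {l l' : α → List γ} (hl : Poly l) (hl' : Poly l') :
    Poly (fun a => l a ++ l' a) :=
  (Poly.flatMap (l := fun a => [l a, l' a]) (f := fun _ c => c) (by fun_prop)
    (by fun_prop)).congr fun a => by simp

@[fun_prop] theorem Poly.reverse {l : α → List γ} (hl : Poly l) :
    Poly (fun a => (l a).reverse) :=
  (Poly.foldl (b := fun _ => []) (s := fun _ b c => c :: b) hl (by fun_prop) (by fun_prop)
    (Classical.choose hl) fun a l₁ h => by
      have h1 := (Classical.choose_spec hl).2 a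
      have h2 := sz_le_of_sublist h.sublist
      simp [sz_reverse]
      omega).congr fun a => by simp

/-- A right fold whose partial results have polynomial size. -/
theorem Poly.foldr {l : α → List γ} {b : α → β} {s : α → γ → β → β} (hl : Poly l) (hb : Poly b)
    (hs : Poly (fun x : α × (β × γ) => s x.1 x.2.2 x.2.1)) (Q : Polynomial ℕ)
    (hQ : ∀ a l₁, l₁ <:+ l a → sz (l₁.foldr (s a) (b a)) ≤ Q.eval (sz a)) :
    Poly (fun a => (l a).foldr (s a) (b a)) :=
  (Poly.foldl (s := fun a x c => s a c x) hl.reverse hb hs Q fun a l₁ h => by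
    have := hQ a l₁.reverse (by rw [← List.reverse_prefix]; simpa using h)
    simpa using this).congr fun a => by simp

/-! ### Equality tests -/

/-- Equality can be tested in polynomial time. -/
class PolyEq (α : Type) [Enc α] [DecidableEq α] : Prop where
  poly : Poly (fun x : α × α => decide (x.1 = x.2))

@[fun_prop] theorem Poly.eq [DecidableEq β] [PolyEq β] {f g : α → β} (hf : Poly f) (hg : Poly g) :
    Poly (fun a => decide (f a = g a)) := PolyEq.poly.comp (hf.pair hg)

instance : PolyEq Bool := ⟨(Poly.cond (c := fun x : Bool × Bool => x.1) (f := fun x => x.2)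
  (g := fun x => !x.2) (by fun_prop) (by fun_prop) (by fun_prop)).congr (by decide)⟩

instance [DecidableEq α] [DecidableEq β] [PolyEq α] [PolyEq β] : PolyEq (α × β) :=
  ⟨(Poly.and (p := fun x : (α × β) × (α × β) => decide (x.1.1 = x.2.1))
    (q := fun x => decide (x.1.2 = x.2.2)) (by fun_prop) (by fun_prop)).congr fun x => by
      rw [Bool.eq_iff_iff]; simp [Prod.ext_iff]⟩

/-- One step of the comparison of two lists: the state consists of the remainder of the second
list and of the result so far. -/
def eqStep {ι : Type} [DecidableEq ι] (d : ι) (st : List ι × Bool) (a : ι) : List ι × Bool :=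
  (st.1.tail, st.2 && (!st.1.isEmpty && decide (st.1.headD d = a)))

theorem foldl_eqStep {ι : Type} [DecidableEq ι] (d : ι) (l l' : List ι) (b : Bool) :
    ((l.foldl (eqStep d) (l', b)).2 && (l.foldl (eqStep d) (l', b)).1.isEmpty) =
      (b && decide (l = l')) := by
  induction l generalizing l' b with
  | nil => cases l' <;> simp
  | cons a l ih =>
    rw [List.foldl_cons, eqStep, ih]
    cases l' with
    | nil => simp
    | cons a' l' =>
      by_cases h : a = a'
      · subst h
        simp
        congr
      · simp [h, Ne.symm h]

/-- Equality of lists. The default value `d`, whose code is that of the empty list, is the result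
of taking the head of the empty list. -/
theorem PolyEq.list [DecidableEq α] [PolyEq α] (d : α) (hd : enc d = .nil) : PolyEq (List α) := by
  have h : Poly (fun x : List α × List α => x.1.foldl (eqStep d) (x.2, true)) := by
    refine Poly.foldl (by fun_prop) (by fun_prop) ?_ (.X + 2) ?_
    · have : Poly (fun x : (List α × List α) × ((List α × Bool) × α) => x.2.1.1.headD d) :=
        Poly.headD d hd (by fun_prop)
      unfold eqStep
      fun_prop
    · rintro ⟨l, l'⟩ l₁ -
      have : ∀ b, sz (l₁.foldl (eqStep d) (l', b)).1 ≤ sz l' := by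
        clear l
        induction l₁ generalizing l' with
        | nil => simp
        | cons a l ih =>
          intro b
          exact (ih _ _).trans (sz_le_of_sublist (List.tail_sublist _))
      have h1 := this true
      have h2 := sz_bool_le (l₁.foldl (eqStep d) (l', true)).2
      have h3 : sz (l₁.foldl (eqStep d) (l', true)) = sz (l₁.foldl (eqStep d) (l', true)).1 +
        sz (l₁.foldl (eqStep d) (l', true)).2 := rfl
      simp
      omega
  exact ⟨(h.snd.and h.fst.isEmpty).congr fun x => by rw [foldl_eqStep]; simp⟩

instance : PolyEq (List Bool) := .list false rfl

/-- A function whose values have the same codes as those of a polynomial-time function. -/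
theorem Poly.of_enc {f : α → β} (g : α → γ) (hg : Poly g) (h : ∀ a, enc (f a) = enc (g a)) :
    Poly f := by
  obtain ⟨P, ⟨p, hp⟩, hP⟩ := hg
  refine ⟨P, ⟨p, fun a => h a ▸ hp a⟩, fun a => ?_⟩
  have := hP a
  rwa [sz, ← h] at this

@[fun_prop] theorem Poly.bits {f : α → ℕ} (hf : Poly f) : Poly (fun a => (f a).bits) :=
  Poly.of_enc _ hf fun _ => rfl

theorem bits_injective : Function.Injective Nat.bits := fun m n h =>
  Nat.eq_of_testBit_eq fun i => by rw [Nat.testBit_eq_inth, Nat.testBit_eq_inth, h]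

instance : PolyEq ℕ := ⟨(Poly.eq (f := fun x : ℕ × ℕ => x.1.bits) (g := fun x => x.2.bits)
  (by fun_prop) (by fun_prop)).congr fun x => by simp [bits_injective.eq_iff]⟩

instance : PolyEq (List ℕ) := .list 0 rfl

@[fun_prop] theorem Poly.mem [DecidableEq β] [PolyEq β] {f : α → β} {g : α → List β}
    [∀ a, Decidable (f a ∈ g a)] (hf : Poly f) (hg : Poly g) : Poly (fun a => decide (f a ∈ g a)) :=
  (hg.any (p := fun a b => decide (f a = b)) (by fun_prop)).congr fun a => by
    rw [Bool.eq_iff_iff]; simp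

/-! ### Counting -/

/-- One step of the increment of a number in binary: the state consists of the carry and the
reversed list of the digits so far. -/
def incStep (st : Bool × List Bool) (b : Bool) : Bool × List Bool :=
  (st.1 && b, (xor st.1 b) :: st.2)

/-- Adding a carry to a number, digit by digit. -/
theorem bits_succ (n : ℕ) (l : List Bool) (c : Bool) :
    (if (n.bits.foldl incStep (c, l)).1 then true :: (n.bits.foldl incStep (c, l)).2
      else (n.bits.foldl incStep (c, l)).2).reverse =
    l.reverse ++ (if c then (n + 1).bits else n.bits) := by
  induction n using Nat.binaryRec' generalizing l c with
  | zero => cases c <;> simp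
  | bit b n h ih =>
    rw [Nat.bits_append_bit _ _ h, List.foldl_cons, incStep, ih]
    cases b <;> cases c
    · simp
    · simp
    · simp
    · simp only [Nat.bit, Bool.and_self, cond_true, if_true]
      rw [show 2 * n + 1 + 1 = 2 * (n + 1) by ring, Nat.bit0_bits _ (by omega)]
      simp

theorem length_bits_le (n : ℕ) : n.bits.length ≤ n := by
  rw [Nat.size_eq_bits_len, Nat.size_le]
  exact Nat.lt_two_pow_self

theorem sz_nat_le (n : ℕ) : sz n ≤ 2 * n + 1 := by
  have h1 : sz n = sz n.bits := rfl
  have := sz_le_of_forall (l := n.bits) (K := 2) fun b _ => sz_bool_le b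
  have := length_bits_le n
  omega

@[fun_prop] theorem Poly.succ {f : α → ℕ} (hf : Poly f) : Poly (fun a => f a + 1) := by
  have h : Poly (fun l : List Bool => l.foldl incStep (true, [])) := by
    refine Poly.foldl (by fun_prop) (by fun_prop) ?_ (2 * .X + 3) ?_
    · have h : Poly (fun x : Bool × Bool => xor x.1 x.2) :=
        (Poly.cond (c := fun x : Bool × Bool => x.1) (f := fun x => !x.2) (g := fun x => x.2)
          (by fun_prop) (by fun_prop) (by fun_prop)).congr (by decide)
      have h' : Poly (fun x : List Bool × ((Bool × List Bool) × Bool) => xor x.2.1.1 x.2.2) :=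
        h.comp (f := fun x : List Bool × ((Bool × List Bool) × Bool) => (x.2.1.1, x.2.2))
          (by fun_prop)
      unfold incStep
      fun_prop
    · intro l l₁ h
      have h1 := length_lt_sz l
      have h2 := h.length_le
      have h3 := sz_bool_le (l₁.foldl incStep (true, [])).1
      have h4 : ∀ (c : Bool × List Bool), (l₁.foldl incStep c).2.length =
          l₁.length + c.2.length := by
        clear h h2 h3
        induction l₁ with
        | nil => simp
        | cons b l ih => intro c; simp [ih, incStep]; omega
      have h5 := sz_le_of_forall (l := (l₁.foldl incStep (true, [])).2) (K := 2)
        fun b _ => sz_bool_le b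
      rw [h4] at h5
      have h3 : sz (l₁.foldl incStep (true, [])) = sz (l₁.foldl incStep (true, [])).1 +
        sz (l₁.foldl incStep (true, [])).2 := rfl
      simp at h5 ⊢
      omega
  have h' : Poly (fun l : List Bool => (if (l.foldl incStep (true, [])).1 then
      true :: (l.foldl incStep (true, [])).2 else (l.foldl incStep (true, [])).2).reverse) := by
    fun_prop
  refine Poly.of_enc _ (h'.comp hf.bits) fun a => ?_
  rw [bits_succ]
  rfl

@[fun_prop] theorem Poly.zipIdx {l : α → List γ} (hl : Poly l) : Poly (fun a => (l a).zipIdx) := by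
  have e : ∀ (l : List γ) (x : ℕ × List (γ × ℕ)),
      l.foldl (fun x c => (x.1 + 1, (c, x.1) :: x.2)) x =
        (x.1 + l.length, (l.zipIdx x.1).reverse ++ x.2) := by
    intro l
    induction l with
    | nil => simp
    | cons c l ih => intro x; simp [ih, Nat.add_assoc, Nat.add_comm 1]
  have h : Poly (fun l : List γ => l.foldl (fun (x : ℕ × List (γ × ℕ)) c =>
      (x.1 + 1, (c, x.1) :: x.2)) (0, [])) := by
    refine Poly.foldl (by fun_prop) (by fun_prop) (by fun_prop)
      (2 * .X + 1 + (.X * (3 * .X + 1) + 1)) ?_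
    intro l l₁ h
    have h1 := length_lt_sz l
    have h2 := h.length_le
    have h3 := sz_nat_le l₁.length
    rw [e]
    have h4 := sz_le_of_forall (l := l₁.zipIdx) (K := 3 * sz l + 1) (by
      rintro ⟨c, i⟩ hc
      have h5 := List.mem_zipIdx hc
      have h6 := sz_nat_le i
      have h7 : c ∈ l := h.subset (by
        simp only [h5.2.2]; exact List.getElem_mem _)
      have h8 := sz_mem_lt h7
      simp
      omega)
    have h5 := Nat.mul_le_mul_right (3 * sz l + 1) (h2.trans h1.le)
    simp [sz_reverse] at h3 h4 ⊢
    omega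
  exact (h.snd.reverse.comp hl).congr fun a => by simp [e]

/-! ### Further list functions -/

/-- The list without repetitions, as a right fold. -/
def dedup' {ι : Type} [DecidableEq ι] (l : List ι) : List ι :=
  l.foldr (fun a l => if decide (a ∈ l) then l else a :: l) []

theorem dedup'_cons {ι : Type} [DecidableEq ι] (a : ι) (l : List ι) :
    dedup' (a :: l) = if a ∈ l then dedup' l else a :: dedup' l := by
  have h : ∀ l : List ι, ∀ a, a ∈ dedup' l ↔ a ∈ l := by
    intro l
    induction l with
    | nil => simp [dedup']
    | cons b l ih =>
      intro a
      rw [dedup', List.foldr_cons, ← dedup', List.mem_cons, ← ih]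
      split
      · rename_i h
        constructor
        · exact .inr
        · rintro (rfl | h')
          · simpa using h
          · exact h'
      · simp
  rw [dedup', List.foldr_cons, ← dedup']
  simp [h]

theorem dedup'_eq {ι : Type} [DecidableEq ι] (l : List ι) : dedup' l = l.dedup := by
  induction l with
  | nil => rfl
  | cons a l ih =>
    rw [dedup'_cons, ih]
    split
    · rename_i h
      rw [List.dedup_cons_of_mem h]
    · rename_i h
      rw [List.dedup_cons_of_notMem h]

@[fun_prop] theorem Poly.dedup [DecidableEq β] [PolyEq β] {l : α → List β} (hl : Poly l) :
    Poly (fun a => (l a).dedup) := by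
  have h : Poly (fun l : List β => dedup' l) := by
    refine Poly.foldr (by fun_prop) (by fun_prop) (by fun_prop) .X fun l l₁ h => ?_
    rw [← dedup', dedup'_eq]
    simpa using sz_le_of_sublist ((List.dedup_sublist l₁).trans h.sublist)
  exact (h.comp hl).congr fun a => dedup'_eq _

theorem foldr_tails {ι : Type} (l : List ι) :
    l.foldr (fun a acc => (a :: acc.headD []) :: acc) [[]] = l.tails := by
  induction l with
  | nil => rfl
  | cons a l ih =>
    rw [List.foldr_cons, ih]
    cases l <;> rfl

theorem sz_tails_le (l : List α) : sz l.tails ≤ (l.length + 1) * sz l + 1 := by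
  refine (sz_le_of_forall (K := sz l) fun a ha => ?_).trans_eq (by simp)
  exact sz_le_of_sublist (List.mem_tails _ _ |>.1 ha).sublist

@[fun_prop] theorem Poly.tails {l : α → List β} (hl : Poly l) : Poly (fun a => (l a).tails) := by
  have h : Poly (fun l : List β => l.foldr (fun a acc => (a :: acc.headD []) :: acc) [[]]) := by
    refine Poly.foldr (by fun_prop) (by fun_prop) (by fun_prop) (.X * .X + 1) fun l l₁ h => ?_
    rw [foldr_tails]
    refine (sz_tails_le l₁).trans ?_
    have h1 := sz_le_of_sublist h.sublist
    have h2 := h.length_le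
    have h3 := length_lt_sz l
    simp
    gcongr
    omega
  exact (h.comp hl).congr fun a => foldr_tails _

/-- The number of repetitions is a constant here. -/
@[fun_prop] theorem Poly.replicate {f : α → β} (n : ℕ) (hf : Poly f) :
    Poly (fun a => List.replicate n (f a)) := by
  induction n with
  | zero => exact .const []
  | succ n ih => exact hf.cons ih

/-- The comparison of the lengths of two lists. -/
theorem isEmpty_foldl_tail {ι κ : Type} (l : List ι) (l' : List κ) :
    (l'.foldl (fun l _ => l.tail) l).isEmpty = decide (l.length ≤ l'.length) := by
  induction l' generalizing l with
  | nil => cases l <;> simp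
  | cons b l' ih =>
    rw [List.foldl_cons, ih]
    cases l
    · simp
    · exact decide_eq_decide.2 (by simp)

@[fun_prop] theorem Poly.length_le {f : α → List β} {g : α → List γ} (hf : Poly f)
    (hg : Poly g) : Poly (fun a => decide ((f a).length ≤ (g a).length)) := by
  have h : Poly (fun x : List β × List γ => x.2.foldl (fun l _ => l.tail) x.1) := by
    refine Poly.foldl (by fun_prop) (by fun_prop) (by fun_prop) .X fun x l₁ h => ?_
    clear h
    have : ∀ l : List β, sz (l₁.foldl (fun l _ => l.tail) l) ≤ sz l := by
      induction l₁ with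
      | nil => simp
      | cons c l' ih => intro l; exact (ih _).trans (sz_le_of_sublist (List.tail_sublist _))
    have := this x.1
    have := sz_fst_le x
    simp
    omega
  exact (h.comp (hf.pair hg)).isEmpty.congr fun a => isEmpty_foldl_tail _ _

@[fun_prop] theorem Poly.ite {c : α → Prop} [DecidablePred c] {f g : α → β}
    (hc : Poly (fun a => decide (c a))) (hf : Poly f) (hg : Poly g) :
    Poly (fun a => if c a then f a else g a) :=
  (hc.cond hf hg).congr fun a => by simp

end
end MaxCutCW

/-! ### Tries -/

namespace MaxCutCW

open Enc (enc)

/-- Binary tries; every node stores a list of vertex lists. -/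
inductive Trie : Type
  | leaf : Trie
  | node (v : List (List ℕ)) (l r : Trie) : Trie

namespace Trie

/-- The representation of a trie as a tree. -/
def toData : Trie → Data
  | leaf => .nil
  | node v l r => .node () (enc v) (.node () l.toData r.toData)

instance : Enc Trie := ⟨toData⟩

/-- The list stored at the root. -/
def val : Trie → List (List ℕ)
  | leaf => []
  | node v _ _ => v

/-- The left subtrie. -/
def left : Trie → Trie
  | leaf => leaf
  | node _ l _ => l

/-- The right subtrie. -/
def right : Trie → Trie
  | leaf => leaf
  | node _ _ r => r

/-- The subtrie selected by a bit. -/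
def child (t : Trie) (b : Bool) : Trie := if b then t.right else t.left

/-- The list stored under the key `k`. -/
def get (k : List Bool) (t : Trie) : List (List ℕ) := (k.foldl child t).val

/-- The trie in which the list under the key `k` is replaced by its image under `f`. -/
def modify (f : List (List ℕ) → List (List ℕ)) : List Bool → Trie → Trie
  | [], t => node (f t.val) t.left t.right
  | b :: k, t => if b then node t.val t.left (modify f k t.right)
      else node t.val (modify f k t.left) t.right

@[simp] theorem get_leaf (k : List Bool) : get k leaf = [] := by
  have : k.foldl child leaf = leaf := by
    induction k with
    | nil => rfl
    | cons b k ih => cases b <;> exact ih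
  rw [get, this]
  rfl

theorem get_cons (b : Bool) (k : List Bool) (t : Trie) : get (b :: k) t = get k (t.child b) := rfl

theorem get_modify (f : List (List ℕ) → List (List ℕ)) (k k' : List Bool) (t : Trie) :
    get k' (modify f k t) = if k' = k then f (get k t) else get k' t := by
  induction k generalizing k' t with
  | nil =>
    cases k' with
    | nil => rfl
    | cons b k' => cases b <;> rfl
  | cons b k ih =>
    cases k' with
    | nil => cases b <;> rfl
    | cons b' k' =>
      cases b <;> cases b' <;> simp [modify, get_cons, child, left, right, ih]

/-- One step down in a trie; the state contains the path from the root in reverse, with the part of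
each node that the path does not enter. -/
def down (x : Trie × List (Bool × (List (List ℕ) × Trie))) (b : Bool) :
    Trie × List (Bool × (List (List ℕ) × Trie)) :=
  if b then (x.1.right, (b, (x.1.val, x.1.left)) :: x.2)
  else (x.1.left, (b, (x.1.val, x.1.right)) :: x.2)

/-- One step up along a path recorded by `down`. -/
def up (t : Trie) (x : Bool × (List (List ℕ) × Trie)) : Trie :=
  if x.1 then node x.2.1 x.2.2 t else node x.2.1 t x.2.2

/-- Going down along the key `k`, replacing the list found there, and going back up amounts to
`modify`. -/
theorem foldl_up (f : List (List ℕ) → List (List ℕ)) (k : List Bool)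
    (x : Trie × List (Bool × (List (List ℕ) × Trie))) :
    (k.foldl down x).2.foldl up (node (f (k.foldl down x).1.val) (k.foldl down x).1.left
      (k.foldl down x).1.right) = x.2.foldl up (modify f k x.1) := by
  induction k generalizing x with
  | nil => rfl
  | cons b k ih =>
    rw [List.foldl_cons, ih]
    cases b <;> rfl

theorem foldl_down_fst (k : List Bool) (x : Trie × List (Bool × (List (List ℕ) × Trie))) :
    (k.foldl down x).1 = k.foldl child x.1 := by
  induction k generalizing x with
  | nil => rfl
  | cons b k ih =>
    rw [List.foldl_cons, ih]
    cases b <;> rfl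

theorem length_foldl_down (k : List Bool) (x : Trie × List (Bool × (List (List ℕ) × Trie))) :
    (k.foldl down x).2.length = k.length + x.2.length := by
  induction k generalizing x with
  | nil => simp
  | cons b k ih =>
    rw [List.foldl_cons, ih]
    cases b <;> simp [down] <;> omega

end Trie

/-! ### The algorithm -/

/-- The graph with edge list `E` has `u` and `v` as twins. -/
def twin (E : List (ℕ × ℕ)) (u v : ℕ) : Bool :=
  decide ((u, v) ∈ E) && E.all fun e =>
    (!decide (e.1 = u) || (decide (e.2 = v) || decide ((v, e.2) ∈ E))) &&
    (!decide (e.1 = v) || (decide (e.2 = u) || decide ((u, e.2) ∈ E)))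

/-- `u` and `v` belong to the same bubble. -/
def same (E : List (ℕ × ℕ)) (u v : ℕ) : Bool := decide (u = v) || twin E u v

/-- The vertices whose label does not belong to `L`, in the order of `V`. -/
def outside (V : List ℕ) (lab : List (ℕ × ℕ)) (L : List ℕ) : List ℕ :=
  V.filter fun x => lab.any fun p => decide (p.1 = x) && !decide (p.2 ∈ L)

/-- The nonempty intersections of the bubbles with `O`. -/
def bubbles (E : List (ℕ × ℕ)) (O : List ℕ) : List (List ℕ) :=
  (O.map fun u => O.filter fun x => same E u x).dedup

/-- The empty set and the suffixes of the lists in `bs`. -/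
def suffixChoices (bs : List (List ℕ)) : List (List ℕ) := [] :: bs.flatMap fun B => B.tails

/-- The list of all vertices with the label `l`. -/
def labelList (lab : List (ℕ × ℕ)) (l : ℕ) : List ℕ :=
  (lab.filter fun q => decide (q.2 = l)).map fun q => q.1

/-- The label classes, with repetitions. -/
def classLists (lab : List (ℕ × ℕ)) : List (List ℕ) := lab.map fun p => labelList lab p.2

/-- All concatenations of one element from each of the lists. An element is a part of a guess, and
a list contains the possibilities for one part. -/
def choiceProd {γ : Type} (cs : List (List (List γ))) : List (List γ) :=
  cs.foldl (fun acc c => acc.flatMap fun X => c.map fun Y => Y ++ X) [[]]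

/-- The possible intersections of the sought cut with the parts that are treated independently: the
bubbles outside `L`, up to `α` mixed bubbles, and the label classes in `L` of both children. -/
def choices (α δ : ℕ) (bs : List (List ℕ)) (labS labT : List (ℕ × ℕ)) :
    List (List (List ℕ)) :=
  bs.map (fun B => [[], B]) ++ (List.replicate α (suffixChoices bs) ++
    (List.replicate δ (suffixChoices (classLists labS)) ++
      List.replicate δ (suffixChoices (classLists labT))))

/-- The choices for the set `L` of labels; there are none if there are too many bubbles. -/
def guardedChoices (α δ : ℕ) (V : List ℕ) (E : List (ℕ × ℕ)) (fuel : List ℕ)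
    (labS labT : List (ℕ × ℕ)) (L : List ℕ) : List (List (List ℕ)) :=
  if (bubbles E (outside V (labS ++ labT) L)).length ≤ fuel.length then
    choices α δ (bubbles E (outside V (labS ++ labT) L)) labS labT
  else [[]]

/-- All lists of at most `δ` labels. -/
def labelSets (δ : ℕ) (labels : List ℕ) : List (List ℕ) :=
  choiceProd (List.replicate δ ([] :: labels.map fun l => [l]))

/-- A code for the numbers of elements that `X` has in the label classes: for each labelled vertex,
the unary code of the number of elements of `X` with the same label. -/
def key (lab : List (ℕ × ℕ)) (X : List ℕ) : List Bool :=
  lab.flatMap fun p =>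
    (lab.filter fun q => decide (q.2 = p.2) && decide (q.1 ∈ X)).map (fun _ => true) ++ [false]

/-- The edges between `X` and its complement in the labelled set. -/
def cutPairs (E : List (ℕ × ℕ)) (lab : List (ℕ × ℕ)) (X : List ℕ) : List (ℕ × ℕ) :=
  lab.flatMap fun p => lab.filter fun q =>
    decide (p.1 ∈ X) && (!decide (q.1 ∈ X) && decide ((p.1, q.1) ∈ E))

/-- The better one of at most one known set and the set `W`. -/
def better (E : List (ℕ × ℕ)) (lab : List (ℕ × ℕ)) (U : List (List ℕ)) (W : List ℕ) :
    List (List ℕ) :=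
  if U.isEmpty then [W]
  else if (cutPairs E lab (U.headD [])).length ≤ (cutPairs E lab W).length then [W] else U

/-- The trie that stores under each key a best set in `D` with this key. -/
def buildTrie (E : List (ℕ × ℕ)) (lab : List (ℕ × ℕ)) (D : List (List ℕ)) : Trie :=
  D.foldl (fun t W => t.modify (better E lab · W) (key lab W)) .leaf

/-- The unions of the best sets in the tries for the keys of `X`. -/
def lookupBoth (labS labT : List (ℕ × ℕ)) (tS tT : Trie) (X : List ℕ) : List (List ℕ) :=
  (tS.get (key labS X)).flatMap fun A => (tT.get (key labT X)).map fun B => A ++ B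

/-- The table for a disjoint union. -/
def unionTable (α δ : ℕ) (V : List ℕ) (E : List (ℕ × ℕ)) (labels fuel : List ℕ)
    (labS labT : List (ℕ × ℕ)) (DS DT : List (List ℕ)) : List (List ℕ) :=
  (labelSets δ labels).flatMap fun L =>
    (choiceProd (guardedChoices α δ V E fuel labS labT L)).flatMap
      (lookupBoth labS labT (buildTrie E labS DS) (buildTrie E labT DT))

/-! ### Correctness of the data structures -/

theorem mem_choiceProd_append {γ : Type} {cs : List (List (List γ))} {Z : List γ}
    {c : List (List γ)} :
    Z ∈ choiceProd (cs ++ [c]) ↔ ∃ X ∈ choiceProd cs, ∃ Y ∈ c, Y ++ X = Z := by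
  simp [choiceProd, List.foldl_append]

/-- One element from each list gives an element of the product. -/
theorem exists_mem_choiceProd {γ : Type} {cs : List (List (List γ))} {ys : List (List γ)}
    (h : List.Forall₂ (fun y c => y ∈ c) ys cs) :
    ∃ Z ∈ choiceProd cs, ∀ x, x ∈ Z ↔ ∃ y ∈ ys, x ∈ y := by
  induction cs using List.reverseRecOn generalizing ys with
  | nil => cases h; exact ⟨[], by simp [choiceProd], by simp⟩
  | append_singleton cs c ih =>
    obtain ⟨ys', ys'', h1, h2, rfl⟩ : ∃ ys' ys'', List.Forall₂ (fun y c => y ∈ c) ys' cs ∧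
        List.Forall₂ (fun y c => y ∈ c) ys'' [c] ∧ ys = ys' ++ ys'' := by
      refine ⟨ys.take cs.length, ys.drop cs.length, List.forall₂_take_append _ _ _ h,
        List.forall₂_drop_append _ _ _ h, by simp⟩
    obtain ⟨Z, hZ, hZ'⟩ := ih h1
    cases h2 with
    | cons h3 h4 =>
      cases h4
      rename_i y
      refine ⟨y ++ Z, mem_choiceProd_append.2 ⟨Z, hZ, y, h3, rfl⟩, fun x => ?_⟩
      simp only [List.mem_append, hZ', List.mem_singleton]
      constructor
      · rintro (h | ⟨y', h, h'⟩)
        exacts [⟨y, .inr rfl, h⟩, ⟨y', .inl h, h'⟩]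
      · rintro ⟨y', h | rfl, h'⟩
        exacts [.inr ⟨y', h, h'⟩, .inl h']

/-- The number of cut edges within the labelled set. -/
def cutCount (E : List (ℕ × ℕ)) (lab : List (ℕ × ℕ)) (X : List ℕ) : ℕ :=
  (cutPairs E lab X).length

theorem better_spec {E : List (ℕ × ℕ)} {lab : List (ℕ × ℕ)} {U : List (List ℕ)} {W : List ℕ}
    (hU : U.length ≤ 1) :
    (better E lab U W).length ≤ 1 ∧ (∀ Y ∈ better E lab U W, Y = W ∨ Y ∈ U) ∧
      ∀ Y, Y = W ∨ Y ∈ U → ∃ Z ∈ better E lab U W, cutCount E lab Y ≤ cutCount E lab Z := by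
  match U, hU with
  | [], _ => simp [better]
  | [A], _ =>
    simp only [better, List.isEmpty_cons, List.headD_cons]
    by_cases h : (cutPairs E lab A).length ≤ (cutPairs E lab W).length
    · simp [h, cutCount]
    · simp [h, cutCount]
      omega

/-- A fold with `better` selects a best set. -/
theorem foldl_better {E : List (ℕ × ℕ)} {lab : List (ℕ × ℕ)} (D : List (List ℕ)) :
    (D.foldl (better E lab) []).length ≤ 1 ∧ (∀ Y ∈ D.foldl (better E lab) [], Y ∈ D) ∧
      ∀ Y ∈ D, ∃ Z ∈ D.foldl (better E lab) [], cutCount E lab Y ≤ cutCount E lab Z := by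
  induction D using List.reverseRecOn with
  | nil => simp
  | append_singleton D W ih =>
    obtain ⟨h1, h2, h3⟩ := ih
    obtain ⟨g1, g2, g3⟩ := better_spec (E := E) (lab := lab) (W := W) h1
    rw [List.foldl_append, List.foldl_cons, List.foldl_nil]
    refine ⟨g1, fun Y hY => ?_, fun Y hY => ?_⟩
    · rcases g2 Y hY with rfl | h
      · simp
      · simp [h2 Y h]
    · simp only [List.mem_append, List.mem_singleton] at hY
      rcases hY with hY | rfl
      · obtain ⟨Z, hZ, hZ'⟩ := h3 Y hY
        obtain ⟨Z', hZ1, hZ2⟩ := g3 Z (.inr hZ)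
        exact ⟨Z', hZ1, hZ'.trans hZ2⟩
      · exact g3 Y (.inl rfl)

/-- The trie stores under each key the best one of the sets with this key. -/
theorem get_buildTrie (E lab) (D : List (List ℕ)) (k : List Bool) :
    (buildTrie E lab D).get k = (D.filter fun W => key lab W = k).foldl (better E lab) [] := by
  induction D using List.reverseRecOn with
  | nil => simp [buildTrie]
  | append_singleton D W ih =>
    rw [buildTrie, List.foldl_append, ← buildTrie, List.foldl_cons, List.foldl_nil,
      Trie.get_modify, ih, List.filter_append, List.foldl_append]
    by_cases h : key lab W = k
    · subst h
      simp [ih]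
    · simp [h, Ne.symm h]

theorem mem_of_mem_get_buildTrie {E lab} {D : List (List ℕ)} {k : List Bool} {W : List ℕ}
    (h : W ∈ (buildTrie E lab D).get k) : W ∈ D ∧ key lab W = k := by
  rw [get_buildTrie] at h
  simpa using (foldl_better _).2.1 W h

theorem exists_mem_get_buildTrie {E lab} {D : List (List ℕ)} {W : List ℕ} (h : W ∈ D) :
    ∃ Z ∈ (buildTrie E lab D).get (key lab W), cutCount E lab W ≤ cutCount E lab Z := by
  rw [get_buildTrie]
  exact (foldl_better _).2.2 W (by simpa using h)

theorem length_get_buildTrie_le (E lab) (D : List (List ℕ)) (k : List Bool) :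
    ((buildTrie E lab D).get k).length ≤ 1 := by
  rw [get_buildTrie]
  exact (foldl_better _).1

/-- The unary code of numbers is prefix-free. -/
theorem replicate_append_false_inj {m n : ℕ} {l l' : List Bool}
    (h : List.replicate m true ++ false :: l = List.replicate n true ++ false :: l') :
    m = n ∧ l = l' := by
  induction m generalizing n with
  | zero => cases n <;> simp_all [List.replicate_succ]
  | succ m ih =>
    cases n with
    | zero => simp [List.replicate_succ] at h
    | succ n =>
      simp only [List.replicate_succ, List.cons_append, List.cons.injEq, true_and] at h
      simpa using ih h

/-- The number of vertices with label `l` that satisfy `P`. -/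
def labelCount (lab : List (ℕ × ℕ)) (P : ℕ → Bool) (l : ℕ) : ℕ :=
  (lab.filter fun q => decide (q.2 = l) && P q.1).length

/-- Two sets have the same key if and only if they have the same number of elements in each label
class. -/
theorem key_eq_iff {lab : List (ℕ × ℕ)} {X Y : List ℕ} :
    key lab X = key lab Y ↔
      ∀ p ∈ lab, labelCount lab (fun x => decide (x ∈ X)) p.2 =
        labelCount lab (fun x => decide (x ∈ Y)) p.2 := by
  have : ∀ lab' : List (ℕ × ℕ),
      ((lab'.flatMap fun p => (lab.filter fun q => decide (q.2 = p.2) && decide (q.1 ∈ X)).map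
        (fun _ => true) ++ [false]) = lab'.flatMap fun p =>
        (lab.filter fun q => decide (q.2 = p.2) && decide (q.1 ∈ Y)).map (fun _ => true) ++ [false])
      ↔ ∀ p ∈ lab', labelCount lab (fun x => decide (x ∈ X)) p.2 =
        labelCount lab (fun x => decide (x ∈ Y)) p.2 := by
    intro lab'
    induction lab' with
    | nil => simp
    | cons p lab' ih =>
      simp only [List.flatMap_cons, List.map_const', List.append_assoc, List.singleton_append,
        List.forall_mem_cons] at ih ⊢
      constructor
      · intro h
        obtain ⟨h1, h2⟩ := replicate_append_false_inj h
        exact ⟨h1, ih.1 h2⟩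
      · rintro ⟨h1, h2⟩
        rw [ih.2 h2]
        unfold labelCount at h1
        rw [h1]
  exact this lab

end MaxCutCW

/-! ### The running time of the table operations -/

namespace MaxCutCW

open Enc (enc)

section
variable {α β γ δ : Type} [Enc α] [Enc β] [Enc γ] [Enc δ]

/-- `f` is computed in constant time. -/
@[fun_prop] def ConstTime (f : α → β) : Prop := ∃ K, CT f (fun _ => K)

@[fun_prop] theorem ConstTime.id : ConstTime (fun a : α => a) := ⟨_, CT.id⟩

@[fun_prop] theorem ConstTime.const (b : β) : ConstTime (fun _ : α => b) := CT.const b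

@[fun_prop] theorem ConstTime.comp {g : β → γ} {f : α → β} (hg : ConstTime g) (hf : ConstTime f) :
    ConstTime (fun a => g (f a)) := by
  obtain ⟨P, hP⟩ := hf
  obtain ⟨Q, hQ⟩ := hg
  exact ⟨_, hQ.comp hP⟩

@[fun_prop] theorem ConstTime.pair {f : α → β} {g : α → γ} (hf : ConstTime f)
    (hg : ConstTime g) : ConstTime (fun a => (f a, g a)) := by
  obtain ⟨P, hP⟩ := hf
  obtain ⟨Q, hQ⟩ := hg
  exact ⟨_, hP.pair hQ⟩

@[fun_prop] theorem ConstTime.fst {f : α → β × γ} (hf : ConstTime f) :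
    ConstTime (fun a => (f a).1) :=
  ConstTime.comp (g := fun x : β × γ => x.1) ⟨_, CT.fst⟩ hf

@[fun_prop] theorem ConstTime.snd {f : α → β × γ} (hf : ConstTime f) :
    ConstTime (fun a => (f a).2) :=
  ConstTime.comp (g := fun x : β × γ => x.2) ⟨_, CT.snd⟩ hf

@[fun_prop] theorem ConstTime.cons {f : α → β} {g : α → List β} (hf : ConstTime f)
    (hg : ConstTime g) : ConstTime (fun a => f a :: g a) :=
  ConstTime.comp (g := fun x : β × List β => x.1 :: x.2) ⟨_, CT.cons⟩ (hf.pair hg)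

@[fun_prop] theorem ConstTime.tail {f : α → List β} (hf : ConstTime f) :
    ConstTime (fun a => (f a).tail) :=
  ConstTime.comp (g := fun x : List β => x.tail) ⟨_, CT.tail⟩ hf

@[fun_prop] theorem ConstTime.headD_nil {f : α → List (List β)} (hf : ConstTime f) :
    ConstTime (fun a => (f a).headD []) :=
  ConstTime.comp (g := fun x : List (List β) => x.headD []) ⟨_, CT.headD [] rfl⟩ hf

@[fun_prop] theorem ConstTime.cond {c : α → Bool} {f g : α → β} (hc : ConstTime c)
    (hf : ConstTime f) (hg : ConstTime g) : ConstTime (fun a => if c a then f a else g a) := by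
  obtain ⟨P, hP⟩ := hf
  obtain ⟨Q, hQ⟩ := hg
  obtain ⟨R, hR⟩ := hc
  exact ⟨_, hR.ite hP hQ⟩

/-- A fold with steps of constant time takes linear time. -/
theorem ConstTime.foldl {s : β → γ → β} (hs : ConstTime (fun x : β × γ => s x.1 x.2)) :
    ∃ K, CT (fun x : β × List γ => x.2.foldl s x.1) (fun x => K * (x.2.length + 1)) := by
  obtain ⟨k, hk⟩ : ConstTime (fun x : Unit × (β × γ) => s x.2.1 x.2.2) :=
    hs.comp (f := fun x : Unit × (β × γ) => x.2) (by fun_prop)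
  obtain ⟨k', hk'⟩ : ConstTime (fun x : β × List γ => ((), x)) := by fun_prop
  refine ⟨k + k' + 300, ((CT.foldl (s := fun _ => s) hk).comp hk').mono fun x => ?_⟩
  refine (Nat.add_le_add_left (Nat.add_le_add_right (foldTime_le (K := k) (fun _ _ => True)
      (by simp) (by simp) _ _ trivial) _) _).trans ?_
  nlinarith

@[fun_prop] theorem ConstTime.trie_val {f : α → Trie} (hf : ConstTime f) :
    ConstTime (fun a => (f a).val) :=
  ConstTime.comp (g := fun t : Trie => t.val) ⟨_, CT.expr (.hd (.hd .st)) (by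
    rintro _ _ (_ | ⟨v, l, r⟩) <;> simp [Expr.eval, Data.hd, enc, Trie.toData, Trie.val, encList])⟩
    hf

@[fun_prop] theorem ConstTime.trie_left {f : α → Trie} (hf : ConstTime f) :
    ConstTime (fun a => (f a).left) :=
  ConstTime.comp (g := fun t : Trie => t.left) ⟨_, CT.expr (.hd (.tl (.hd .st))) (by
    rintro _ _ (_ | ⟨v, l, r⟩) <;>
      simp [Expr.eval, Data.hd, Data.tl, enc, Trie.toData, Trie.left])⟩ hf

@[fun_prop] theorem ConstTime.trie_right {f : α → Trie} (hf : ConstTime f) :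
    ConstTime (fun a => (f a).right) :=
  ConstTime.comp (g := fun t : Trie => t.right) ⟨_, CT.expr (.tl (.tl (.hd .st))) (by
    rintro _ _ (_ | ⟨v, l, r⟩) <;>
      simp [Expr.eval, Data.hd, Data.tl, enc, Trie.toData, Trie.right])⟩ hf

@[fun_prop] theorem ConstTime.trie_node {f : α → List (List ℕ)} {g h : α → Trie}
    (hf : ConstTime f) (hg : ConstTime g) (hh : ConstTime h) :
    ConstTime (fun a => Trie.node (f a) (g a) (h a)) :=
  ConstTime.comp (g := fun x : List (List ℕ) × (Trie × Trie) => Trie.node x.1 x.2.1 x.2.2)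
    ⟨_, CT.expr (.hd .st) (by
      rintro _ _ ⟨v, l, r⟩; simp [Expr.eval, Data.hd, enc, Trie.toData])⟩ (hf.pair (hg.pair hh))

theorem CT.trie_get :
    ∃ K, CT (fun x : List Bool × Trie => x.2.get x.1) (fun x => K * (x.1.length + 1)) := by
  obtain ⟨K, hK⟩ := ConstTime.foldl (s := Trie.child) (by unfold Trie.child; fun_prop)
  obtain ⟨k, hk⟩ : ConstTime (fun x : List Bool × Trie => (x.2, x.1)) := by fun_prop
  obtain ⟨k', hk'⟩ : ConstTime (fun t : Trie => t.val) := by fun_prop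
  refine ⟨K + k + k', (hk'.comp (hK.comp hk)).mono fun x => ?_⟩
  simp
  nlinarith

end

/-! ### Bounds by polynomials -/

/-- `t` is bounded by a polynomial in `s`. -/
def PB {α : Type} (s t : α → ℕ) : Prop := ∃ P : Polynomial ℕ, ∀ a, t a ≤ P.eval (s a)

section
variable {α : Type} {s t u : α → ℕ}

theorem PB.mono (h : PB s t) (ht : ∀ a, u a ≤ t a) : PB s u := by
  obtain ⟨P, hP⟩ := h
  exact ⟨P, fun a => (ht a).trans (hP a)⟩

theorem PB.const (k : ℕ) : PB s fun _ => k := ⟨.C k, by simp⟩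

theorem PB.of_le (h : ∀ a, t a ≤ s a) : PB s t := ⟨.X, by simpa using h⟩

theorem PB.add (ht : PB s t) (hu : PB s u) : PB s fun a => t a + u a := by
  obtain ⟨P, hP⟩ := ht
  obtain ⟨Q, hQ⟩ := hu
  exact ⟨P + Q, fun a => by simpa using Nat.add_le_add (hP a) (hQ a)⟩

theorem PB.mul (ht : PB s t) (hu : PB s u) : PB s fun a => t a * u a := by
  obtain ⟨P, hP⟩ := ht
  obtain ⟨Q, hQ⟩ := hu
  exact ⟨P * Q, fun a => by simpa using Nat.mul_le_mul (hP a) (hQ a)⟩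

theorem PB.pow (ht : PB s t) (n : ℕ) : PB s fun a => t a ^ n := by
  obtain ⟨P, hP⟩ := ht
  exact ⟨P ^ n, fun a => by simpa using Nat.pow_le_pow_left (hP a) n⟩

theorem PB.eval (P : Polynomial ℕ) (ht : PB s t) : PB s fun a => P.eval (t a) := by
  obtain ⟨Q, hQ⟩ := ht
  exact ⟨P.comp Q, fun a => by simpa [Polynomial.eval_comp] using eval_mono P (hQ a)⟩

end

section
variable {α β γ δ : Type} [Enc α] [Enc β] [Enc γ] [Enc δ]

/-- `f` is computed in time polynomial in the measure `s` of its argument. -/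
def PT (s : α → ℕ) (f : α → β) : Prop := ∃ P : Polynomial ℕ, CT f fun a => P.eval (s a)

theorem PT.of_ct {s t : α → ℕ} {f : α → β} (h : CT f t) (ht : PB s t) : PT s f := by
  obtain ⟨P, hP⟩ := ht
  exact ⟨P, h.mono hP⟩

theorem ConstTime.pt {f : α → β} (h : ConstTime f) (s : α → ℕ) : PT s f := by
  obtain ⟨k, hk⟩ := h
  exact .of_ct hk (.const k)

theorem PT.comp {s : α → ℕ} {s' : β → ℕ} {f : α → β} {g : β → γ} (hg : PT s' g) (hf : PT s f)
    (h : PB s fun a => s' (f a)) : PT s fun a => g (f a) := by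
  obtain ⟨P, hP⟩ := hf
  obtain ⟨Q, hQ⟩ := hg
  exact .of_ct (hQ.comp hP) (.add ⟨P, fun _ => le_rfl⟩ (h.eval Q))

theorem PT.pair {s : α → ℕ} {f : α → β} {g : α → γ} (hf : PT s f) (hg : PT s g) :
    PT s fun a => (f a, g a) := by
  obtain ⟨P, hP⟩ := hf
  obtain ⟨Q, hQ⟩ := hg
  exact ⟨P + Q + 40, (hP.pair hQ).mono (by simp)⟩

theorem Poly.pt {f : α → β} (h : Poly f) : PT sz f := by
  obtain ⟨P, hP, -⟩ := h
  exact ⟨P, hP⟩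

theorem Poly.sz_pb {f : α → β} (h : Poly f) : PB sz fun a => sz (f a) := by
  obtain ⟨P, -, hP⟩ := h
  exact ⟨P, hP⟩

/-- A polynomial-time function of a small part of the argument. -/
theorem PT.comp_poly {s : α → ℕ} {f : α → β} {g : β → γ} (hg : Poly g) (hf : ConstTime f)
    (h : PB s fun a => sz (f a)) : PT s fun a => g (f a) := hg.pt.comp (hf.pt s) h

theorem PB.comp_poly {ι : Type} {s : ι → ℕ} {f : ι → β} {g : β → γ} (hg : Poly g)
    (h : PB s fun a => sz (f a)) : PB s fun a => sz (g (f a)) := by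
  obtain ⟨P, hP⟩ := hg.sz_pb
  exact (h.eval P).mono fun a => hP _

theorem PB.length {ι : Type} {s : ι → ℕ} {f : ι → List β} (h : PB s fun a => sz (f a)) :
    PB s fun a => (f a).length := h.mono fun _ => (length_lt_sz _).le

end

/-! ### Building and searching tries -/

@[fun_prop] theorem Poly.key {α : Type} [Enc α] {f : α → List (ℕ × ℕ)} {g : α → List ℕ}
    (hf : Poly f) (hg : Poly g) : Poly fun a => key (f a) (g a) := by
  unfold MaxCutCW.key
  fun_prop

@[fun_prop] theorem Poly.cutPairs {α : Type} [Enc α] {e f : α → List (ℕ × ℕ)} {g : α → List ℕ}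
    (he : Poly e) (hf : Poly f) (hg : Poly g) : Poly fun a => cutPairs (e a) (f a) (g a) := by
  unfold MaxCutCW.cutPairs
  exact Poly.flatMap (by fun_prop) (Poly.filter (by fun_prop) (by fun_prop))

@[fun_prop] theorem Poly.better {α : Type} [Enc α] {e f : α → List (ℕ × ℕ)}
    {u : α → List (List ℕ)} {g : α → List ℕ}
    (he : Poly e) (hf : Poly f) (hu : Poly u) (hg : Poly g) :
    Poly fun a => better (e a) (f a) (u a) (g a) := by
  unfold MaxCutCW.better
  fun_prop

/-- The maximum size of the elements of a list. -/
def maxSize {α : Type} [Enc α] (D : List α) : ℕ := (D.map sz).foldr max 0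

theorem maxSize_cons {α : Type} [Enc α] (W : α) (D : List α) :
    maxSize (W :: D) = max (sz W) (maxSize D) := rfl

theorem sz_le_maxSize {α : Type} [Enc α] {D : List α} {W : α} (h : W ∈ D) : sz W ≤ maxSize D := by
  induction D with
  | nil => simp at h
  | cons A D ih =>
    rw [maxSize_cons]
    rcases List.mem_cons.1 h with rfl | h
    · exact le_max_left _ _
    · exact (ih h).trans (le_max_right _ _)

theorem maxSize_le {α : Type} [Enc α] {D : List α} {K : ℕ} (h : ∀ W ∈ D, sz W ≤ K) :
    maxSize D ≤ K := by
  induction D with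
  | nil => simp [maxSize]
  | cons A D ih =>
    rw [maxSize_cons]
    exact max_le (h _ (by simp)) (ih fun W hW => h W (by simp [hW]))

/-- The argument of an insertion into a trie: the edges, the labels, the trie, and the new set. -/
abbrev InsertArg : Type := (List (ℕ × ℕ) × List (ℕ × ℕ)) × (Trie × List ℕ)

namespace InsertArg

/-- The key of the new set. -/
def key (x : InsertArg) : List Bool := MaxCutCW.key x.1.2 x.2.2

/-- The final state of the way down. -/
def bottom (x : InsertArg) : Trie × List (Bool × (List (List ℕ) × Trie)) :=
  x.key.foldl Trie.down (x.2.1, [])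

/-- The measure that bounds the time of an insertion; it does not involve the size of the trie. -/
def size (x : InsertArg) : ℕ := sz x.1 + sz x.2.2 + sz (x.2.1.get x.key)

theorem pb_sz : PB size fun x => sz (x.1.2, x.2.2) := .of_le fun x => by
  have := sz_snd_le x.1
  simp only [size, sz_pair]; omega

theorem pt_key : PT size key :=
  PT.comp_poly (f := fun x : InsertArg => (x.1.2, x.2.2)) (g := fun y => MaxCutCW.key y.1 y.2)
    (by fun_prop) (by fun_prop) pb_sz

theorem pb_length_key : PB size fun x => x.key.length :=
  (PB.comp_poly (f := fun x : InsertArg => (x.1.2, x.2.2))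
    (g := fun y : List (ℕ × ℕ) × List ℕ => MaxCutCW.key y.1 y.2) (by fun_prop) pb_sz).length

theorem pt_bottom : PT size bottom := by
  obtain ⟨K, hK⟩ := ConstTime.foldl (s := Trie.down) (by unfold Trie.down; fun_prop)
  have h : PT size fun x : InsertArg =>
    ((x.2.1, ([] : List (Bool × (List (List ℕ) × Trie)))), x.key) :=
    PT.pair (ConstTime.pt (by fun_prop) _) pt_key
  exact PT.comp
    (s' := fun y : (Trie × List (Bool × (List (List ℕ) × Trie))) × List Bool => y.2.length)
    (f := fun x : InsertArg =>
    ((x.2.1, ([] : List (Bool × (List (List ℕ) × Trie)))), x.key))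
    (g := fun y => y.2.foldl Trie.down y.1)
    (.of_ct hK (.mul (.const K) (.add (.of_le fun _ => le_rfl) (.const 1)))) h pb_length_key

theorem pt_better : PT size fun x => better x.1.1 x.1.2 x.bottom.1.val x.2.2 := by
  refine PT.comp (s' := sz)
    (g := fun y : ((List (ℕ × ℕ) × List (ℕ × ℕ)) × List ℕ) × List (List ℕ) =>
      MaxCutCW.better y.1.1.1 y.1.1.2 y.2 y.1.2)
    (f := fun x : InsertArg => ((x.1, x.2.2), x.bottom.1.val))
    (Poly.pt (by fun_prop)) (.pair (ConstTime.pt (by fun_prop) _) ?_) (.of_le ?_)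
  · exact PT.comp (s' := fun _ => 0) (f := bottom)
      (g := fun y : Trie × List (Bool × (List (List ℕ) × Trie)) => y.1.val)
      (ConstTime.pt (by fun_prop) _) pt_bottom (.const 0)
  · intro x
    simp only [bottom, Trie.foldl_down_fst, size, Trie.get, sz_pair]
    exact le_rfl

theorem pt_node : PT size fun x => Trie.node (better x.1.1 x.1.2 x.bottom.1.val x.2.2)
    x.bottom.1.left x.bottom.1.right :=
  PT.comp (s' := fun _ => 0)
    (g := fun y : List (List ℕ) × (Trie × List (Bool × (List (List ℕ) × Trie))) =>
      Trie.node y.1 y.2.1.left y.2.1.right) (ConstTime.pt (by fun_prop) _)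
    (pt_better.pair pt_bottom) (.const 0)

/-- The time of an insertion does not depend on the size of the trie, because only the nodes on one
path are replaced and all other subtrees are shared. -/
theorem pt_modify : PT size fun x => x.2.1.modify (better x.1.1 x.1.2 · x.2.2) x.key := by
  obtain ⟨K, hK⟩ := ConstTime.foldl (s := Trie.up) (by unfold Trie.up; fun_prop)
  have h : PT size fun x => x.bottom.2 := PT.comp (s' := fun _ => 0) (f := bottom)
      (g := fun y : Trie × List (Bool × (List (List ℕ) × Trie)) => y.2)
      (ConstTime.pt (by fun_prop) _) pt_bottom (.const 0)
  have h' : PB size fun x => x.bottom.2.length := by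
    simpa [bottom, Trie.length_foldl_down] using pb_length_key
  obtain ⟨P, hP⟩ := PT.comp
    (s' := fun y : Trie × List (Bool × (List (List ℕ) × Trie)) => y.2.length)
    (g := fun y => y.2.foldl Trie.up y.1)
    (f := fun x : InsertArg => (Trie.node (MaxCutCW.better x.1.1 x.1.2 x.bottom.1.val x.2.2)
      x.bottom.1.left x.bottom.1.right, x.bottom.2))
    (PT.of_ct hK (.mul (.const K) (.add (.of_le fun _ => le_rfl) (.const 1))))
    (pt_node.pair h) h'
  exact ⟨P, hP.congr fun x => Trie.foldl_up (MaxCutCW.better x.1.1 x.1.2 · x.2.2) x.key (x.2.1, [])⟩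

end InsertArg

/-- The time to build a trie is linear in the number of sets. -/
theorem CT.buildTrie : ∃ P : Polynomial ℕ,
    CT (fun x : (List (ℕ × ℕ) × List (ℕ × ℕ)) × List (List ℕ) => buildTrie x.1.1 x.1.2 x.2)
      (fun x => (x.2.length + 1) * P.eval (sz x.1 + maxSize x.2)) := by
  obtain ⟨P, hP⟩ := InsertArg.pt_modify
  obtain ⟨k, hk⟩ : ConstTime fun x : (List (ℕ × ℕ) × List (ℕ × ℕ)) × List (List ℕ) =>
    (x.1, (Trie.leaf, x.2)) := by fun_prop
  have h := CT.foldl (s := fun (a : List (ℕ × ℕ) × List (ℕ × ℕ)) (t : Trie) (W : List ℕ) =>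
    t.modify (MaxCutCW.better a.1 a.2 · W) (MaxCutCW.key a.2 W)) hP
  refine ⟨.C (k + 200) + P.comp (2 * .X + 1), (h.comp hk).mono fun x => ?_⟩
  refine (Nat.add_le_add_left (Nat.add_le_add_right (foldTime_le
    (K := P.eval (2 * (sz x.1 + maxSize x.2) + 1))
    (fun t l => (∀ W ∈ l, W ∈ x.2) ∧ ∃ D, (∀ W ∈ D, W ∈ x.2) ∧
      t = MaxCutCW.buildTrie x.1.1 x.1.2 D) ?_ ?_ _ _ ?_) _) _).trans ?_
  · rintro t W l ⟨h1, D, h2, rfl⟩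
    refine ⟨fun W' h => h1 W' (by simp [h]), D ++ [W], ?_, by simp [MaxCutCW.buildTrie]⟩
    intro W' hW'
    rcases List.mem_append.1 hW' with h | h
    · exact h2 _ h
    · exact h1 _ (by simpa using .inl (List.mem_singleton.1 h))
  · rintro t W l ⟨h1, D, h2, rfl⟩
    apply eval_mono
    have h3 := sz_le_maxSize (h1 W (by simp))
    have h4 := sz_le_of_forall (K := maxSize x.2) fun A hA =>
      sz_le_maxSize (h2 A (mem_of_mem_get_buildTrie (E := x.1.1) (lab := x.1.2)
        (k := MaxCutCW.key x.1.2 W) hA).1)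
    have h5 := Nat.mul_le_mul_right (maxSize x.2)
      (length_get_buildTrie_le x.1.1 x.1.2 D (MaxCutCW.key x.1.2 W))
    simp only [InsertArg.size, InsertArg.key] at h4 ⊢
    omega
  · exact ⟨fun _ h => h, [], by simp, rfl⟩
  · simp [Polynomial.eval_comp]
    nlinarith

end MaxCutCW

/-! ### The running time of a union -/

namespace MaxCutCW

open Enc (enc)

section
variable {α : Type} {N s t u : α → ℕ}

/-- `t` is bounded by the product of `N` and a polynomial in `s`. -/
def EB {α : Type} (N s t : α → ℕ) : Prop := ∃ P : Polynomial ℕ, ∀ a, t a ≤ N a * P.eval (s a)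

theorem EB.mono (h : EB N s t) (ht : ∀ a, u a ≤ t a) : EB N s u := by
  obtain ⟨P, hP⟩ := h
  exact ⟨P, fun a => (ht a).trans (hP a)⟩

theorem EB.add (ht : EB N s t) (hu : EB N s u) : EB N s fun a => t a + u a := by
  obtain ⟨P, hP⟩ := ht
  obtain ⟨Q, hQ⟩ := hu
  exact ⟨P + Q, fun a => by simpa [Nat.mul_add] using Nat.add_le_add (hP a) (hQ a)⟩

theorem EB.mul (ht : EB N s t) (hu : PB s u) : EB N s fun a => t a * u a := by
  obtain ⟨P, hP⟩ := ht
  obtain ⟨Q, hQ⟩ := hu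
  exact ⟨P * Q, fun a => by
    simpa [Nat.mul_assoc] using Nat.mul_le_mul (hP a) (hQ a)⟩

theorem PB.eb (hN : ∀ a, 1 ≤ N a) (ht : PB s t) : EB N s t := by
  obtain ⟨P, hP⟩ := ht
  exact ⟨P, fun a => (hP a).trans (Nat.le_mul_of_pos_left _ (hN a))⟩

theorem EB.of_le (h : ∀ a, t a ≤ N a) : EB N s t := ⟨1, by simpa using h⟩

end

section
variable {α β γ δ : Type} [Enc α] [Enc β] [Enc γ] [Enc δ]

/-- A `flatMap` over a list that is itself computed from the argument. -/
theorem CT.flatMap' {l : α → List γ} {f : α → γ → List δ} {tl : α → ℕ} {tf : α × γ → ℕ}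
    (hl : CT l tl) (hf : CT (fun x : α × γ => f x.1 x.2) tf) :
    ∃ K, CT (fun a => (l a).flatMap (f a))
      (fun a => K * (1 + tl a + ((l a).map fun c => tf (a, c) + (f a c).length + 1).sum)) := by
  obtain ⟨K, hK⟩ := CT.flatMap hf
  refine ⟨K + 100, (hK.comp (CT.id.pair hl)).mono fun a => ?_⟩
  set S := ((l a).map fun c => tf (a, c) + (f a c).length + 1).sum
  have : 6 + tl a + 40 + K * (1 + S) ≤ (K + 100) * (1 + tl a + S) := by
    nlinarith [Nat.zero_le (K * tl a), Nat.zero_le S]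
  exact this

/-- The number of combinations of choices. -/
def numChoices {ι : Type} (cs : List (List ι)) : ℕ := (cs.map fun c => max 1 c.length).prod

theorem numChoices_pos {ι : Type} (cs : List (List ι)) : 1 ≤ numChoices cs := by
  induction cs with
  | nil => exact le_rfl
  | cons c cs ih =>
    rw [numChoices, List.map_cons, List.prod_cons]
    exact Nat.mul_pos (by omega) ih

theorem numChoices_append {ι : Type} (cs cs' : List (List ι)) :
    numChoices (cs ++ cs') = numChoices cs * numChoices cs' := by simp [numChoices]

theorem length_choiceProd_le {ι : Type} (cs : List (List (List ι))) :
    (choiceProd cs).length ≤ numChoices cs := by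
  induction cs using List.reverseRecOn with
  | nil => simp [choiceProd, numChoices]
  | append_singleton cs c ih =>
    rw [numChoices_append, choiceProd, List.foldl_append, ← choiceProd]
    simp only [List.foldl_cons, List.foldl_nil, List.length_flatMap, List.length_map,
      List.map_const', List.sum_replicate, smul_eq_mul]
    exact Nat.mul_le_mul ih (by simp [numChoices])

theorem sz_le_of_mem_choiceProd {cs : List (List (List γ))} {X : List γ}
    (h : X ∈ choiceProd cs) : sz X ≤ sz cs := by
  induction cs using List.reverseRecOn generalizing X with
  | nil => simp [choiceProd] at h; simp [h]
  | append_singleton cs c ih =>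
    obtain ⟨X, hX, Y, hY, rfl⟩ := mem_choiceProd_append.1 h
    have h1 := ih hX
    have h2 := sz_mem_lt hY
    have h3 := sz_append Y X
    have h4 := sz_append cs [c]
    simp at h4
    omega

/-- The time to enumerate all combinations of choices is polynomial for each combination. -/
theorem CT.choiceProd : ∃ P : Polynomial ℕ, CT (fun cs : List (List (List γ)) => choiceProd cs)
    (fun cs => numChoices cs * P.eval (sz cs)) := by
  obtain ⟨K₁, h₁⟩ := CT.append (α := γ)
  obtain ⟨k, hk⟩ : ConstTime fun X : List γ => [X] := by
    have : ConstTime fun X : List γ => ([] : List (List γ)) := .const _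
    fun_prop
  obtain ⟨K₂, h₂⟩ := CT.flatMap (α := List γ) (f := fun X Y => [Y ++ X])
    (hk.comp (h₁.comp (CT.snd.pair CT.fst)))
  have h₂' : CT (fun x : List γ × List (List γ) => x.2.map fun Y => Y ++ x.1)
      (fun x => K₂ * ((K₁ + k + 100) * sz x.2)) := by
    refine (h₂.congr fun x => by rw [List.map_eq_flatMap]).mono fun x => ?_
    gcongr
    rw [sz_eq_sum, Nat.mul_add]
    have : ∀ c : List γ, 8 + 8 + 40 + K₁ * (c.length + 1) + k + 1 + 1 ≤ (K₁ + k + 100) * sz c := by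
      intro c
      have := length_lt_sz c
      nlinarith [Nat.mul_le_mul_left K₁ this]
    have h := List.sum_le_sum (l := x.2) fun c _ => this c
    rw [List.sum_map_mul_left] at h
    simp only [List.length_singleton]
    omega
  obtain ⟨K₃, h₃⟩ := CT.flatMap (α := List (List γ)) (f := fun c X => c.map fun Y => Y ++ X)
    (h₂'.comp (CT.snd.pair CT.fst))
  obtain ⟨k', hk'⟩ : ConstTime fun cs : List (List (List γ)) => ((), ([([] : List γ)], cs)) := by
    have : ConstTime fun X : List (List (List γ)) => [([] : List γ)] := .const _
    fun_prop
  have h₄ := CT.foldl (α := Unit) (β := List (List γ)) (γ := List (List γ))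
    (s := fun _ acc c => acc.flatMap fun X => c.map fun Y => Y ++ X)
    (h₃.comp ((CT.comp CT.snd CT.snd).pair (CT.comp CT.fst CT.snd)))
  obtain ⟨Q, hQ⟩ : EB (fun cs : List (List (List γ)) => numChoices cs) sz fun cs =>
      k' + (100 + (100 + (100 + K₃ * (1 + numChoices cs * (200 + K₂ * ((K₁ + k + 100) * sz cs)
        + sz cs + 1)))) * sz cs + 20) := by
    have hc : ∀ k : ℕ, EB (fun cs : List (List (List γ)) => numChoices cs) sz fun _ => k :=
      fun k => (PB.const k).eb numChoices_pos
    have hs : PB (sz : List (List (List γ)) → ℕ) sz := .of_le fun _ => le_rfl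
    refine (hc _).add (((hc _).add (((hc _).add ((hc _).add ?_)).mul hs)).add (hc _))
    refine (((hc 1).add (EB.mul (.of_le fun _ => le_rfl) ((((PB.const 200).add
      ((PB.const (K₂ * (K₁ + k + 100))).mul hs)).add hs).add (.const 1)))).mul (.const K₃)).mono
      fun cs => le_of_eq ?_
    ring
  refine ⟨Q, (h₄.comp hk').mono fun cs => le_trans ?_ (hQ cs)⟩
  refine Nat.add_le_add_left (Nat.add_le_add_right ((foldTime_le
    (fun acc l => ∃ cs', cs' ++ l = cs ∧ acc = MaxCutCW.choiceProd cs') (K := 100 + K₃ * (1 +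
      numChoices cs * (200 + K₂ * ((K₁ + k + 100) * sz cs)
        + sz cs + 1))) ?_ ?_ _ _ ⟨[], rfl, rfl⟩).trans ?_) _) _
  · rintro acc c l ⟨cs', rfl, rfl⟩
    exact ⟨cs' ++ [c], by simp, by simp [MaxCutCW.choiceProd]⟩
  · rintro acc c l ⟨cs', rfl, rfl⟩
    simp only [List.length_map, List.map_const', List.sum_replicate, smul_eq_mul]
    have h1 : sz c < sz (cs' ++ c :: l) := sz_mem_lt (by simp)
    have h2 := length_lt_sz c
    have h3 : (MaxCutCW.choiceProd cs').length ≤ numChoices (cs' ++ c :: l) := by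
      rw [numChoices_append]
      exact (length_choiceProd_le _).trans (Nat.le_mul_of_pos_right _ (numChoices_pos _))
    have : 8 + 8 + (8 + 8) + 40 + K₃ * (1 + (MaxCutCW.choiceProd cs').length * (8 + 8 + 40 +
        K₂ * ((K₁ + k + 100) * sz c) + c.length + 1)) ≤ 100 + K₃ * (1 +
      numChoices (cs' ++ c :: l) * (200 + K₂ * ((K₁ + k + 100) * sz (cs' ++ c :: l))
        + sz (cs' ++ c :: l) + 1)) := by
      gcongr
      · omega
      · omega
      · omega
    exact this
  · gcongr
    exact (length_lt_sz cs).le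

end

end MaxCutCW

namespace MaxCutCW

open Enc (enc)

section
variable {α : Type} [Enc α]

@[fun_prop] theorem Poly.same {e : α → List (ℕ × ℕ)} {f g : α → ℕ}
    (he : Poly e) (hf : Poly f) (hg : Poly g) : Poly fun a => same (e a) (f a) (g a) := by
  unfold MaxCutCW.same twin
  fun_prop

@[fun_prop] theorem Poly.outside {v l : α → List ℕ} {f : α → List (ℕ × ℕ)}
    (hv : Poly v) (hf : Poly f) (hl : Poly l) : Poly fun a => outside (v a) (f a) (l a) := by
  unfold MaxCutCW.outside
  fun_prop

@[fun_prop] theorem Poly.bubbles {e : α → List (ℕ × ℕ)} {o : α → List ℕ}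
    (he : Poly e) (ho : Poly o) : Poly fun a => bubbles (e a) (o a) := by
  unfold MaxCutCW.bubbles
  fun_prop

@[fun_prop] theorem Poly.suffixChoices {o : α → List (List ℕ)}
    (ho : Poly o) : Poly fun a => suffixChoices (o a) := by
  unfold MaxCutCW.suffixChoices
  fun_prop

@[fun_prop] theorem Poly.labelList {e : α → List (ℕ × ℕ)} {f : α → ℕ}
    (he : Poly e) (hf : Poly f) : Poly fun a => labelList (e a) (f a) := by
  unfold MaxCutCW.labelList
  fun_prop

@[fun_prop] theorem Poly.classLists {e : α → List (ℕ × ℕ)} (he : Poly e) :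
    Poly fun a => classLists (e a) := by
  unfold MaxCutCW.classLists
  fun_prop

@[fun_prop] theorem Poly.choices (n d : ℕ) {b : α → List (List ℕ)} {f g : α → List (ℕ × ℕ)}
    (hb : Poly b) (hf : Poly f) (hg : Poly g) :
    Poly fun a => choices n d (b a) (f a) (g a) := by
  unfold MaxCutCW.choices
  fun_prop

@[fun_prop] theorem Poly.guardedChoices (n d : ℕ) {v k l : α → List ℕ} {e f g : α → List (ℕ × ℕ)}
    (hv : Poly v) (he : Poly e) (hk : Poly k) (hf : Poly f) (hg : Poly g) (hl : Poly l) :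
    Poly fun a => guardedChoices n d (v a) (e a) (k a) (f a) (g a) (l a) := by
  unfold MaxCutCW.guardedChoices
  fun_prop

theorem numChoices_map_pair {ι κ : Type} (l : List κ) (f g : κ → ι) :
    numChoices (l.map fun B => [f B, g B]) = 2 ^ l.length := by
  simp [numChoices, Function.comp_def]

theorem numChoices_replicate {ι : Type} (n : ℕ) (c : List ι) :
    numChoices (List.replicate n c) = (max 1 c.length) ^ n := by
  simp [numChoices]

@[fun_prop] theorem Poly.labelSets (d : ℕ) {l : α → List ℕ} (hl : Poly l) :
    Poly fun a => labelSets d (l a) := by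
  suffices h : Poly fun l : List ℕ => MaxCutCW.labelSets d l from h.comp hl
  unfold MaxCutCW.labelSets
  have h : Poly fun l : List ℕ => List.replicate d ([] :: l.map fun i => [i]) := by fun_prop
  have hN : PB sz fun l : List ℕ => numChoices (List.replicate d ([] :: l.map fun i => [i])) := by
    simp only [numChoices_replicate]
    exact .pow (.of_le fun l => by have := length_lt_sz l; simp; omega) _
  obtain ⟨P, hP⟩ := CT.choiceProd (γ := ℕ)
  have h' := h
  obtain ⟨P', hP', -⟩ := h'
  obtain ⟨Q, hQ⟩ : PT sz fun l : List ℕ =>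
      choiceProd (List.replicate d ([] :: l.map fun i => [i])) :=
    .of_ct (hP.comp hP') (.add ⟨P', fun _ => le_rfl⟩ (hN.mul (h.sz_pb.eval P)))
  obtain ⟨R, hR⟩ := (hN.mul h.sz_pb).add (.const 1)
  refine .mk' Q R hQ fun l => (le_trans ?_ (hR l))
  refine (sz_le_of_forall fun X hX => sz_le_of_mem_choiceProd hX).trans ?_
  exact Nat.add_le_add_right (Nat.mul_le_mul_right _ (length_choiceProd_le _)) _

end

/-- The data that are the same for all nodes: the vertices, the edges, the labels, and a list whose
length bounds the number of bubbles. -/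
abbrev Glob : Type := List ℕ × (List (ℕ × ℕ) × (List ℕ × List ℕ))

/-- The argument of a union: the global data, and the labels and tables of both children. -/
abbrev UnionArg : Type :=
  (Glob × (List (ℕ × ℕ) × List (ℕ × ℕ))) × (List (List ℕ) × List (List ℕ))

namespace UnionArg

/-- The size of the argument, where the lengths of the tables do not count. -/
def size (x : UnionArg) : ℕ := sz x.1 + maxSize x.2.1 + maxSize x.2.2

/-- The exponential factor in the time of a union. -/
def weight (x : UnionArg) : ℕ := 2 ^ x.1.1.2.2.2.length + x.2.1.length + x.2.2.length

theorem one_le_weight (x : UnionArg) : 1 ≤ x.weight := by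
  have := Nat.one_le_two_pow (n := x.1.1.2.2.2.length)
  unfold weight
  omega

/-- The trie of the first child. -/
def trieS (x : UnionArg) : Trie := buildTrie x.1.1.2.1 x.1.2.1 x.2.1

/-- The trie of the second child. -/
def trieT (x : UnionArg) : Trie := buildTrie x.1.1.2.1 x.1.2.2 x.2.2

end UnionArg

/-- A union argument, represented together with both tries. -/
structure Built : Type where
  /-- The argument. -/
  arg : UnionArg

instance : Enc Built := ⟨fun b => enc ((b.arg.trieS, b.arg.trieT), b.arg.1)⟩

/-- Both tries of a union can be built in time linear in the lengths of the tables. -/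
theorem ct_built : ∃ t, CT Built.mk t ∧ EB UnionArg.weight UnionArg.size t := by
  obtain ⟨P, hP⟩ := CT.buildTrie
  obtain ⟨k₁, h₁⟩ : ConstTime fun x : UnionArg => ((x.1.1.2.1, x.1.2.1), x.2.1) := by fun_prop
  obtain ⟨k₂, h₂⟩ : ConstTime fun x : UnionArg => ((x.1.1.2.1, x.1.2.2), x.2.2) := by fun_prop
  obtain ⟨k₃, h₃⟩ : ConstTime fun x : UnionArg => x.1 := by fun_prop
  obtain ⟨p, hp⟩ := ((hP.comp h₁).pair (hP.comp h₂)).pair h₃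
  have hc : ∀ k : ℕ, EB UnionArg.weight UnionArg.size fun _ => k :=
      fun k => (PB.const k).eb UnionArg.one_le_weight
  refine ⟨_, ⟨p, fun x => hp x⟩, ((((hc _).add ?_).add ((hc _).add ?_)).add
    (hc _)).add (hc _) |>.add (hc _)⟩
  · refine EB.mul (.of_le fun x => ?_) (.eval _ (.of_le fun x => ?_))
    · have := Nat.one_le_two_pow (n := x.1.1.2.2.2.length)
      simp only [UnionArg.weight]; omega
    · obtain ⟨⟨⟨V, E, l, f⟩, lS, lT⟩, D, D'⟩ := x
      simp only [UnionArg.size, sz_pair]; omega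
  · refine EB.mul (.of_le fun x => ?_) (.eval _ (.of_le fun x => ?_))
    · have := Nat.one_le_two_pow (n := x.1.1.2.2.2.length)
      simp only [UnionArg.weight]; omega
    · obtain ⟨⟨⟨V, E, l, f⟩, lS, lT⟩, D, D'⟩ := x
      simp only [UnionArg.size, sz_pair]; omega

@[fun_prop] theorem ConstTime.built {α : Type} [Enc α] {f : α → Built} (hf : ConstTime f) :
    ConstTime fun a => (((f a).arg.trieS, (f a).arg.trieT), (f a).arg.1) :=
  ConstTime.comp (g := fun b : Built => ((b.arg.trieS, b.arg.trieT), b.arg.1))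
    ⟨_, CT.expr (.hd .st) fun σ r b => by simp [Expr.eval, Data.hd, enc]⟩ hf

@[fun_prop] theorem ConstTime.built_trieS {α : Type} [Enc α] {f : α → Built} (hf : ConstTime f) :
    ConstTime fun a => (f a).arg.trieS := hf.built.fst.fst

@[fun_prop] theorem ConstTime.built_trieT {α : Type} [Enc α] {f : α → Built} (hf : ConstTime f) :
    ConstTime fun a => (f a).arg.trieT := hf.built.fst.snd

@[fun_prop] theorem ConstTime.built_arg {α : Type} [Enc α] {f : α → Built} (hf : ConstTime f) :
    ConstTime fun a => (f a).arg.1 := hf.built.snd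

/-- The measure for the search with the set `X` in the tries. -/
def lookupSize (x : Built × List ℕ) : ℕ := x.1.arg.size + sz x.2

/-- The search with the set `X` in the tries. -/
def Built.lookup (x : Built × List ℕ) : List (List ℕ) :=
  lookupBoth x.1.arg.1.2.1 x.1.arg.1.2.2 x.1.arg.trieS x.1.arg.trieT x.2

/-- A search takes time polynomial in the size of a single set, irrespective of the lengths of the
tables. -/
theorem pt_lookup : PT lookupSize Built.lookup := by
  obtain ⟨K, hK⟩ := CT.trie_get
  have hK' : PT (fun x : List Bool × Trie => x.1.length) fun x => x.2.get x.1 :=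
    .of_ct hK (.mul (.const K) (.add (.of_le fun _ => le_rfl) (.const 1)))
  have bS : PB lookupSize fun x => sz (x.1.arg.1.2.1, x.2) := .of_le fun x => by
    obtain ⟨⟨⟨⟨⟨V, E, l, f⟩, lS, lT⟩, D, D'⟩⟩, X⟩ := x
    simp only [lookupSize, UnionArg.size, sz_pair]; omega
  have bT : PB lookupSize fun x => sz (x.1.arg.1.2.2, x.2) := .of_le fun x => by
    obtain ⟨⟨⟨⟨⟨V, E, l, f⟩, lS, lT⟩, D, D'⟩⟩, X⟩ := x
    simp only [lookupSize, UnionArg.size, sz_pair]; omega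
  have kS : PT lookupSize fun x => key x.1.arg.1.2.1 x.2 :=
    PT.comp_poly (f := fun x : Built × List ℕ => (x.1.arg.1.2.1, x.2))
      (g := fun y => key y.1 y.2) (by fun_prop) (by fun_prop) bS
  have kT : PT lookupSize fun x => key x.1.arg.1.2.2 x.2 :=
    PT.comp_poly (f := fun x : Built × List ℕ => (x.1.arg.1.2.2, x.2))
      (g := fun y => key y.1 y.2) (by fun_prop) (by fun_prop) bT
  have gS : PT lookupSize fun x => x.1.arg.trieS.get (key x.1.arg.1.2.1 x.2) :=
    hK'.comp (f := fun x : Built × List ℕ => (key x.1.arg.1.2.1 x.2, x.1.arg.trieS))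
      (kS.pair (ConstTime.pt (by fun_prop) _))
      (PB.comp_poly (g := fun y : List (ℕ × ℕ) × List ℕ => key y.1 y.2) (by fun_prop) bS).length
  have gT : PT lookupSize fun x => x.1.arg.trieT.get (key x.1.arg.1.2.2 x.2) :=
    hK'.comp (f := fun x : Built × List ℕ => (key x.1.arg.1.2.2 x.2, x.1.arg.trieT))
      (kT.pair (ConstTime.pt (by fun_prop) _))
      (PB.comp_poly (g := fun y : List (ℕ × ℕ) × List ℕ => key y.1 y.2) (by fun_prop) bT).length
  have sb : ∀ E lab (D : List (List ℕ)) k, sz ((buildTrie E lab D).get k) ≤ maxSize D + 1 := by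
    intro E lab D k
    refine (sz_le_of_forall (K := maxSize D) fun A hA =>
      sz_le_maxSize (mem_of_mem_get_buildTrie hA).1).trans ?_
    have := Nat.mul_le_mul_right (maxSize D) (length_get_buildTrie_le E lab D k)
    omega
  refine PT.comp (s' := sz)
    (g := fun y : List (List ℕ) × List (List ℕ) => y.1.flatMap fun A => y.2.map fun B => A ++ B)
    (f := fun x : Built × List ℕ => (x.1.arg.trieS.get (key x.1.arg.1.2.1 x.2),
      x.1.arg.trieT.get (key x.1.arg.1.2.2 x.2))) (Poly.pt (by fun_prop)) (gS.pair gT) ?_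
  refine ((PB.of_le fun _ => le_rfl).add (.const 2)).mono fun x => ?_
  have h1 := sb x.1.arg.1.1.2.1 x.1.arg.1.2.1 x.1.arg.2.1 (key x.1.arg.1.2.1 x.2)
  have h2 := sb x.1.arg.1.1.2.1 x.1.arg.1.2.2 x.1.arg.2.2 (key x.1.arg.1.2.2 x.2)
  simp only [sz_pair, UnionArg.trieS, UnionArg.trieT, lookupSize, UnionArg.size] at h1 h2 ⊢
  omega

theorem length_lookup_le (x : Built × List ℕ) : (Built.lookup x).length ≤ 1 := by
  simp only [Built.lookup, lookupBoth, List.length_flatMap, List.length_map, List.map_const',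
    List.sum_replicate, smul_eq_mul]
  exact Nat.mul_le_mul (length_get_buildTrie_le _ _ _ _) (length_get_buildTrie_le _ _ _ _)

theorem sum_map_le {ι : Type} {l : List ι} {f : ι → ℕ} {B : ℕ} (h : ∀ a ∈ l, f a ≤ B) :
    (l.map f).sum ≤ l.length * B := by
  have := List.sum_le_card_nsmul (l.map f) B (by simpa using h)
  simpa using this

/-- The choices for the set `L` of labels in a union. -/
def Built.choices (n d : ℕ) (x : Built × List ℕ) : List (List (List ℕ)) :=
  guardedChoices n d x.1.arg.1.1.1 x.1.arg.1.1.2.1 x.1.arg.1.1.2.2.2 x.1.arg.1.2.1 x.1.arg.1.2.2 x.2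

theorem pb_small : PB lookupSize fun x => sz (x.1.arg.1, x.2) := .of_le fun x => by
  simp only [lookupSize, UnionArg.size, sz_pair]; omega

theorem poly_choices (n d : ℕ) : Poly fun y : (Glob × (List (ℕ × ℕ) × List (ℕ × ℕ))) × List ℕ =>
    guardedChoices n d y.1.1.1 y.1.1.2.1 y.1.1.2.2.2 y.1.2.1 y.1.2.2 y.2 := by
  fun_prop

theorem pt_choices (n d : ℕ) : PT lookupSize (Built.choices n d) :=
  PT.comp_poly (f := fun x : Built × List ℕ => (x.1.arg.1, x.2)) (poly_choices n d) (by fun_prop)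
    pb_small

theorem pb_choices (n d : ℕ) : PB lookupSize fun x => sz (Built.choices n d x) :=
  PB.comp_poly (f := fun x : Built × List ℕ => (x.1.arg.1, x.2)) (poly_choices n d) pb_small

end MaxCutCW

namespace MaxCutCW

open Enc (enc)

/-- Since the number of bubbles is bounded, so is the number of combinations of choices. -/
theorem eb_numChoices (n d : ℕ) :
    EB (fun x => x.1.arg.weight) lookupSize fun x => numChoices (Built.choices n d x) := by
  have h1 : PB lookupSize fun x => sz (suffixChoices (bubbles x.1.arg.1.1.2.1
      (outside x.1.arg.1.1.1 (x.1.arg.1.2.1 ++ x.1.arg.1.2.2) x.2))) :=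
    PB.comp_poly (f := fun x : Built × List ℕ => (x.1.arg.1, x.2))
      (g := fun y => suffixChoices (bubbles y.1.1.2.1
        (outside y.1.1.1 (y.1.2.1 ++ y.1.2.2) y.2))) (by fun_prop) pb_small
  have h2 : PB lookupSize fun x => sz (suffixChoices (classLists x.1.arg.1.2.1)) :=
    PB.comp_poly (f := fun x : Built × List ℕ => (x.1.arg.1, x.2))
      (g := fun y => suffixChoices (classLists y.1.2.1)) (by fun_prop) pb_small
  have h3 : PB lookupSize fun x => sz (suffixChoices (classLists x.1.arg.1.2.2)) :=
    PB.comp_poly (f := fun x : Built × List ℕ => (x.1.arg.1, x.2))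
      (g := fun y => suffixChoices (classLists y.1.2.2)) (by fun_prop) pb_small
  have hle : ∀ c : List (List ℕ), max 1 c.length ≤ sz c := fun c => by
    have := length_lt_sz c; omega
  refine (EB.mul (.of_le fun x => le_rfl) (((h1.pow n).mul ((h2.pow d).mul (h3.pow d))))).mono
    fun x => ?_
  have hw : 2 ^ x.1.arg.1.1.2.2.2.length ≤ x.1.arg.weight := by
    simp only [UnionArg.weight]; omega
  unfold Built.choices guardedChoices
  split
  · rename_i h
    simp only [MaxCutCW.choices, numChoices_append, numChoices_map_pair, numChoices_replicate]
    gcongr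
    · exact (Nat.pow_le_pow_right (by norm_num) h).trans hw
    all_goals exact hle _
  · refine (le_of_eq (b := 1) (by simp [numChoices])).trans ?_
    exact Nat.mul_pos x.1.arg.one_le_weight (Nat.mul_pos (Nat.pow_pos (sz_pos _))
      (Nat.mul_pos (Nat.pow_pos (sz_pos _)) (Nat.pow_pos (sz_pos _))))

/-- The part of the table of a union that is obtained with a given set of labels. -/
def Built.part (n d : ℕ) (x : Built × List ℕ) : List (List ℕ) :=
  (choiceProd (Built.choices n d x)).flatMap fun X => Built.lookup (x.1, X)

theorem length_part_le (n d : ℕ) (x : Built × List ℕ) :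
    (Built.part n d x).length ≤ numChoices (Built.choices n d x) := by
  rw [Built.part, List.length_flatMap]
  refine (sum_map_le (B := 1) fun X _ => length_lookup_le (x.1, X)).trans ?_
  rw [mul_one]
  exact length_choiceProd_le _

theorem ct_part (n d : ℕ) : ∃ t, CT (Built.part n d) t ∧
    EB (fun x => x.1.arg.weight) lookupSize t := by
  obtain ⟨P, hP⟩ := CT.choiceProd (γ := ℕ)
  obtain ⟨Q, hQ⟩ := pt_choices n d
  obtain ⟨R, hR⟩ := pt_lookup
  obtain ⟨k, hk⟩ : ConstTime fun x : (Built × List ℕ) × List ℕ => (x.1.1, x.2) := by fun_prop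
  have hl : CT (fun x : (Built × List ℕ) × List ℕ => Built.lookup (x.1.1, x.2))
    (fun x => k + R.eval (lookupSize (x.1.1, x.2))) := hR.comp hk
  obtain ⟨K, hK⟩ := CT.flatMap' (f := fun (x : Built × List ℕ) (X : List ℕ) =>
    Built.lookup (x.1, X)) (hP.comp hQ) hl
  refine ⟨_, hK, ?_⟩
  have hN := eb_numChoices n d
  have hcs := pb_choices n d
  have hw : ∀ x : Built × List ℕ, 1 ≤ x.1.arg.weight := fun x => x.1.arg.one_le_weight
  have hB : PB lookupSize fun x => k + R.eval (lookupSize x + sz (Built.choices n d x)) + 1 + 1 :=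
    (((PB.const k).add (.eval R ((PB.of_le fun _ => le_rfl).add hcs))).add (.const 1)).add
      (.const 1)
  have hQ' : PB lookupSize fun x => 1 + Q.eval (lookupSize x) :=
    (PB.const 1).add ⟨Q, fun _ => le_rfl⟩
  have h := ((PB.eb hw hQ').add ((hN.mul (PB.eval P hcs)).add (hN.mul hB))).mul (PB.const K)
  refine h.mono fun x => ?_
  have hsum : ((choiceProd (Built.choices n d x)).map fun c => k + R.eval (lookupSize (x.1, c)) +
      (Built.lookup (x.1, c)).length + 1).sum ≤ numChoices (Built.choices n d x) *
        (k + R.eval (lookupSize x + sz (Built.choices n d x)) + 1 + 1) := by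
    refine (sum_map_le fun X hX => ?_).trans (Nat.mul_le_mul_right _ (length_choiceProd_le _))
    have h1 := length_lookup_le (x.1, X)
    have h2 := sz_le_of_mem_choiceProd hX
    have h3 := eval_mono R (show lookupSize (x.1, X) ≤ lookupSize x + sz (Built.choices n d x) by
      simp only [lookupSize]; omega)
    omega
  have h4 := Nat.mul_le_mul_left K (Nat.add_le_add_left hsum (1 + (Q.eval (lookupSize x) +
    numChoices (Built.choices n d x) * P.eval (sz (Built.choices n d x)))))
  refine h4.trans (le_of_eq ?_)
  ring

/-- The table of a union, as a function of its argument. -/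
def UnionArg.table (n d : ℕ) (x : UnionArg) : List (List ℕ) :=
  unionTable n d x.1.1.1 x.1.1.2.1 x.1.1.2.2.1 x.1.1.2.2.2 x.1.2.1 x.1.2.2 x.2.1 x.2.2

theorem pb_labelSets (d : ℕ) : PB UnionArg.size fun x => sz (labelSets d x.1.1.2.2.1) :=
  PB.comp_poly (f := fun x : UnionArg => x.1) (g := fun y => labelSets d y.1.2.2.1)
    (by fun_prop) (.of_le fun x => by simp only [UnionArg.size]; omega)

/-- The length of the table of a union depends only on the number of guesses, and not on the lengths
of the tables of the children; hence the lengths do not accumulate along the decomposition. -/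
theorem length_table_le (n d : ℕ) :
    ∃ P : Polynomial ℕ, ∀ x : UnionArg, (x.table n d).length ≤
      2 ^ x.1.1.2.2.2.length * P.eval (sz x.1) := by
  obtain ⟨P, hP⟩ := eb_numChoices n d
  obtain ⟨Q, hQ⟩ := (Poly.labelSets d .id).sz_pb
  -- the number of combinations does not depend on the tables, so they may be taken to be empty
  refine ⟨Q * P.comp (.X + Q), fun x => ?_⟩
  let b : Built := ⟨(x.1, ([], []))⟩
  have h : ∀ L, Built.choices n d (⟨x⟩, L) = Built.choices n d (b, L) := fun L => rfl
  have hlab := hQ x.1.1.2.2.1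
  have hsz : sz x.1.1.2.2.1 ≤ sz x.1 := by
    obtain ⟨⟨⟨V, E, l, f⟩, lS, lT⟩, D, D'⟩ := x
    simp only [sz_pair]; omega
  simp only at hlab
  replace hlab := hlab.trans (eval_mono Q hsz)
  rw [UnionArg.table, unionTable, List.length_flatMap]
  refine (sum_map_le (B := 2 ^ x.1.1.2.2.2.length * P.eval (sz x.1 + Q.eval (sz x.1)))
    fun L hL => ?_).trans ?_
  · refine (length_part_le n d (⟨x⟩, L)).trans ?_
    rw [h]
    refine (hP (b, L)).trans ?_
    have h1 : b.arg.weight = 2 ^ x.1.1.2.2.2.length := by simp [b, UnionArg.weight]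
    have h2 : lookupSize (b, L) ≤ sz x.1 + Q.eval (sz x.1) := by
      have := sz_mem_lt hL
      simp only [lookupSize, b, UnionArg.size, maxSize, List.map_nil, List.foldr_nil]
      omega
    simp only [h1]
    exact Nat.mul_le_mul_left _ (eval_mono P h2)
  · have h3 := (length_lt_sz _).le.trans hlab
    simp only [Polynomial.eval_mul, Polynomial.eval_comp, Polynomial.eval_add, Polynomial.eval_X]
    calc _ ≤ Q.eval (sz x.1) * (2 ^ x.1.1.2.2.2.length * P.eval (sz x.1 + Q.eval (sz x.1))) :=
          Nat.mul_le_mul_right _ h3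
      _ = _ := by ring

/-- The time of a union is the number of guesses plus the lengths of the tables of the children, up
to a polynomial factor. -/
theorem ct_table (n d : ℕ) : ∃ t, CT (UnionArg.table n d) t ∧
    EB UnionArg.weight UnionArg.size t := by
  obtain ⟨tp, hp, P, hP⟩ := ct_part n d
  obtain ⟨tb, hb, hb'⟩ := ct_built
  obtain ⟨R, hR⟩ := eb_numChoices n d
  obtain ⟨Q, hQ⟩ : PT (fun b : Built => b.arg.size) fun b : Built => labelSets d b.arg.1.1.2.2.1 :=
    PT.comp_poly (f := fun b : Built => b.arg.1) (g := fun y => labelSets d y.1.2.2.1)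
      (by fun_prop) (by fun_prop) (.of_le fun x => by simp only [UnionArg.size]; omega)
  obtain ⟨K, hK⟩ := CT.flatMap' (f := fun (b : Built) L => Built.part n d (b, L)) hQ hp
  refine ⟨_, hK.comp hb, hb'.add ?_⟩
  have hs := pb_labelSets d
  have hB : EB UnionArg.weight UnionArg.size fun x =>
      x.weight * (P.eval (x.size + sz (labelSets d x.1.1.2.2.1)) +
        R.eval (x.size + sz (labelSets d x.1.1.2.2.1)) + 1) :=
    EB.mul (.of_le fun _ => le_rfl) (((PB.eval P ((PB.of_le fun _ => le_rfl).add hs)).add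
      (PB.eval R ((PB.of_le fun _ => le_rfl).add hs))).add (.const 1))
  refine (((PB.eb UnionArg.one_le_weight ((PB.const 1).add ⟨Q, fun _ => le_rfl⟩)).add
    (hB.mul hs)).mul (.const K)).mono fun x => ?_
  have : ((labelSets d x.1.1.2.2.1).map fun c => tp (⟨x⟩, c) +
      (Built.part n d (⟨x⟩, c)).length + 1).sum ≤ sz (labelSets d x.1.1.2.2.1) *
      (x.weight * (P.eval (x.size + sz (labelSets d x.1.1.2.2.1)) +
        R.eval (x.size + sz (labelSets d x.1.1.2.2.1)) + 1)) := by
    refine (sum_map_le fun L hL => ?_).trans (Nat.mul_le_mul_right _ (length_lt_sz _).le)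
    have h1 := hP (⟨x⟩, L)
    have h2 := (length_part_le n d (⟨x⟩, L)).trans (hR (⟨x⟩, L))
    have h3 : lookupSize (⟨x⟩, L) ≤ x.size + sz (labelSets d x.1.1.2.2.1) := by
      have := sz_mem_lt hL
      simp only [lookupSize]; omega
    have h4 := Nat.mul_le_mul_left x.weight (eval_mono P h3)
    have h5 := Nat.mul_le_mul_left x.weight (eval_mono R h3)
    have h6 := x.one_le_weight
    simp only [Nat.mul_add] at h1 h2 ⊢
    omega
  have h4 := Nat.mul_le_mul_left K (Nat.add_le_add_left this (1 + Q.eval x.size))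
  refine h4.trans (le_of_eq ?_)
  ring

end MaxCutCW

/-! ### Linearization of decompositions -/

namespace MaxCutCW

open Enc (enc)

/-- A decomposition of a graph with any number of vertices. -/
abbrev SDecomp : Type := Σ n : ℕ, Decomp (Fin n)

instance : Enc SDecomp := ⟨fun T => encDecomp T.2⟩

/-- An instruction of a stack machine: the tag of an operation and two numbers. -/
abbrev Instr : Type := ℕ × (ℕ × ℕ)

/-- The operations of a decomposition in an order in which every subexpression precedes the
operation that is applied to it, the second operand of a union being the first in the list. -/
def lin {n : ℕ} : Decomp (Fin n) → List Instr
  | .vertex l v => [(0, l, v)]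
  | .union s t => lin t ++ (lin s ++ [(1, 0, 0)])
  | .join i j t => lin t ++ [(2, i, j)]
  | .relabel i j t => lin t ++ [(3, i, j)]

theorem enc_zero : enc (0 : ℕ) = .nil := rfl

theorem enc_one : enc (1 : ℕ) = .node () (encBool true) .nil := by
  change encList (List.map encBool (Nat.bits 1)) = _
  rw [Nat.one_bits]
  rfl

theorem enc_two : enc (2 : ℕ) = .node () .nil (.node () (encBool true) .nil) := by
  change encList (List.map encBool (Nat.bits (2 * 1))) = _
  rw [Nat.bit0_bits _ one_ne_zero, Nat.one_bits]
  rfl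

theorem enc_three :
    enc (3 : ℕ) = .node () (encBool true) (.node () (encBool true) .nil) := by
  change encList (List.map encBool (Nat.bits (2 * 1 + 1))) = _
  rw [Nat.bit1_bits, Nat.one_bits]
  rfl

theorem sz_lin_le {n : ℕ} (T : Decomp (Fin n)) : sz (lin T) ≤ (encDecomp T).size := by
  have e : ∀ a b : Data, Data.size (.node () a b) = Data.size a + Data.size b := fun _ _ => rfl
  have e0 : Data.size .nil = 1 := rfl
  have ez : sz 0 = 1 := rfl
  have en : ∀ k, (encNat k).size = sz k := fun _ => rfl
  induction T with
  | vertex l v =>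
    simp only [lin, encDecomp, encList, sz_cons, sz_nil, sz_pair, e, e0, en]
    omega
  | union s t ihs iht =>
    have h1 := sz_append (lin t) (lin s ++ [(1, 0, 0)])
    have h2 := sz_append (lin s) [(1, 0, 0)]
    simp only [lin, encDecomp, encList, sz_cons, sz_nil, sz_pair, e, e0, en] at h1 h2 ⊢
    omega
  | join i j t ih =>
    have h1 := sz_append (lin t) [(2, i, j)]
    simp only [lin, encDecomp, encList, sz_cons, sz_nil, sz_pair, e, e0, en] at h1 ⊢
    omega
  | relabel i j t ih =>
    have h1 := sz_append (lin t) [(3, i, j)]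
    simp only [lin, encDecomp, encList, sz_cons, sz_nil, sz_pair, e, e0, en] at h1 ⊢
    omega

/-- One step of the linearization: the state consists of the expressions that are still to be
processed and of the output so far. -/
def linStep : List SDecomp × List Instr → List SDecomp × List Instr
  | ([], out) => ([], out)
  | (⟨_, .vertex l v⟩ :: st, out) => (st, (0, l, v) :: out)
  | (⟨n, .union s t⟩ :: st, out) => (⟨n, s⟩ :: ⟨n, t⟩ :: st, (1, 0, 0) :: out)
  | (⟨n, .join i j t⟩ :: st, out) => (⟨n, t⟩ :: st, (2, i, j) :: out)
  | (⟨n, .relabel i j t⟩ :: st, out) => (⟨n, t⟩ :: st, (3, i, j) :: out)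

/-- The program for one step of the linearization. The tags `0`, `1`, `2` and `3` have the codes
`[]`, `[1]`, `[0, 1]` and `[1, 1]`, and are told apart by the first digit and by the remainder. -/
def linProg : Program :=
  let stack : Expr := .hd (.hd .st)
  let out : Expr := .tl (.hd .st)
  let T : Expr := .hd stack
  let tag : Expr := .hd T
  let a : Expr := .hd (.tl T)
  let b : Expr := .hd (.tl (.tl T))
  let c : Expr := .hd (.tl (.tl (.tl T)))
  let put (s i : Expr) : Program := .assign 0 (.cons (.cons s (.cons i out)) (.tl .st))
  .ite tag
    (.ite (.hd tag)
      (.ite (.tl tag) (put (.cons c (.tl stack)) (.cons tag (.cons a b)))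
        (put (.cons a (.cons b (.tl stack))) (.cons tag (.cons .nil .nil))))
      (put (.cons c (.tl stack)) (.cons tag (.cons a b))))
    (put (.tl stack) (.cons tag (.cons a b)))

theorem runs_linProg (x : List SDecomp × List Instr) (hx : x.1 ≠ []) :
    Runs linProg (enc x) (enc (linStep x)) 200 := by
  intro σ r
  have e0 : encNat 0 = .nil := enc_zero
  have e1 : encNat 1 = _ := enc_one
  have e2 : encNat 2 = _ := enc_two
  have e3 : encNat 3 = _ := enc_three
  obtain ⟨_ | ⟨⟨n, T⟩, st⟩, out⟩ := x
  · simp at hx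
  cases T with
  | vertex l v =>
    refine ⟨_, ?_, .ite_false ?_ (steps_assign_top ?_)⟩
    · simp [Expr.cost]
    all_goals simp [Expr.eval, Data.hd, Data.tl, linStep, enc, encDecomp, encList, e0]
  | union s t =>
    refine ⟨_, ?_, .ite_true ?_ (.ite_true ?_ (.ite_false ?_ (steps_assign_top ?_)))⟩
    · simp [Expr.cost]
    all_goals simp [Expr.eval, Data.hd, Data.tl, linStep, enc, encDecomp, encList, e0, e1, encBool]
  | join i j t =>
    refine ⟨_, ?_, .ite_true ?_ (.ite_false ?_ (steps_assign_top ?_))⟩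
    · simp [Expr.cost]
    all_goals simp [Expr.eval, Data.hd, Data.tl, linStep, enc, encDecomp, encList, e2, encBool]
  | relabel i j t =>
    refine ⟨_, ?_, .ite_true ?_ (.ite_true ?_ (.ite_true ?_ (steps_assign_top ?_)))⟩
    · simp [Expr.cost]
    all_goals simp [Expr.eval, Data.hd, Data.tl, linStep, enc, encDecomp, encList, e3, encBool]

/-- The linearization keeps a stack of the expressions that are still to be processed and takes one
step for each node. -/
@[fun_prop] theorem Poly.lin {α : Type} [Enc α] {f : α → SDecomp} (hf : Poly f) :
    Poly fun a => lin (f a).2 := by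
  suffices h : Poly fun T : SDecomp => MaxCutCW.lin T.2 from h.comp hf
  have hloop : CT (fun x : List SDecomp × List Instr =>
      (([] : List SDecomp), x.1.foldl (fun out T => MaxCutCW.lin T.2 ++ out) x.2))
      (fun x => 300 * (x.1.map fun T => (MaxCutCW.lin T.2).length).sum + 10) := by
    refine CT.loop (.hd (.hd .st)) (fun x => x.1 ≠ []) linStep (fun _ => 200) linProg ?_
      runs_linProg ?_ ?_ ?_ ?_
    · rintro ⟨_ | ⟨T, st⟩, out⟩ σ r <;> simp [Expr.eval, Data.hd]
    · rintro ⟨_ | ⟨⟨n, T⟩, st⟩, out⟩ hx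
      · simp at hx
      · cases T <;> simp [linStep, MaxCutCW.lin]
    · rintro ⟨_ | ⟨⟨n, T⟩, st⟩, out⟩ hx
      · simp
      · simp at hx
    · rintro ⟨_ | ⟨⟨n, T⟩, st⟩, out⟩ hx
      · simp at hx
      · cases T <;> simp [linStep, MaxCutCW.lin, Expr.cost] <;> omega
    · intro x _
      simp [Expr.cost]
  obtain ⟨k, hk⟩ : ConstTime fun T : SDecomp => ([T], ([] : List Instr)) := by
    have : ConstTime fun T : SDecomp => ([] : List SDecomp) := .const _
    have : ConstTime fun T : SDecomp => ([] : List Instr) := .const _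
    fun_prop
  refine .mk' (.C (k + 100) + 300 * .X) .X
    (((CT.snd.comp (hloop.comp hk)).congr fun T => by simp).mono fun T => ?_) fun T => ?_
  · have h1 := length_lt_sz (MaxCutCW.lin T.2)
    have h2 : sz (MaxCutCW.lin T.2) ≤ sz T := sz_lin_le T.2
    simp
    omega
  · rw [Polynomial.eval_X]
    exact sz_lin_le T.2

/-! ### The stack machine -/

/-- The state of the stack machine: the stacks of the labelled vertex sets and of the tables. -/
abbrev MState : Type := List (List (ℕ × ℕ)) × List (List (List ℕ))

/-- The effect of a relabelling on a label. -/
def relabelNat (i j l : ℕ) : ℕ := if l = i then j else l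

/-- The argument of a union that is on top of the stacks. -/
def MState.arg (g : Glob) (st : MState) : UnionArg :=
  ((g, (st.1.headD [], st.1.tail.headD [])), (st.2.headD [], st.2.tail.headD []))

/-- One step of the stack machine. -/
def machineStep (α δ : ℕ) (g : Glob) (st : MState) (i : Instr) : MState :=
  if decide (i.1 = 0) then ([(i.2.2, i.2.1)] :: st.1, [[], [i.2.2]] :: st.2)
  else if decide (i.1 = 1) then
    ((st.1.headD [] ++ st.1.tail.headD []) :: st.1.tail.tail,
      (st.arg g).table α δ :: st.2.tail.tail)
  else if decide (i.1 = 3) then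
    ((st.1.headD []).map (fun p => (p.1, relabelNat i.2.1 i.2.2 p.2)) :: st.1.tail, st.2)
  else st

/-- The argument of a step of the stack machine. -/
abbrev StepArg : Type := Glob × (MState × Instr)

/-- The running time of a step. The stacks can be arbitrarily large; only a union depends on the
tables, a relabelling depends on the labels on top of the stack, and all other steps depend on the
instruction only. -/
theorem ct_machineStep (α δ : ℕ) : ∃ (t : StepArg → ℕ) (P : Polynomial ℕ),
    CT (fun x : StepArg => machineStep α δ x.1 x.2.1 x.2.2) t ∧
    ∀ x : StepArg,
      (x.2.2.1 = 1 → t x ≤ (x.2.1.arg x.1).weight * P.eval ((x.2.1.arg x.1).size + sz x.2.2)) ∧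
      (x.2.2.1 = 3 → t x ≤ P.eval (sz x.2.2 + sz (x.2.1.1.headD []))) ∧
      (x.2.2.1 ≠ 1 → x.2.2.1 ≠ 3 → t x ≤ P.eval (sz x.2.2)) := by
  have htag : ∀ k : ℕ, PT (fun x : StepArg => sz x.2.2) fun x => decide (x.2.2.1 = k) := fun k =>
    PT.comp_poly (f := fun x : StepArg => x.2.2) (g := fun i => decide (i.1 = k)) (by fun_prop)
      (by fun_prop) (.of_le fun _ => le_rfl)
  obtain ⟨P0, h0⟩ := htag 0
  obtain ⟨P1, h1⟩ := htag 1
  obtain ⟨P3, h3⟩ := htag 3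
  obtain ⟨k0, f0⟩ : ConstTime fun x : StepArg =>
      ([(x.2.2.2.2, x.2.2.2.1)] :: x.2.1.1, [[], [x.2.2.2.2]] :: x.2.1.2) := by
    have : ConstTime fun T : StepArg => ([] : List (ℕ × ℕ)) := .const _
    have : ConstTime fun T : StepArg => ([] : List ℕ) := .const _
    have : ConstTime fun T : StepArg => ([] : List (List ℕ)) := .const _
    fun_prop
  obtain ⟨tt, ht, Pt, hPt⟩ := ct_table α δ
  obtain ⟨ka, ha⟩ : ConstTime fun x : StepArg => x.2.1.arg x.1 := by
    unfold MState.arg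
    fun_prop
  obtain ⟨kb, hb⟩ : ConstTime fun x : StepArg => x.2.1.1.tail.tail := by fun_prop
  obtain ⟨kc, hc⟩ : ConstTime fun x : StepArg => x.2.1.2.tail.tail := by fun_prop
  obtain ⟨Pl, hl⟩ : PT (fun x : StepArg => (x.2.1.arg x.1).size)
      fun x => x.2.1.1.headD [] ++ x.2.1.1.tail.headD [] :=
    PT.comp_poly (f := fun x : StepArg => (x.2.1.1.headD [], x.2.1.1.tail.headD []))
      (g := fun y => y.1 ++ y.2) (by fun_prop) (by fun_prop) (.of_le fun x => by
        simp only [MState.arg, UnionArg.size, sz_pair]; omega)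
  obtain ⟨Pr, hr⟩ : PT (fun x : StepArg => sz x.2.2 + sz (x.2.1.1.headD []))
      fun x => (x.2.1.1.headD []).map (fun p => (p.1, relabelNat x.2.2.2.1 x.2.2.2.2 p.2)) := by
    refine PT.comp_poly (f := fun x : StepArg => (x.2.2, x.2.1.1.headD []))
      (g := fun y => y.2.map (fun p => (p.1, relabelNat y.1.2.1 y.1.2.2 p.2))) ?_ (by fun_prop)
      (.of_le fun x => le_rfl)
    unfold relabelNat
    fun_prop
  obtain ⟨kd, hd⟩ : ConstTime fun x : StepArg => x.2.1.1.tail := by fun_prop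
  obtain ⟨ke, he⟩ : ConstTime fun x : StepArg => x.2.1.2 := by fun_prop
  obtain ⟨kf, hf⟩ : ConstTime fun x : StepArg => x.2.1 := by fun_prop
  have f1 := (CT.cons.comp (hl.pair hb)).pair (CT.cons.comp ((ht.comp ha).pair hc))
  have f3 := (CT.cons.comp (hr.pair hd)).pair he
  refine ⟨_, P0 + P1 + P3 + Pt + Pl + Pr + .C (k0 + ka + kb + kc + kd + ke + kf + 1000),
    CT.ite' h0 f0 (CT.ite' h1 f1 (CT.ite' h3 f3 hf)), fun x => ⟨fun h => ?_, fun h => ?_, ?_⟩⟩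
  · have e0 := eval_mono P0 (show sz x.2.2 ≤ (x.2.1.arg x.1).size + sz x.2.2 by omega)
    have e1 := eval_mono P1 (show sz x.2.2 ≤ (x.2.1.arg x.1).size + sz x.2.2 by omega)
    have el := eval_mono Pl
      (show (x.2.1.arg x.1).size ≤ (x.2.1.arg x.1).size + sz x.2.2 by omega)
    have et := (hPt (x.2.1.arg x.1)).trans (Nat.mul_le_mul_left _ (eval_mono Pt
      (show (x.2.1.arg x.1).size ≤ (x.2.1.arg x.1).size + sz x.2.2 by omega)))
    have hw := (x.2.1.arg x.1).one_le_weight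
    simp [h]
    generalize (x.2.1.arg x.1).weight = w at *
    nlinarith
  · have e0 := eval_mono P0 (show sz x.2.2 ≤ sz x.2.2 + sz (x.2.1.1.headD []) by omega)
    have e1 := eval_mono P1 (show sz x.2.2 ≤ sz x.2.2 + sz (x.2.1.1.headD []) by omega)
    have e3 := eval_mono P3 (show sz x.2.2 ≤ sz x.2.2 + sz (x.2.1.1.headD []) by omega)
    simp [h] at e0 e1 e3 ⊢
    omega
  · intro g1 g3
    simp [g1, g3]
    split <;> omega

end MaxCutCW

/-! ### The tables of a decomposition -/

namespace MaxCutCW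

open Enc (enc)

/-- The vertices of an expression with their labels. -/
def nodeLab {n : ℕ} : Decomp (Fin n) → List (ℕ × ℕ)
  | .vertex l v => [(v, l)]
  | .union s t => nodeLab s ++ nodeLab t
  | .join _ _ t => nodeLab t
  | .relabel i j t => (nodeLab t).map fun p => (p.1, relabelNat i j p.2)

/-- The table that the algorithm computes for an expression. -/
def nodeTable {n : ℕ} (α δ : ℕ) (g : Glob) : Decomp (Fin n) → List (List ℕ)
  | .vertex _ v => [[], [(v : ℕ)]]
  | .union s t => unionTable α δ g.1 g.2.1 g.2.2.1 g.2.2.2 (nodeLab s) (nodeLab t)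
      (nodeTable α δ g s) (nodeTable α δ g t)
  | .join _ _ t => nodeTable α δ g t
  | .relabel _ _ t => nodeTable α δ g t

/-- On the linearization of an expression the stack machine pushes its labelled vertices and its
table. -/
theorem foldl_machineStep {n : ℕ} (α δ : ℕ) (g : Glob) (T : Decomp (Fin n)) (st : MState) :
    (lin T).foldl (machineStep α δ g) st = (nodeLab T :: st.1, nodeTable α δ g T :: st.2) := by
  induction T generalizing st with
  | vertex l v => rfl
  | union s t ihs iht => simp only [lin, List.foldl_append, ihs, iht]; rfl
  | join i j t ih => simp only [lin, List.foldl_append, ih]; rfl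
  | relabel i j t ih => simp only [lin, List.foldl_append, ih]; rfl

/-- All sets in the table of an expression consist of vertices of the expression. -/
theorem sublist_of_mem_nodeTable {n : ℕ} {α δ : ℕ} {g : Glob} {T : Decomp (Fin n)} {W : List ℕ}
    (h : W ∈ nodeTable α δ g T) : W.Sublist ((nodeLab T).map Prod.fst) := by
  induction T generalizing W with
  | vertex l v =>
    simp only [nodeTable, List.mem_cons, List.not_mem_nil, or_false] at h
    rcases h with rfl | rfl <;> simp [nodeLab]
  | union s t ihs iht =>
    simp only [nodeTable, unionTable, lookupBoth, List.mem_flatMap, List.mem_map] at h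
    obtain ⟨L, -, X, -, A, hA, B, hB, rfl⟩ := h
    simpa [nodeLab] using (ihs (mem_of_mem_get_buildTrie hA).1).append
      (iht (mem_of_mem_get_buildTrie hB).1)
  | join i j t ih => exact ih h
  | relabel i j t ih =>
    have : (nodeLab (.relabel i j t)).map Prod.fst = (nodeLab t).map Prod.fst := by
      simp [nodeLab, Function.comp_def]
    rw [this]
    exact ih h

theorem length_nodeLab_le {n : ℕ} (T : Decomp (Fin n)) :
    (nodeLab T).length ≤ (lin T).length := by
  induction T with
  | vertex l v => simp [nodeLab, lin]
  | union s t ihs iht => simp [nodeLab, lin]; omega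
  | join i j t ih => simp [nodeLab, lin]; omega
  | relabel i j t ih => simp [nodeLab, lin]; omega

theorem sz_of_mem_nodeLab {n : ℕ} {T : Decomp (Fin n)} {p : ℕ × ℕ} (h : p ∈ nodeLab T) :
    sz p.1 ≤ sz (lin T) ∧ sz p.2 ≤ sz (lin T) := by
  induction T generalizing p with
  | vertex l v =>
    simp only [nodeLab, List.mem_singleton] at h
    subst h
    simp only [lin, sz_cons, sz_pair]
    omega
  | union s t ihs iht =>
    have h1 := sz_append (lin t) (lin s ++ [(1, 0, 0)])
    have h2 := sz_append (lin s) [(1, 0, 0)]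
    have h3 := sz_pos (lin s)
    have h4 := sz_pos (lin t)
    have h5 := length_lt_sz [((1, 0, 0) : Instr)]
    simp only [List.length_singleton] at h5
    rcases List.mem_append.1 h with h | h
    · have := ihs h; simp only [lin]; omega
    · have := iht h; simp only [lin]; omega
  | join i j t ih =>
    have h1 := sz_append (lin t) [(2, i, j)]
    have h5 := length_lt_sz [((2, i, j) : Instr)]
    simp only [List.length_singleton] at h5
    have := ih h
    simp only [lin]; omega
  | relabel i j t ih =>
    obtain ⟨q, hq, rfl⟩ := List.mem_map.1 h
    have h1 := sz_append (lin t) [(3, i, j)]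
    have := ih hq
    simp only [lin, relabelNat, sz_cons, sz_pair, sz_nil] at h1 ⊢
    split <;> omega

theorem sz_nodeLab_le {n : ℕ} (T : Decomp (Fin n)) :
    sz (nodeLab T) ≤ 2 * sz (lin T) * sz (lin T) + 1 := by
  refine (sz_le_of_forall (K := 2 * sz (lin T)) fun p hp => ?_).trans ?_
  · have := sz_of_mem_nodeLab hp
    have e : sz p = sz p.1 + sz p.2 := rfl
    omega
  · have h1 := (length_nodeLab_le T).trans (length_lt_sz (lin T)).le
    have := Nat.mul_le_mul_right (2 * sz (lin T)) h1
    nlinarith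

theorem sz_map_fst_le (l : List (ℕ × ℕ)) : sz (l.map Prod.fst) ≤ sz l := by
  induction l with
  | nil => simp
  | cons p l ih => have := sz_fst_le p; simp only [List.map_cons, sz_cons]; omega

theorem maxSize_nodeTable_le {n : ℕ} (α δ : ℕ) (g : Glob) (T : Decomp (Fin n)) :
    maxSize (nodeTable α δ g T) ≤ sz (nodeLab T) :=
  maxSize_le fun _ hW => (sz_le_of_sublist (sublist_of_mem_nodeTable hW)).trans (sz_map_fst_le _)

theorem sz_lin_union {n : ℕ} (s t : Decomp (Fin n)) :
    sz (lin s) ≤ sz (lin (.union s t)) ∧ sz (lin t) ≤ sz (lin (.union s t)) := by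
  constructor
  · exact sz_le_of_sublist ((List.sublist_append_left _ _).trans (List.sublist_append_right _ _))
  · exact sz_le_of_sublist (List.sublist_append_left _ _)

theorem sz_lin_join {n : ℕ} (i j : ℕ) (t : Decomp (Fin n)) :
    sz (lin t) ≤ sz (lin (.join i j t)) := sz_le_of_sublist (List.sublist_append_left _ _)

theorem sz_lin_relabel {n : ℕ} (i j : ℕ) (t : Decomp (Fin n)) :
    sz (lin t) ≤ sz (lin (.relabel i j t)) := sz_le_of_sublist (List.sublist_append_left _ _)

/-- The tables have at most `2 ^ f` entries, up to a polynomial factor, where `f` bounds the number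
of bubbles. -/
theorem length_nodeTable_le (α δ : ℕ) : ∃ P : Polynomial ℕ, ∀ (n : ℕ) (g : Glob)
    (T : Decomp (Fin n)) (S : ℕ), sz g ≤ S → sz (lin T) ≤ S →
    (nodeTable α δ g T).length ≤ 2 ^ g.2.2.2.length * P.eval S := by
  obtain ⟨P, hP⟩ := length_table_le α δ
  refine ⟨P.comp (.X + 2 * (2 * .X * .X + 1)) + 2, fun n g T S hg hT => ?_⟩
  have h2 : 2 ≤ 2 ^ g.2.2.2.length * 2 := Nat.le_mul_of_pos_left _ (by positivity)
  induction T with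
  | vertex l v =>
    simp only [nodeTable, List.length_cons, List.length_nil, Polynomial.eval_add,
      Polynomial.eval_ofNat, Nat.mul_add]
    omega
  | union s t ihs iht =>
    have hs := (sz_lin_union s t).1.trans hT
    have ht := (sz_lin_union s t).2.trans hT
    refine (hP ((g, (nodeLab s, nodeLab t)), (nodeTable α δ g s, nodeTable α δ g t))).trans ?_
    refine Nat.mul_le_mul_left _ ?_
    have h1 : sz (g, (nodeLab s, nodeLab t)) ≤ S + 2 * (2 * S * S + 1) := by
      have h3 := sz_nodeLab_le s
      have h4 := sz_nodeLab_le t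
      have h5 : 2 * sz (lin s) * sz (lin s) ≤ 2 * S * S := by gcongr
      have h6 : 2 * sz (lin t) * sz (lin t) ≤ 2 * S * S := by gcongr
      simp only [sz_pair]
      omega
    have := eval_mono P h1
    simp [Polynomial.eval_comp] at this ⊢
    omega
  | join i j t ih => exact ih ((sz_lin_join i j t).trans hT)
  | relabel i j t ih => exact ih ((sz_lin_relabel i j t).trans hT)

/-- The running time of the stack machine. -/
theorem ct_machine (α δ : ℕ) : ∃ (t : Glob × (MState × List Instr) → ℕ) (P : Polynomial ℕ),
    CT (fun x : Glob × (MState × List Instr) => x.2.2.foldl (machineStep α δ x.1) x.2.1) t ∧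
    ∀ (n : ℕ) (g : Glob) (T : Decomp (Fin n)), t (g, (([], []), lin T)) ≤
      2 ^ g.2.2.2.length * P.eval (sz g + sz (lin T)) := by
  obtain ⟨ts, P, hts, hP⟩ := ct_machineStep α δ
  obtain ⟨Q, hQ⟩ := length_nodeTable_le α δ
  refine ⟨_, .X * (100 + (2 * Q + 1) * P.comp (.X + 4 * (2 * .X * .X + 1) + .X)) + 120,
    CT.foldl hts, fun n g T => ?_⟩
  set S := sz g + sz (lin T) with hS
  set F := 2 ^ g.2.2.2.length with hF
  set B := 100 + F * (2 * Q.eval S + 1) * P.eval (S + 4 * (2 * S * S + 1) + S) with hB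
  have hF1 : 1 ≤ F := Nat.one_le_two_pow
  have key : ∀ (T : Decomp (Fin n)), sz (lin T) ≤ S → ∀ (st : MState) (rest : List Instr),
      foldTime (machineStep α δ g) (fun b c => ts (g, b, c)) 100 st (lin T ++ rest) ≤
        (lin T).length * B + foldTime (machineStep α δ g) (fun b c => ts (g, b, c)) 100
          (nodeLab T :: st.1, nodeTable α δ g T :: st.2) rest := by
    have hmul : ∀ m, m ≤ S + 4 * (2 * S * S + 1) + S → 100 + P.eval m ≤ B := by
      intro m hm
      have h1 := eval_mono P hm
      have h2 : 1 * P.eval (S + 4 * (2 * S * S + 1) + S) ≤ F * (2 * Q.eval S + 1) *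
        P.eval (S + 4 * (2 * S * S + 1) + S) := Nat.mul_le_mul_right _ (Nat.mul_pos hF1 (by omega))
      omega
    have hlab : ∀ T : Decomp (Fin n), sz (lin T) ≤ S → sz (nodeLab T) ≤ 2 * S * S + 1 := by
      intro T hT
      refine (sz_nodeLab_le T).trans ?_
      gcongr
    intro T hT
    induction T with
    | vertex l v =>
      intro st rest
      have h1 := (hP (g, st, (0, l, v))).2.2 (by simp) (by simp)
      have h2 : sz ((0, l, v) : Instr) ≤ S :=
        (sz_mem_lt (l := lin (.vertex l v)) (by simp [lin])).le.trans hT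
      have h3 := hmul _ (h2.trans (by omega))
      simp only [lin, List.singleton_append, foldTime, List.length_singleton, one_mul]
      have e : machineStep α δ g st (0, l, v) =
        (nodeLab (.vertex l v) :: st.1, nodeTable α δ g (.vertex l v) :: st.2) := rfl
      rw [e]
      simp only at h1
      omega
    | union s t ihs iht =>
      intro st rest
      have hs := (sz_lin_union s t).1.trans hT
      have ht := (sz_lin_union s t).2.trans hT
      have h1 := iht ht st (lin s ++ ((1, 0, 0) :: rest))
      have h2 := ihs hs (nodeLab t :: st.1, nodeTable α δ g t :: st.2) ((1, 0, 0) :: rest)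
      set st' : MState := (nodeLab s :: nodeLab t :: st.1,
        nodeTable α δ g s :: nodeTable α δ g t :: st.2) with hst'
      have h3 := (hP (g, st', (1, 0, 0))).1 rfl
      have e : machineStep α δ g st' (1, 0, 0) =
        (nodeLab (.union s t) :: st.1, nodeTable α δ g (.union s t) :: st.2) := rfl
      have hi : sz ((1, 0, 0) : Instr) ≤ S :=
        (sz_mem_lt (l := lin (.union s t)) (by simp [lin])).le.trans hT
      have hw : (st'.arg g).weight ≤ F * (2 * Q.eval S + 1) := by
        have h4 := hQ n g s S (by omega) hs
        have h5 := hQ n g t S (by omega) ht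
        have h6 : (st'.arg g).weight = F + (nodeTable α δ g s).length +
          (nodeTable α δ g t).length := rfl
        rw [← hF] at h4 h5
        rw [h6]
        calc _ ≤ F + F * Q.eval S + F * Q.eval S := by omega
          _ = _ := by ring
      have hz : (st'.arg g).size + sz ((1, 0, 0) : Instr) ≤ S + 4 * (2 * S * S + 1) + S := by
        have h4 := hlab s hs
        have h5 := hlab t ht
        have h6 := maxSize_nodeTable_le α δ g s
        have h7 := maxSize_nodeTable_le α δ g t
        have h8 : (st'.arg g).size = sz g + (sz (nodeLab s) + sz (nodeLab t)) +
          maxSize (nodeTable α δ g s) + maxSize (nodeTable α δ g t) := rfl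
        omega
      have h9 : 100 + ts (g, st', (1, 0, 0)) ≤ B :=
        Nat.add_le_add_left (h3.trans (Nat.mul_le_mul hw (eval_mono P hz))) _
      simp only [lin, List.append_assoc, List.singleton_append, List.length_append,
        List.length_singleton, Nat.add_mul, one_mul]
      simp only [foldTime, e] at h2
      omega
    | join i j t ih =>
      intro st rest
      have ht := (sz_lin_join i j t).trans hT
      have h1 := ih ht st ((2, i, j) :: rest)
      set st' : MState := (nodeLab t :: st.1, nodeTable α δ g t :: st.2) with hst'
      have h3 := (hP (g, st', (2, i, j))).2.2 (by simp) (by simp)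
      have e : machineStep α δ g st' (2, i, j) =
        (nodeLab (.join i j t) :: st.1, nodeTable α δ g (.join i j t) :: st.2) := rfl
      have hi : sz ((2, i, j) : Instr) ≤ S :=
        (sz_mem_lt (l := lin (.join i j t)) (by simp [lin])).le.trans hT
      have h9 := hmul _ (hi.trans (by omega))
      simp only [lin, List.append_assoc, List.singleton_append, List.length_append,
        List.length_singleton, Nat.add_mul, one_mul]
      simp only [foldTime, e] at h1 h3
      omega
    | relabel i j t ih =>
      intro st rest
      have ht := (sz_lin_relabel i j t).trans hT
      have h1 := ih ht st ((3, i, j) :: rest)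
      set st' : MState := (nodeLab t :: st.1, nodeTable α δ g t :: st.2) with hst'
      have h3 := (hP (g, st', (3, i, j))).2.1 rfl
      have e : machineStep α δ g st' (3, i, j) =
        (nodeLab (.relabel i j t) :: st.1, nodeTable α δ g (.relabel i j t) :: st.2) := rfl
      have hi : sz ((3, i, j) : Instr) ≤ S :=
        (sz_mem_lt (l := lin (.relabel i j t)) (by simp [lin])).le.trans hT
      have h4 : sz ((st'.1.headD [])) ≤ 2 * S * S + 1 := hlab t ht
      have h9 := hmul (sz ((3, i, j) : Instr) + sz ((st'.1.headD []))) (by omega)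
      simp only [lin, List.append_assoc, List.singleton_append, List.length_append,
        List.length_singleton, Nat.add_mul, one_mul]
      simp only [foldTime, e] at h1 h3
      omega
  have h := key T (by omega) ([], []) []
  simp only [List.append_nil, foldTime] at h
  have h1 : (lin T).length ≤ S := (length_lt_sz _).le.trans (by omega)
  have h2 := Nat.mul_le_mul_right B h1
  refine (Nat.add_le_add_right h 20).trans ?_
  simp only [Polynomial.eval_add, Polynomial.eval_mul, Polynomial.eval_comp, Polynomial.eval_X,
    Polynomial.eval_ofNat, Polynomial.eval_one]
  set q := (2 * Q.eval S + 1) * P.eval (S + 4 * (2 * S * S + 1) + S) with hq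
  have h3 : B = 100 + F * q := by rw [hB, hq]; ring
  have h4 : 120 ≤ F * 120 := Nat.le_mul_of_pos_left _ hF1
  have h5 : S * 100 ≤ F * (S * 100) := Nat.le_mul_of_pos_left _ hF1
  rw [h3] at h h2
  calc _ ≤ S * (100 + F * q) + 120 := by rw [h3]; omega
    _ ≤ F * (S * 100) + F * (S * q) + F * 120 := by nlinarith
    _ = _ := by ring

end MaxCutCW

/-! ### The complete algorithm -/

namespace MaxCutCW

open Enc (enc)

/-- The edges, as ordered pairs, of the graph with a given adjacency matrix. -/
def edgeList (M : List (List Bool)) : List (ℕ × ℕ) :=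
  M.zipIdx.flatMap fun r => r.1.zipIdx.flatMap fun c => if c.1 then [(r.2, c.2)] else []

/-- The labels that occur in an instruction. -/
def instrLabels (i : Instr) : List ℕ :=
  if i.1 = 0 then [i.2.1] else if i.1 = 1 then [] else [i.2.1, i.2.2]

/-- The labels that are used by a list of instructions, without repetitions. -/
def usedLabels (p : List Instr) : List ℕ := (p.flatMap fun i => instrLabels i).dedup

/-- The data that the stack machine needs. The last list, of length `β * w` for `w` labels, serves
as the bound for the number of bubbles. -/
def mkGlob (β : ℕ) (M : List (List Bool)) (p : List Instr) : Glob :=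
  (M.zipIdx.map fun r => r.2, (edgeList M, (usedLabels p,
    (List.replicate β (usedLabels p)).flatMap fun l => l)))

theorem poly_mkGlob (β : ℕ) :
    Poly fun x : List (List Bool) × SDecomp => mkGlob β x.1 (lin x.2.2) := by
  have h1 : Poly fun x : List (List Bool) × SDecomp => edgeList x.1 := by
    unfold edgeList
    refine Poly.flatMap (by fun_prop) (Poly.flatMap (by fun_prop) ?_)
    exact Poly.cond (c := fun x : ((List (List Bool) × SDecomp) × (List Bool × ℕ)) × (Bool × ℕ) =>
      x.2.1) (by fun_prop) (by fun_prop) (by fun_prop)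
  have h2 : Poly fun x : List (List Bool) × SDecomp => usedLabels (lin x.2.2) := by
    unfold usedLabels instrLabels
    fun_prop
  unfold mkGlob
  fun_prop

/-- The algorithm. In addition to the cut, it yields the data with which its size is computed. -/
def solve (α β δ : ℕ) (x : List (List Bool) × SDecomp) :
    (List (ℕ × ℕ) × List (ℕ × ℕ)) × List ℕ :=
  ((edgeList x.1, nodeLab x.2.2),
    ((nodeTable α δ (mkGlob β x.1 (lin x.2.2)) x.2.2).foldl
      (better (edgeList x.1) (nodeLab x.2.2)) []).headD [])

/-- The best set in a table is found in time linear in the length of the table. -/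
theorem ct_best : ∃ P : Polynomial ℕ,
    CT (fun x : (List (ℕ × ℕ) × List (ℕ × ℕ)) × List (List ℕ) =>
      x.2.foldl (better x.1.1 x.1.2) [])
      (fun x => (x.2.length + 1) * P.eval (sz x.1 + maxSize x.2)) := by
  have hb : Poly fun y : (List (ℕ × ℕ) × List (ℕ × ℕ)) × (List (List ℕ) × List ℕ) =>
    better y.1.1 y.1.2 y.2.1 y.2.2 := by fun_prop
  obtain ⟨P, hP, -⟩ := hb
  obtain ⟨k, hk⟩ : ConstTime fun x : (List (ℕ × ℕ) × List (ℕ × ℕ)) × List (List ℕ) =>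
      (x.1, (([] : List (List ℕ)), x.2)) := by
    have : ConstTime fun x : (List (ℕ × ℕ) × List (ℕ × ℕ)) × List (List ℕ) =>
      ([] : List (List ℕ)) := .const _
    fun_prop
  have h := CT.foldl (s := fun (a : List (ℕ × ℕ) × List (ℕ × ℕ)) U W => better a.1 a.2 U W) hP
  refine ⟨.C (k + 200) + P.comp (2 * .X + 1), (h.comp hk).mono fun x => ?_⟩
  refine (Nat.add_le_add_left (Nat.add_le_add_right (foldTime_le
    (K := P.eval (2 * (sz x.1 + maxSize x.2) + 1))
    (fun t l => ∃ D, D ++ l = x.2 ∧ t = D.foldl (better x.1.1 x.1.2) []) ?_ ?_ _ _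
      ⟨[], rfl, rfl⟩) _) _).trans ?_
  · rintro t W l ⟨D, h2, rfl⟩
    exact ⟨D ++ [W], by simp [h2], by simp⟩
  · rintro t W l ⟨D, h2, rfl⟩
    apply eval_mono
    obtain ⟨g1, g2, -⟩ := foldl_better (E := x.1.1) (lab := x.1.2) D
    have h3 : sz W ≤ maxSize x.2 := sz_le_maxSize (by rw [← h2]; simp)
    have h4 := sz_le_of_forall (l := D.foldl (better x.1.1 x.1.2) []) (K := maxSize x.2)
      fun A hA => sz_le_maxSize (show A ∈ x.2 by rw [← h2]; simp [g2 A hA])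
    have h5 := Nat.mul_le_mul_right (maxSize x.2) g1
    simp only [sz_pair] at h4 ⊢
    have e : sz x.1 = sz x.1.1 + sz x.1.2 := rfl
    omega
  · simp [Polynomial.eval_comp]
    nlinarith

/-- The running time of the algorithm: its exponential factor is `2 ^ (β * w)`, where `w` is the
number of labels. -/
theorem ct_solve (α β δ : ℕ) : ∃ (t : List (List Bool) × SDecomp → ℕ) (P : Polynomial ℕ),
    CT (solve α β δ) t ∧
    ∀ x, t x ≤ 2 ^ (β * (usedLabels (lin x.2.2)).length) * P.eval (sz x) := by
  obtain ⟨tm, P, hm, hP⟩ := ct_machine α δ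
  obtain ⟨Q, hQ⟩ := ct_best
  obtain ⟨G, hG⟩ := (poly_mkGlob β).sz_pb
  obtain ⟨R, hR⟩ := length_nodeTable_le α δ
  have hpre : Poly fun x : List (List Bool) × SDecomp =>
      (mkGlob β x.1 (lin x.2.2), ((([], []) : MState), lin x.2.2)) := by
    have := poly_mkGlob β
    fun_prop
  obtain ⟨A, hA⟩ := hpre.pt
  obtain ⟨B, hB⟩ := (show Poly fun x : List (List Bool) × SDecomp => edgeList x.1 from
    (poly_mkGlob β).snd.fst).pt
  obtain ⟨k, hk⟩ : ConstTime fun y : List (ℕ × ℕ) × MState =>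
    ((y.1, y.2.1.headD []), y.2.2.headD []) := by fun_prop
  obtain ⟨k', hk'⟩ : ConstTime fun y : (List (ℕ × ℕ) × List (ℕ × ℕ)) × List (List ℕ) =>
    y.1 := by fun_prop
  obtain ⟨k'', hk''⟩ : ConstTime fun y : List (List ℕ) => y.headD [] := by fun_prop
  have h1 := hk.comp (hB.pair (hm.comp hA))
  have h2 := (hk'.pair (hk''.comp hQ)).comp h1
  refine ⟨_, B + (A + P.comp (G + .X)) + 40 + .C k + (.C k' + ((R.comp (G + .X) + 1) *
    Q.comp (G + 2 * (2 * .X * .X + 1)) + .C k'') + 40), h2.congr fun x => ?_, fun x => ?_⟩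
  · simp only [foldl_machineStep, List.headD_cons]
    rfl
  simp only [foldl_machineStep, List.headD_cons]
  have hfuel : (mkGlob β x.1 (lin x.2.2)).2.2.2.length =
      β * (usedLabels (lin x.2.2)).length := by
    simp [mkGlob]
  set F := 2 ^ (β * (usedLabels (lin x.2.2)).length) with hF
  have hF1 : 1 ≤ F := Nat.one_le_two_pow
  set S := sz x with hS
  have hlin : sz (lin x.2.2) ≤ S := (sz_lin_le _).trans (sz_snd_le x)
  have hg : sz (mkGlob β x.1 (lin x.2.2)) ≤ G.eval S := hG x
  have e1 := hP x.2.1 (mkGlob β x.1 (lin x.2.2)) x.2.2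
  rw [hfuel, ← hF] at e1
  have e2 := hR x.2.1 (mkGlob β x.1 (lin x.2.2)) x.2.2 (G.eval S + S) (by omega) (by omega)
  rw [hfuel, ← hF] at e2
  have e3 : sz (nodeLab x.2.2) ≤ 2 * S * S + 1 := (sz_nodeLab_le _).trans (by gcongr)
  have e4 := (maxSize_nodeTable_le α δ (mkGlob β x.1 (lin x.2.2)) x.2.2).trans e3
  have e5 : sz (edgeList x.1) ≤ G.eval S := by
    refine le_trans ?_ hg
    have := sz_fst_le (mkGlob β x.1 (lin x.2.2)).2
    have := sz_snd_le (mkGlob β x.1 (lin x.2.2))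
    have e : edgeList x.1 = (mkGlob β x.1 (lin x.2.2)).2.1 := rfl
    rw [e]
    omega
  replace e1 := e1.trans (Nat.mul_le_mul_left F (eval_mono P (show _ ≤ G.eval S + S by omega)))
  have e6 := eval_mono Q (show sz (edgeList x.1, nodeLab x.2.2) + maxSize (nodeTable α δ
    (mkGlob β x.1 (lin x.2.2)) x.2.2) ≤ G.eval S + 2 * (2 * S * S + 1) by
      simp only [sz_pair]; omega)
  have e7 : (nodeTable α δ (mkGlob β x.1 (lin x.2.2)) x.2.2).length + 1 ≤
      F * (R.eval (G.eval S + S) + 1) := by rw [Nat.mul_add]; omega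
  have e8 := Nat.mul_le_mul e7 e6
  simp only [Polynomial.eval_add, Polynomial.eval_mul, Polynomial.eval_comp, Polynomial.eval_X,
    Polynomial.eval_ofNat, Polynomial.eval_one, Polynomial.eval_C]
  set p := P.eval (G.eval S + S)
  set q := Q.eval (G.eval S + 2 * (2 * S * S + 1))
  set r := R.eval (G.eval S + S)
  have hc : ∀ m, m ≤ F * m := fun m => Nat.le_mul_of_pos_left _ hF1
  calc _ ≤ B.eval S + (A.eval S + F * p) + 40 + k + (k' + (F * (r + 1) * q + k'') + 40) := by
        gcongr
    _ ≤ F * B.eval S + (F * A.eval S + F * p) + F * 40 + F * k +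
        (F * k' + (F * (r + 1) * q + F * k'') + F * 40) := by
        gcongr <;> exact hc _
    _ = _ := by ring

theorem sz_solve (α β δ : ℕ) : ∃ P : Polynomial ℕ, ∀ x, sz (solve α β δ x) ≤ P.eval (sz x) := by
  obtain ⟨G, hG⟩ := (show Poly fun x : List (List Bool) × SDecomp => edgeList x.1 from
    (poly_mkGlob β).snd.fst).sz_pb
  refine ⟨G + 2 * (2 * .X * .X + 1), fun x => ?_⟩
  have h1 : sz (nodeLab x.2.2) ≤ 2 * sz x * sz x + 1 := by
    have : sz (lin x.2.2) ≤ sz x := (sz_lin_le _).trans (sz_snd_le x)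
    exact (sz_nodeLab_le _).trans (by gcongr)
  have h2 : sz (solve α β δ x).2 ≤ sz (nodeLab x.2.2) := by
    obtain ⟨-, h3, -⟩ := foldl_better (E := edgeList x.1) (lab := nodeLab x.2.2)
      (nodeTable α δ (mkGlob β x.1 (lin x.2.2)) x.2.2)
    unfold solve
    generalize (nodeTable α δ (mkGlob β x.1 (lin x.2.2)) x.2.2).foldl
      (better (edgeList x.1) (nodeLab x.2.2)) [] = U at h3 ⊢
    cases U with
    | nil => exact sz_pos _
    | cons A U =>
      exact (sz_le_of_sublist (sublist_of_mem_nodeTable (h3 A (by simp)))).trans (sz_map_fst_le _)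
  have h4 : sz (edgeList x.1) ≤ G.eval (sz x) := hG x
  have e : sz (solve α β δ x) = sz (edgeList x.1) + sz (nodeLab x.2.2) +
    sz (solve α β δ x).2 := rfl
  simp
  omega

/-- The comparison of the size of the computed cut with a number, by a search for the number among
the positions in a list that is longer by one than the list of cut edges. -/
def reaches (x : ((List (ℕ × ℕ) × List (ℕ × ℕ)) × List ℕ) × ℕ) : Bool :=
  ((0, 0) :: cutPairs x.1.1.1 x.1.1.2 x.1.2).zipIdx.any fun p => decide (p.2 = x.2)

theorem reaches_iff (x) : reaches x = true ↔ x.2 ≤ cutCount x.1.1.1 x.1.1.2 x.1.2 := by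
  simp only [reaches, List.any_eq_true, decide_eq_true_eq, cutCount]
  constructor
  · rintro ⟨⟨a, i⟩, h, rfl⟩
    have := (List.mem_zipIdx h).2.1
    simp at this ⊢
    omega
  · intro h
    refine ⟨(((0, 0) :: cutPairs x.1.1.1 x.1.1.2 x.1.2)[x.2]'(by simp; omega), x.2), ?_, rfl⟩
    rw [List.mem_zipIdx_iff_getElem?]
    simp

theorem poly_reaches : Poly reaches := by
  unfold reaches
  fun_prop

/-! ### Programs for the whole problem -/

/-- From programs on a stack to programs that have the argument as their only input. -/
theorem CT.outputs {α β : Type} [Enc α] [Enc β] {f : α → β} {t : α → ℕ} (h : CT f t) :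
    ∃ p : Program, ∀ a, ∃ n ≤ t a + 20, p.Outputs (enc a) (enc (f a)) n := by
  obtain ⟨p, hp⟩ := h
  refine ⟨.seq (.assign 0 (.cons .st .nil)) (.seq p (.assign 0 (.hd .st))), fun a => ?_⟩
  set σ : Store := Function.update (fun _ => .nil) 0 (enc a)
  obtain ⟨m, hm, hs⟩ := hp a σ .nil
  have h1 := Steps.assign 0 (.cons .st .nil) σ
  have e1 : (Expr.cons .st .nil).eval σ = .node () (enc a) .nil := by simp [Expr.eval, σ]
  rw [e1] at h1
  have h2 := Steps.assign 0 (.hd .st) (top σ (enc (f a)) .nil)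
  refine ⟨_, ?_, _, h1.seq (hs.seq h2), ?_⟩
  · simp [Expr.cost]; omega
  · simp [Expr.eval, Data.hd]

/-- A polynomial is bounded by a constant multiple of a power, on positive numbers. -/
theorem eval_le_pow (P : Polynomial ℕ) {s : ℕ} (hs : 0 < s) :
    P.eval s ≤ P.eval 1 * s ^ P.natDegree := by
  rw [Polynomial.eval_eq_sum_range, Polynomial.eval_eq_sum_range, Finset.sum_mul]
  refine Finset.sum_le_sum fun i hi => ?_
  rw [one_pow, mul_one]
  exact Nat.mul_le_mul_left _ (Nat.pow_le_pow_right hs (by simp at hi; omega))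

end MaxCutCW

/-! ### Counts per label and sizes of cuts -/

namespace MaxCutCW

/-- Membership in a list as a Boolean predicate. -/
def isMem (X : List ℕ) (x : ℕ) : Bool := decide (x ∈ X)

theorem labelCount_eq_zero {lab : List (ℕ × ℕ)} {P : ℕ → Bool} {l : ℕ}
    (h : ∀ p ∈ lab, p.2 ≠ l) : labelCount lab P l = 0 := by
  rw [labelCount, List.length_eq_zero_iff, List.filter_eq_nil_iff]
  intro p hp
  simp [h p hp]

theorem key_eq_iff' {lab : List (ℕ × ℕ)} {X Y : List ℕ} :
    key lab X = key lab Y ↔ ∀ l, labelCount lab (isMem X) l = labelCount lab (isMem Y) l := by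
  rw [key_eq_iff]
  refine ⟨fun h l => ?_, fun h p _ => h p.2⟩
  by_cases hl : ∃ p ∈ lab, p.2 = l
  · obtain ⟨p, hp, rfl⟩ := hl
    exact h p hp
  · push Not at hl
    rw [labelCount_eq_zero hl, labelCount_eq_zero hl]

theorem labelCount_append (lab lab' : List (ℕ × ℕ)) (P : ℕ → Bool) (l : ℕ) :
    labelCount (lab ++ lab') P l = labelCount lab P l + labelCount lab' P l := by
  simp [labelCount]

theorem labelCount_congr {lab : List (ℕ × ℕ)} {P Q : ℕ → Bool} (h : ∀ p ∈ lab, P p.1 = Q p.1)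
    (l : ℕ) : labelCount lab P l = labelCount lab Q l := by
  unfold labelCount
  congr 1
  exact List.filter_congr fun p hp => by rw [h p hp]

theorem labelCount_add_not (lab : List (ℕ × ℕ)) (P : ℕ → Bool) (l : ℕ) :
    labelCount lab P l + labelCount lab (fun x => !P x) l = labelCount lab (fun _ => true) l := by
  induction lab with
  | nil => rfl
  | cons p lab ih =>
    simp only [labelCount, List.filter_cons] at ih ⊢
    by_cases h : p.2 = l <;> cases hP : P p.1 <;> simp [h] at ih ⊢ <;> omega

/-- The multiset of the labels of the elements that satisfy `P`. -/
def prof (lab : List (ℕ × ℕ)) (P : ℕ → Bool) : Multiset ℕ :=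
  ((lab.filter fun q => P q.1).map Prod.snd : List ℕ)

theorem count_prof (lab : List (ℕ × ℕ)) (P : ℕ → Bool) (l : ℕ) :
    (prof lab P).count l = labelCount lab P l := by
  rw [prof, Multiset.coe_count, List.count, List.countP_map, List.countP_filter,
    List.countP_eq_length_filter, labelCount]
  congr 1

theorem prof_eq {lab : List (ℕ × ℕ)} {P Q : ℕ → Bool}
    (h : ∀ l, labelCount lab P l = labelCount lab Q l) : prof lab P = prof lab Q := by
  ext l
  rw [count_prof, count_prof, h]

/-- The counts after a relabelling are determined by the counts before it. -/
theorem labelCount_relabel (lab : List (ℕ × ℕ)) (ρ : ℕ → ℕ) {P Q : ℕ → Bool}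
    (h : ∀ l, labelCount lab P l = labelCount lab Q l) (l : ℕ) :
    labelCount (lab.map fun p => (p.1, ρ p.2)) P l =
      labelCount (lab.map fun p => (p.1, ρ p.2)) Q l := by
  have e : ∀ P : ℕ → Bool, prof (lab.map fun p => (p.1, ρ p.2)) P = (prof lab P).map ρ := by
    intro P
    simp [prof, List.filter_map, Function.comp_def]
  rw [← count_prof, ← count_prof, e, e, prof_eq h]

/-- The number of pairs in `E` from an element of the first set that satisfies `P` to an element of
the second set that does not satisfy `Q`. -/
def cross (E : List (ℕ × ℕ)) (lab lab' : List (ℕ × ℕ)) (P Q : ℕ → Bool) : ℕ :=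
  (lab.flatMap fun p => lab'.filter fun q =>
    P p.1 && (!Q q.1 && decide ((p.1, q.1) ∈ E))).length

theorem cutCount_eq_cross (E lab : List (ℕ × ℕ)) (X : List ℕ) :
    cutCount E lab X = cross E lab lab (isMem X) (isMem X) := rfl

theorem cross_append_left (E l₁ l₂ lab' : List (ℕ × ℕ)) (P Q : ℕ → Bool) :
    cross E (l₁ ++ l₂) lab' P Q = cross E l₁ lab' P Q + cross E l₂ lab' P Q := by
  simp [cross]

theorem cross_append_right (E lab l₁ l₂ : List (ℕ × ℕ)) (P Q : ℕ → Bool) :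
    cross E lab (l₁ ++ l₂) P Q = cross E lab l₁ P Q + cross E lab l₂ P Q := by
  simp only [cross, List.length_flatMap, List.filter_append, List.length_append]
  exact List.sum_map_add

theorem cross_congr {E lab lab' : List (ℕ × ℕ)} {P P' Q Q' : ℕ → Bool}
    (hP : ∀ p ∈ lab, P p.1 = P' p.1) (hQ : ∀ q ∈ lab', Q q.1 = Q' q.1) :
    cross E lab lab' P Q = cross E lab lab' P' Q' := by
  unfold cross
  congr 1
  refine List.flatMap_congr fun p hp => List.filter_congr fun q hq => ?_
  rw [hP p hp, hQ q hq]

theorem cross_relabel (E lab lab' : List (ℕ × ℕ)) (ρ : ℕ → ℕ) (P Q : ℕ → Bool) :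
    cross E (lab.map fun p => (p.1, ρ p.2)) (lab'.map fun p => (p.1, ρ p.2)) P Q =
      cross E lab lab' P Q := by
  simp [cross, List.length_flatMap, List.filter_map, Function.comp_def]

/-- If adjacency between two labelled sets depends on the labels only, then so does the number of
cut edges between them. -/
theorem cross_eq_sum {E lab lab' : List (ℕ × ℕ)} {R : ℕ → ℕ → Bool}
    (hR : ∀ p ∈ lab, ∀ q ∈ lab', decide ((p.1, q.1) ∈ E) = R p.2 q.2) (P Q : ℕ → Bool) :
    cross E lab lab' P Q =
      ((prof lab P).map fun l => (prof lab' fun x => !Q x).countP fun l' => R l l' = true).sum := by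
  have h1 : ∀ l, (prof lab' fun x => !Q x).countP (fun l' => R l l' = true) =
      (lab'.filter fun q => !Q q.1 && R l q.2).length := by
    intro l
    rw [prof, Multiset.coe_countP, List.countP_map, List.countP_filter,
      List.countP_eq_length_filter]
    congr 1
    exact List.filter_congr fun q _ => by cases Q q.1 <;> simp
  simp only [h1]
  have h2 : ∀ lab₁ : List (ℕ × ℕ), (∀ p ∈ lab₁, p ∈ lab) → cross E lab₁ lab' P Q =
      ((prof lab₁ P).map fun l => (lab'.filter fun q => !Q q.1 && R l q.2).length).sum := by
    intro lab₁ h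
    induction lab₁ with
    | nil => rfl
    | cons p lab₁ ih =>
      have h3 := ih fun p' hp' => h p' (by simp [hp'])
      have h4 : (lab'.filter fun q => !Q q.1 && decide ((p.1, q.1) ∈ E)) =
          lab'.filter fun q => !Q q.1 && R p.2 q.2 :=
        List.filter_congr fun q hq => by rw [hR p (h p (by simp)) q hq]
      simp only [cross, prof] at h3 ⊢
      cases hP : P p.1
      · simpa [hP] using h3
      · simp only [List.flatMap_cons, List.length_append, hP, Bool.true_and, h4, h3,
          List.filter_cons_of_pos, List.map_cons, ← Multiset.cons_coe, Multiset.map_cons,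
          Multiset.sum_cons]
  exact h2 lab fun _ h => h

/-- If adjacency between two labelled sets depends on the labels only, then the number of cut edges
between them depends only on the number of chosen elements with each label. -/
theorem cross_eq_of_counts {E lab lab' : List (ℕ × ℕ)} {R : ℕ → ℕ → Bool}
    (hR : ∀ p ∈ lab, ∀ q ∈ lab', decide ((p.1, q.1) ∈ E) = R p.2 q.2) {P P' Q Q' : ℕ → Bool}
    (hP : ∀ l, labelCount lab P l = labelCount lab P' l)
    (hQ : ∀ l, labelCount lab' Q l = labelCount lab' Q' l) :
    cross E lab lab' P Q = cross E lab lab' P' Q' := by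
  rw [cross_eq_sum hR, cross_eq_sum hR, prof_eq hP, prof_eq (P := fun x => !Q x)
    (Q := fun x => !Q' x) fun l => ?_]
  have h1 := labelCount_add_not lab' Q l
  have h2 := labelCount_add_not lab' Q' l
  have h3 := hQ l
  omega

/-- The set `W` may replace the set `S` in every cut: it has the same number of elements with each
label, and it cuts at least as many edges within the labelled set. -/
def Dominates (E lab : List (ℕ × ℕ)) (W : List ℕ) (S : ℕ → Bool) : Prop :=
  (∀ l, labelCount lab (isMem W) l = labelCount lab S l) ∧
    cross E lab lab S S ≤ cross E lab lab (isMem W) (isMem W)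

/-- Adjacency between two labelled sets depends on the labels only. -/
def LabelAdj (E lab lab' : List (ℕ × ℕ)) : Prop :=
  ∃ R : ℕ → ℕ → Bool, ∀ p ∈ lab, ∀ q ∈ lab', decide ((p.1, q.1) ∈ E) = R p.2 q.2

/-- Sets that dominate `S` in two disjoint labelled sets yield a set that dominates `S` in the
union. -/
theorem Dominates.append {E labS labT : List (ℕ × ℕ)} {A B : List ℕ} {S : ℕ → Bool}
    (hA : Dominates E labS A S) (hB : Dominates E labT B S)
    (hAS : ∀ x ∈ A, x ∈ labS.map Prod.fst) (hBT : ∀ x ∈ B, x ∈ labT.map Prod.fst)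
    (hd : (labS.map Prod.fst).Disjoint (labT.map Prod.fst))
    (h1 : LabelAdj E labS labT) (h2 : LabelAdj E labT labS) :
    Dominates E (labS ++ labT) (A ++ B) S := by
  have eS : ∀ p ∈ labS, isMem (A ++ B) p.1 = isMem A p.1 := by
    intro p hp
    have : p.1 ∉ B := fun h => hd (List.mem_map_of_mem hp) (hBT _ h)
    simp [isMem, this]
  have eT : ∀ p ∈ labT, isMem (A ++ B) p.1 = isMem B p.1 := by
    intro p hp
    have : p.1 ∉ A := fun h => hd (hAS _ h) (List.mem_map_of_mem hp)
    simp [isMem, this]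
  obtain ⟨R, hR⟩ := h1
  obtain ⟨R', hR'⟩ := h2
  refine ⟨fun l => ?_, ?_⟩
  · rw [labelCount_append, labelCount_append, labelCount_congr eS, labelCount_congr eT, hA.1, hB.1]
  · simp only [cross_append_left, cross_append_right]
    rw [cross_congr eS eS, cross_congr eS eT, cross_congr eT eS, cross_congr eT eT,
      cross_eq_of_counts hR hA.1 hB.1, cross_eq_of_counts hR' hB.1 hA.1]
    have := hA.2
    have := hB.2
    omega

/-- What the algorithm needs at a union: adjacency between both sides is determined by the labels,
and some choice that it tries has the right number of elements with each label on both sides. -/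
def UnionGood (α δ : ℕ) (g : Glob) (S : ℕ → Bool) (labS labT : List (ℕ × ℕ)) : Prop :=
  (labS.map Prod.fst).Disjoint (labT.map Prod.fst) ∧ LabelAdj g.2.1 labS labT ∧
  LabelAdj g.2.1 labT labS ∧ ∃ L ∈ labelSets δ g.2.2.1,
    ∃ X ∈ choiceProd (guardedChoices α δ g.1 g.2.1 g.2.2.2 labS labT L),
      (∀ l, labelCount labS (isMem X) l = labelCount labS S l) ∧
      ∀ l, labelCount labT (isMem X) l = labelCount labT S l

/-- The table of every expression contains a set that dominates `S`. -/
theorem exists_dominates {n : ℕ} {α δ : ℕ} {g : Glob} {S : ℕ → Bool} (T : Decomp (Fin n))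
    (hT : ∀ s t, Decomp.union s t ∈ T.nodes → UnionGood α δ g S (nodeLab s) (nodeLab t)) :
    ∃ W ∈ nodeTable α δ g T, Dominates g.2.1 (nodeLab T) W S := by
  induction T with
  | vertex l v =>
    refine ⟨if S v then [(v : ℕ)] else [], by cases S v <;> simp [nodeTable], ?_⟩
    have e : ∀ p ∈ nodeLab (.vertex l v), isMem (if S v then [(v : ℕ)] else []) p.1 = S p.1 := by
      intro p hp
      simp only [nodeLab, List.mem_singleton] at hp
      subst hp
      cases S v <;> simp [isMem]
    exact ⟨labelCount_congr e, (cross_congr e e).ge⟩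
  | union s t ihs iht =>
    obtain ⟨A₀, hA₀, hA₁⟩ := ihs fun s' t' h => hT s' t' (.inl (.inr h))
    obtain ⟨B₀, hB₀, hB₁⟩ := iht fun s' t' h => hT s' t' (.inr h)
    obtain ⟨hd, h1, h2, L, hL, X, hX, hXS, hXT⟩ := hT s t (.inl (.inl rfl))
    obtain ⟨A, hA, hA'⟩ := exists_mem_get_buildTrie (E := g.2.1) (lab := nodeLab s) hA₀
    obtain ⟨B, hB, hB'⟩ := exists_mem_get_buildTrie (E := g.2.1) (lab := nodeLab t) hB₀
    have kA : key (nodeLab s) A₀ = key (nodeLab s) X :=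
      key_eq_iff'.2 fun l => by rw [hA₁.1, hXS]
    have kB : key (nodeLab t) B₀ = key (nodeLab t) X :=
      key_eq_iff'.2 fun l => by rw [hB₁.1, hXT]
    rw [kA] at hA
    rw [kB] at hB
    obtain ⟨mA, mA'⟩ := mem_of_mem_get_buildTrie hA
    obtain ⟨mB, mB'⟩ := mem_of_mem_get_buildTrie hB
    refine ⟨A ++ B, ?_, Dominates.append ⟨fun l => ?_, hA₁.2.trans hA'⟩
      ⟨fun l => ?_, hB₁.2.trans hB'⟩ (fun x hx => (sublist_of_mem_nodeTable mA).subset hx)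
      (fun x hx => (sublist_of_mem_nodeTable mB).subset hx) hd h1 h2⟩
    · simp only [nodeTable, unionTable, lookupBoth, List.mem_flatMap, List.mem_map]
      exact ⟨L, hL, X, hX, A, hA, B, hB, rfl⟩
    · rw [key_eq_iff'.1 mA', hXS]
    · rw [key_eq_iff'.1 mB', hXT]
  | join i j t ih => exact ih fun s' t' h => hT s' t' (.inr h)
  | relabel i j t ih =>
    obtain ⟨W, hW, h1, h2⟩ := ih fun s' t' h => hT s' t' (.inr h)
    exact ⟨W, hW, labelCount_relabel _ _ h1, by
      simp only [nodeLab, cross_relabel]; exact h2⟩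

end MaxCutCW

/-! ### A choice of the algorithm that fits a given cut -/

namespace MaxCutCW

theorem mem_outside {V : List ℕ} {lab : List (ℕ × ℕ)} {L : List ℕ} {x : ℕ} :
    x ∈ outside V lab L ↔ x ∈ V ∧ ∃ l, (x, l) ∈ lab ∧ l ∉ L := by
  simp only [outside, List.mem_filter, List.any_eq_true, Bool.and_eq_true, decide_eq_true_eq,
    Bool.not_eq_true', decide_eq_false_iff_not]
  refine and_congr_right fun _ => ⟨?_, ?_⟩
  · rintro ⟨⟨y, l⟩, h, rfl, h'⟩
    exact ⟨l, h, h'⟩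
  · rintro ⟨l, h, h'⟩
    exact ⟨(x, l), h, rfl, h'⟩

theorem mem_bubbles {E : List (ℕ × ℕ)} {O B : List ℕ} :
    B ∈ bubbles E O ↔ ∃ u ∈ O, O.filter (fun x => same E u x) = B := by
  simp [bubbles]

theorem mem_suffixChoices {bs : List (List ℕ)} {Y : List ℕ} :
    Y ∈ suffixChoices bs ↔ Y = [] ∨ ∃ B ∈ bs, Y <:+ B := by
  simp [suffixChoices]

theorem mem_labelList {lab : List (ℕ × ℕ)} {l x : ℕ} : x ∈ labelList lab l ↔ (x, l) ∈ lab := by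
  simp [labelList]

theorem labelCount_eq_length_filter (lab : List (ℕ × ℕ)) (P : ℕ → Bool) (l : ℕ) :
    labelCount lab P l = ((labelList lab l).filter P).length := by
  rw [labelCount, labelList, List.filter_map, List.length_map, List.filter_filter]
  congr 1
  exact List.filter_congr fun q _ => by simp [Bool.and_comm]

theorem length_labelList (lab : List (ℕ × ℕ)) (P : ℕ → Bool) (l : ℕ) :
    labelCount lab P l ≤ (labelList lab l).length := by
  rw [labelCount_eq_length_filter]
  exact List.length_filter_le ..

theorem filter_mem_drop {l : List ℕ} (h : l.Nodup) (k : ℕ) :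
    l.filter (isMem (l.drop k)) = l.drop k := by
  conv_lhs => rw [← List.take_append_drop k l, List.filter_append]
  have hd := List.disjoint_take_drop h le_rfl (m := k) (n := k)
  rw [List.filter_eq_nil_iff.2, List.nil_append, List.filter_eq_self.2]
  · intro x hx
    simpa [isMem] using hx
  · intro x hx
    simpa [isMem] using fun h' => hd hx h'

/-- The last vertices with label `l`, as many as there are in `S`. -/
def lastOf (lab : List (ℕ × ℕ)) (S : ℕ → Bool) (l : ℕ) : List ℕ :=
  (labelList lab l).drop ((labelList lab l).length - labelCount lab S l)

theorem lastOf_mem (lab : List (ℕ × ℕ)) (S : ℕ → Bool) (l : ℕ) :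
    lastOf lab S l ∈ suffixChoices (classLists lab) := by
  rw [mem_suffixChoices]
  by_cases h : ∃ p ∈ lab, p.2 = l
  · obtain ⟨p, hp, rfl⟩ := h
    exact .inr ⟨_, List.mem_map_of_mem hp, List.drop_suffix _ _⟩
  · left
    have : labelList lab l = [] := by
      rw [List.eq_nil_iff_forall_not_mem]
      exact fun x hx => h ⟨_, mem_labelList.1 hx, rfl⟩
    simp [lastOf, this]

theorem mem_of_mem_lastOf {lab : List (ℕ × ℕ)} {S : ℕ → Bool} {l x : ℕ}
    (h : x ∈ lastOf lab S l) : (x, l) ∈ lab :=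
  mem_labelList.1 (List.mem_of_mem_drop h)

theorem eq_of_mem_of_nodup {lab : List (ℕ × ℕ)} (h : (lab.map Prod.fst).Nodup) {x l l' : ℕ}
    (h1 : (x, l) ∈ lab) (h2 : (x, l') ∈ lab) : l = l' := by
  have := List.inj_on_of_nodup_map h h1 h2 rfl
  simpa using this

theorem nodup_labelList {lab : List (ℕ × ℕ)} (h : (lab.map Prod.fst).Nodup) (l : ℕ) :
    (labelList lab l).Nodup :=
  h.sublist (List.filter_sublist.map _)

/-- A set that agrees with `S` outside of `L`, and consists of the right number of vertices at the
end of each class in `L`, has as many vertices with each label as `S`. -/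
theorem labelCount_eq_of_lastOf {lab : List (ℕ × ℕ)} {S : ℕ → Bool} {L X : List ℕ}
    (hn : (lab.map Prod.fst).Nodup)
    (h1 : ∀ x l, (x, l) ∈ lab → l ∉ L → (x ∈ X ↔ S x = true))
    (h2 : ∀ x l, (x, l) ∈ lab → l ∈ L → (x ∈ X ↔ x ∈ lastOf lab S l)) (l : ℕ) :
    labelCount lab (isMem X) l = labelCount lab S l := by
  rw [labelCount_eq_length_filter]
  by_cases hl : l ∈ L
  · rw [List.filter_congr (q := isMem (lastOf lab S l)) fun x hx => ?_, lastOf,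
      filter_mem_drop (nodup_labelList hn l), List.length_drop]
    · have := length_labelList lab S l
      omega
    · simpa [isMem] using h2 x l (mem_labelList.1 hx) hl
  · rw [labelCount_eq_length_filter]
    congr 1
    refine List.filter_congr fun x hx => ?_
    rw [Bool.eq_iff_iff]
    simpa [isMem] using h1 x l (mem_labelList.1 hx) hl

theorem exists_forall₂_replicate {γ : Type} {ys : List (List γ)} {c : List (List γ)} {k : ℕ}
    (hk : ys.length ≤ k) (h : ∀ y ∈ ys, y ∈ c) (hc : [] ∈ c) :
    ∃ zs, List.Forall₂ (fun y c => y ∈ c) zs (List.replicate k c) ∧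
      ∀ x, (∃ z ∈ zs, x ∈ z) ↔ ∃ y ∈ ys, x ∈ y := by
  induction k generalizing ys with
  | zero =>
    obtain rfl : ys = [] := by simpa using hk
    exact ⟨[], by simp, by simp⟩
  | succ k ih =>
    cases ys with
    | nil =>
      obtain ⟨zs, h1, h2⟩ := ih (ys := []) (by simp) (by simp)
      exact ⟨[] :: zs, .cons hc h1, by simpa using h2⟩
    | cons y ys =>
      obtain ⟨zs, h1, h2⟩ := ih (ys := ys) (by simpa using hk) fun y hy => h y (by simp [hy])
      exact ⟨y :: zs, .cons (h y (by simp)) h1, by simp [h2]⟩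

theorem exists_mem_labelSets {δ : ℕ} {labels L : List ℕ} (h : L.length ≤ δ) (hL : L ⊆ labels) :
    ∃ L' ∈ labelSets δ labels, ∀ l, l ∈ L' ↔ l ∈ L := by
  obtain ⟨zs, h1, h2⟩ := exists_forall₂_replicate (ys := L.map fun l => [l])
    (c := [] :: labels.map fun l => [l]) (k := δ) (by simpa using h)
    (by simpa using fun a ha => hL ha) (by simp)
  obtain ⟨L', h3, h4⟩ := exists_mem_choiceProd h1
  exact ⟨L', h3, fun l => by rw [h4, h2]; simp⟩

theorem filter_suffix {S : ℕ → Bool} {l : List ℕ}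
    (h : l.Pairwise fun x y => S x = true → S y = true) : l.filter S <:+ l := by
  induction l with
  | nil => simp
  | cons x l ih =>
    rw [List.pairwise_cons] at h
    cases hx : S x
    · rw [List.filter_cons_of_neg (by simp [hx])]
      exact (ih h.2).trans (List.suffix_cons x l)
    · rw [List.filter_eq_self.2]
      simpa [hx] using fun y hy => h.1 y hy hx

theorem outside_congr {V : List ℕ} {lab : List (ℕ × ℕ)} {L L' : List ℕ}
    (h : ∀ l, l ∈ L' ↔ l ∈ L) : outside V lab L' = outside V lab L := by
  simp only [outside, h]

/-- Some choice that the algorithm tries at a union fits `S`, provided that `S` is normalized on the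
bubbles outside of `L`: in each of them it consists of the last vertices, and at most `α` of them
are mixed. -/
theorem exists_guess {α δ : ℕ} {V : List ℕ} {E : List (ℕ × ℕ)} {labels fuel : List ℕ}
    {labS labT : List (ℕ × ℕ)} {S : ℕ → Bool} {L R : List ℕ}
    (hn : ((labS ++ labT).map Prod.fst).Nodup) (hV : ∀ p ∈ labS ++ labT, p.1 ∈ V)
    (hδ : L.length ≤ δ) (hL : L ⊆ labels)
    (hfuel : (bubbles E (outside V (labS ++ labT) L)).length ≤ fuel.length)
    (hα : R.length ≤ α) (hRO : R ⊆ outside V (labS ++ labT) L)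
    (hmix : ∀ x ∈ outside V (labS ++ labT) L, ∀ y ∈ outside V (labS ++ labT) L,
      same E x y = true → S x = true → S y = false → ∃ r ∈ R, same E r x = true)
    (hsuf : V.Pairwise fun x y => same E x y = true → S x = true → S y = true)
    (hrefl : ∀ x, same E x x = true)
    (hcomm : ∀ x y, same E x y = true → same E y x = true)
    (htrans : ∀ x y z, same E x y = true → same E y z = true → same E x z = true) :
    ∃ L' ∈ labelSets δ labels, ∃ X ∈ choiceProd (guardedChoices α δ V E fuel labS labT L'),
      (∀ l, labelCount labS (isMem X) l = labelCount labS S l) ∧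
      ∀ l, labelCount labT (isMem X) l = labelCount labT S l := by
  obtain ⟨L', hL', hLL'⟩ := exists_mem_labelSets hδ hL
  refine ⟨L', hL', ?_⟩
  rw [guardedChoices, outside_congr hLL', if_pos hfuel, choices]
  set O := outside V (labS ++ labT) L with hO
  have mO {x} := mem_outside (x := x) (V := V) (lab := labS ++ labT) (L := L)
  rw [← hO] at mO
  -- the four parts of the choice
  have f1 : List.Forall₂ (fun y c => y ∈ c)
      ((bubbles E O).map fun B => if B.all S then B else [])
      ((bubbles E O).map fun B => [[], B]) := by
    rw [List.forall₂_map_left_iff, List.forall₂_map_right_iff, List.forall₂_same]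
    intro B _
    cases B.all S <;> simp
  obtain ⟨z2, f2, m2⟩ := exists_forall₂_replicate (k := α) (c := suffixChoices (bubbles E O))
    (ys := R.map fun r => (O.filter fun x => same E r x).filter S) (by simpa using hα) (by
      simp only [List.mem_map, forall_exists_index, and_imp, forall_apply_eq_imp_iff₂]
      intro r hr
      rw [mem_suffixChoices]
      refine .inr ⟨_, mem_bubbles.2 ⟨r, hRO hr, rfl⟩, filter_suffix ?_⟩
      have h1 := hsuf.sublist ((List.filter_sublist (p := fun x => same E r x)).trans
        (List.filter_sublist (l := V) (p := fun x =>
          (labS ++ labT).any fun p => decide (p.1 = x) && !decide (p.2 ∈ L))))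
      refine h1.imp_of_mem fun {x y} hx hy h => h ?_
      exact htrans _ _ _ (hcomm _ _ (List.mem_filter.1 hx).2) (List.mem_filter.1 hy).2)
    (by simp [suffixChoices])
  obtain ⟨z3, f3, m3⟩ := exists_forall₂_replicate (k := δ) (c := suffixChoices (classLists labS))
    (ys := L.map (lastOf labS S)) (by simpa using hδ) (by simp [lastOf_mem])
    (by simp [suffixChoices])
  obtain ⟨z4, f4, m4⟩ := exists_forall₂_replicate (k := δ) (c := suffixChoices (classLists labT))
    (ys := L.map (lastOf labT S)) (by simpa using hδ) (by simp [lastOf_mem])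
    (by simp [suffixChoices])
  obtain ⟨X, hX, mX⟩ := exists_mem_choiceProd
    (List.rel_append f1 (List.rel_append f2 (List.rel_append f3 f4)))
  refine ⟨X, hX, ?_⟩
  have mX' : ∀ x, x ∈ X ↔ (∃ B ∈ bubbles E O, (∀ y ∈ B, S y = true) ∧ x ∈ B) ∨
      (∃ r ∈ R, x ∈ O ∧ same E r x = true ∧ S x = true) ∨ (∃ l ∈ L, x ∈ lastOf labS S l) ∨
      ∃ l ∈ L, x ∈ lastOf labT S l := by
    intro x
    rw [mX]
    simp only [List.mem_append, or_and_right, exists_or, m2, m3, m4]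
    refine or_congr ?_ (or_congr ?_ (by simp))
    · simp only [List.mem_map, exists_exists_and_eq_and]
      refine exists_congr fun B => and_congr_right fun _ => ?_
      cases h : B.all S
      · simp only [Bool.false_eq_true, if_false, List.not_mem_nil, false_iff]
        rintro ⟨h1, -⟩
        rw [List.all_eq_true.2 h1] at h
        cases h
      · simpa using fun _ => by simpa using h
    · simp [and_comm]
  have hin : ∀ x l, (x, l) ∈ labS ++ labT → l ∉ L → ((∃ B ∈ bubbles E O, (∀ y ∈ B, S y = true) ∧
      x ∈ B) ∨ (∃ r ∈ R, x ∈ O ∧ same E r x = true ∧ S x = true) ↔ S x = true) := by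
    intro x l hx hl
    have hxO : x ∈ O := mO.2 ⟨hV _ hx, l, hx, hl⟩
    refine ⟨?_, fun hSx => ?_⟩
    · rintro (⟨B, -, h, h'⟩ | ⟨_, _, _, _, h⟩)
      exacts [h x h', h]
    · by_cases hB : ∀ y ∈ O.filter (fun y => same E x y), S y = true
      · exact .inl ⟨_, mem_bubbles.2 ⟨x, hxO, rfl⟩, hB, List.mem_filter.2 ⟨hxO, hrefl x⟩⟩
      · push Not at hB
        obtain ⟨y, hy, hy'⟩ := hB
        obtain ⟨r, hr, hr'⟩ := hmix x hxO y (List.mem_filter.1 hy).1 (List.mem_filter.1 hy).2 hSx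
          (by simpa using hy')
        exact .inr ⟨r, hr, hxO, hr', hSx⟩
  have hout : ∀ x l, (x, l) ∈ labS ++ labT → l ∈ L → ¬ ((∃ B ∈ bubbles E O,
      (∀ y ∈ B, S y = true) ∧ x ∈ B) ∨ (∃ r ∈ R, x ∈ O ∧ same E r x = true ∧ S x = true)) := by
    intro x l hx hl h
    have hxO : x ∈ O := by
      rcases h with ⟨B, hB, -, h'⟩ | ⟨_, _, h, _⟩
      · obtain ⟨u, -, rfl⟩ := mem_bubbles.1 hB
        exact (List.mem_filter.1 h').1
      · exact h
    obtain ⟨-, l', h1, h2⟩ := mO.1 hxO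
    exact h2 (eq_of_mem_of_nodup hn hx h1 ▸ hl)
  have hd : ∀ x l l', (x, l) ∈ labS → (x, l') ∉ labT := by
    intro x l l' h h'
    rw [List.map_append, List.nodup_append] at hn
    exact hn.2.2 x (List.mem_map_of_mem h) x (List.mem_map_of_mem h') rfl
  have huniq : ∀ x l l', (x, l) ∈ labS ++ labT → (x, l') ∈ labS ++ labT → l = l' :=
    fun x l l' => eq_of_mem_of_nodup hn
  have hl : ∀ x l l', (x, l) ∈ labS ++ labT → x ∈ lastOf labS S l' → (x, l) ∈ labS ∧ l = l' := by
    intro x l l' h1 h2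
    have h3 := mem_of_mem_lastOf h2
    obtain rfl := huniq x l l' h1 (List.mem_append_left _ h3)
    exact ⟨h3, rfl⟩
  have hr : ∀ x l l', (x, l) ∈ labS ++ labT → x ∈ lastOf labT S l' → (x, l) ∈ labT ∧ l = l' := by
    intro x l l' h1 h2
    have h3 := mem_of_mem_lastOf h2
    obtain rfl := huniq x l l' h1 (List.mem_append_right _ h3)
    exact ⟨h3, rfl⟩
  rw [List.map_append] at hn
  refine ⟨labelCount_eq_of_lastOf (L := L) (List.nodup_append.1 hn).1 ?_ ?_,
    labelCount_eq_of_lastOf (L := L) (List.nodup_append.1 hn).2.1 ?_ ?_⟩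
  · intro x l hx hlL
    have hx' := List.mem_append_left labT hx
    refine (mX' x).trans (Iff.trans ⟨?_, fun h => h.imp_right .inl⟩ (hin x l hx' hlL))
    rintro (h | h | ⟨l', h1, h2⟩ | ⟨l', h1, h2⟩)
    exacts [.inl h, .inr h, absurd ((hl x l l' hx' h2).2 ▸ h1) hlL,
      absurd ((hr x l l' hx' h2).2 ▸ h1) hlL]
  · intro x l hx hlL
    have hx' := List.mem_append_left labT hx
    rw [mX']
    refine ⟨?_, fun h => .inr (.inr (.inl ⟨l, hlL, h⟩))⟩
    rintro (h | h | ⟨l', h1, h2⟩ | ⟨l', h1, h2⟩)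
    exacts [absurd (.inl h) (hout x l hx' hlL), absurd (.inr h) (hout x l hx' hlL),
      (hl x l l' hx' h2).2 ▸ h2, absurd (hr x l l' hx' h2).1 (hd x l l hx)]
  · intro x l hx hlL
    have hx' := List.mem_append_right labS hx
    refine (mX' x).trans (Iff.trans ⟨?_, fun h => h.imp_right .inl⟩ (hin x l hx' hlL))
    rintro (h | h | ⟨l', h1, h2⟩ | ⟨l', h1, h2⟩)
    exacts [.inl h, .inr h, absurd ((hl x l l' hx' h2).2 ▸ h1) hlL,
      absurd ((hr x l l' hx' h2).2 ▸ h1) hlL]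
  · intro x l hx hlL
    have hx' := List.mem_append_right labS hx
    rw [mX']
    refine ⟨?_, fun h => .inr (.inr (.inr ⟨l, hlL, h⟩))⟩
    rintro (h | h | ⟨l', h1, h2⟩ | ⟨l', h1, h2⟩)
    exacts [absurd (.inl h) (hout x l hx' hlL), absurd (.inr h) (hout x l hx' hlL),
      absurd hx (hd x l l (hl x l l' hx' h2).1), (hr x l l' hx' h2).2 ▸ h2]

end MaxCutCW

/-! ### Normalized maximum cuts -/

namespace MaxCutCW

open Finset Matrix

section Graph

variable {V : Type*} {G : SimpleGraph V}

/-- The closed neighbourhood of a vertex. Two vertices belong to the same bubble if and only if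
their closed neighbourhoods are equal. -/
def closedNbhd (G : SimpleGraph V) (u : V) : Set V := {x | x = u ∨ G.Adj u x}

theorem mem_closedNbhd_self (u : V) : u ∈ closedNbhd G u := .inl rfl

theorem adj_of_closedNbhd_eq {u v : V} (h : closedNbhd G u = closedNbhd G v) (hne : u ≠ v) :
    G.Adj u v := by
  have : v ∈ closedNbhd G u := h ▸ mem_closedNbhd_self v
  exact this.resolve_left hne.symm

theorem adj_iff_of_closedNbhd_eq {u v x : V} (h : closedNbhd G u = closedNbhd G v) (hu : x ≠ u)
    (hv : x ≠ v) : G.Adj u x ↔ G.Adj v x := by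
  have h1 : x ∈ closedNbhd G u ↔ x ∈ closedNbhd G v := by rw [h]
  simpa [closedNbhd, hu, hv] using h1

theorem twins_iff {u v : V} : Twins G u v ↔ u ≠ v ∧ closedNbhd G u = closedNbhd G v := by
  constructor
  · rintro ⟨h1, h2⟩
    refine ⟨h1.ne, Set.ext fun x => ?_⟩
    have h3 : x ∈ G.neighborSet u \ {v} ↔ x ∈ G.neighborSet v \ {u} := by rw [h2]
    simp only [Set.mem_sdiff, SimpleGraph.mem_neighborSet, Set.mem_singleton_iff] at h3
    simp only [closedNbhd, Set.mem_ofPred_eq]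
    by_cases hu : x = u
    · subst hu; simp [h1.symm]
    by_cases hv : x = v
    · subst hv; simp [h1]
    tauto
  · rintro ⟨h1, h2⟩
    refine ⟨adj_of_closedNbhd_eq h2 h1, Set.ext fun x => ?_⟩
    simp only [Set.mem_sdiff, SimpleGraph.mem_neighborSet, Set.mem_singleton_iff]
    by_cases hu : x = u
    · subst hu; simp
    by_cases hv : x = v
    · subst hv; simp
    simp [hu, hv, adj_iff_of_closedNbhd_eq h2 hu hv]

theorem isBubble_setOf_closedNbhd_eq (u : V) :
    IsBubble G {x | closedNbhd G u = closedNbhd G x} := by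
  refine ⟨fun x hx y hy hne => twins_iff.2 ⟨hne, hx.symm.trans hy⟩, fun B hB hle x hx => ?_⟩
  by_cases hxu : u = x
  · rw [hxu]; rfl
  · exact (twins_iff.1 (hB (hle (rfl : closedNbhd G u = closedNbhd G u)) hx hxu)).2

end Graph

variable {V : Type*} [Fintype V] [DecidableEq V]

/-- The characteristic vector of a set. -/
def charVec (S : Finset V) : V → ℤ := fun v => if v ∈ S then 1 else 0

omit [Fintype V] in
theorem charVec_swap {S : Finset V} {a b : V} (ha : a ∈ S) (hb : b ∉ S) :
    charVec (insert b (S.erase a)) = charVec S + (Pi.single b 1 - Pi.single a 1) := by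
  have hab : a ≠ b := fun h => hb (h ▸ ha)
  ext v
  simp only [charVec, mem_insert, mem_erase, Pi.add_apply, Pi.sub_apply, Pi.single_apply]
  by_cases h1 : v = a
  · subst h1; simp [hab, ha]
  by_cases h2 : v = b
  · subst h2; simp [hb, h1]
  simp [h1, h2]

/-- The effect on a quadratic form of an exchange of two elements. -/
theorem quadratic_swap {M : Matrix V V ℤ} (hM : M.IsSymm) (d : V → ℤ) (x : V → ℤ) (a b : V) :
    d ⬝ᵥ (x + (Pi.single b 1 - Pi.single a 1)) + (x + (Pi.single b 1 - Pi.single a 1)) ⬝ᵥ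
      (M *ᵥ (x + (Pi.single b 1 - Pi.single a 1))) =
    d ⬝ᵥ x + x ⬝ᵥ (M *ᵥ x) + (d b - d a) + 2 * ((M *ᵥ x) b - (M *ᵥ x) a) + M a a + M b b
      - 2 * M a b := by
  have h1 : ∀ (c : V) (y : V → ℤ), y ⬝ᵥ (M *ᵥ Pi.single c 1) = (M *ᵥ y) c := by
    intro c y
    rw [dotProduct_mulVec, ← mulVec_transpose, hM.eq, dotProduct_single_one]
  have h2 : M b a = M a b := hM.apply a b
  have h3 : ∀ c e, (M *ᵥ Pi.single c 1) e = M e c := by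
    intro c e
    simp
  simp only [mulVec_add, mulVec_sub, dotProduct_add, add_dotProduct, sub_dotProduct,
    dotProduct_sub, h1, single_one_dotProduct, dotProduct_single_one, Pi.add_apply, Pi.sub_apply,
    h3, h2]
  ring

open Classical in
/-- The number of edges with exactly one endpoint in `S`, as a quadratic form. -/
noncomputable def cutForm (G : SimpleGraph V) (S : Finset V) : ℤ :=
  (G.adjMatrix ℤ *ᵥ 1) ⬝ᵥ charVec S + charVec S ⬝ᵥ (-G.adjMatrix ℤ *ᵥ charVec S)

open Classical in
/-- The matrix of the equivalence relation whose classes are the bubbles. -/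
noncomputable def bubbleMatrix (G : SimpleGraph V) : Matrix V V ℤ :=
  fun u v => if closedNbhd G u = closedNbhd G v then 1 else 0

/-- The number of pairs in `S` that belong to the same bubble. -/
noncomputable def bubbleForm (G : SimpleGraph V) (S : Finset V) : ℤ :=
  0 ⬝ᵥ charVec S + charVec S ⬝ᵥ (bubbleMatrix G *ᵥ charVec S)

open Classical in
theorem cutSize_eq_card (G : SimpleGraph V) (S : Finset V) :
    cutSize G S = #{p : V × V | G.Adj p.1 p.2 ∧ p.1 ∈ S ∧ p.2 ∉ S} := by
  have : cutSet G (S : Set V) = (fun p : V × V => s(p.1, p.2)) ''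
      (({p : V × V | G.Adj p.1 p.2 ∧ p.1 ∈ S ∧ p.2 ∉ S} : Finset (V × V)) : Set (V × V)) := by
    ext e
    simp only [cutSet, Set.mem_ofPred_eq, Set.mem_image, mem_coe, Finset.mem_filter, mem_univ,
      true_and, Prod.exists]
    exact ⟨fun ⟨u, v, h1, h2, h3, h4⟩ => ⟨u, v, ⟨h1, h2, h3⟩, h4.symm⟩,
      fun ⟨u, v, ⟨h1, h2, h3⟩, h4⟩ => ⟨u, v, h1, h2, h3, h4.symm⟩⟩
  rw [cutSize, this, Set.InjOn.ncard_image, Set.ncard_coe_finset]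
  rintro ⟨a, b⟩ h1 ⟨c, d⟩ h2 h3
  simp only [coe_filter, mem_univ, true_and, Set.mem_ofPred_eq] at h1 h2
  rcases Sym2.eq_iff.1 h3 with ⟨rfl, rfl⟩ | ⟨rfl, rfl⟩
  · rfl
  · exact absurd h1.2.1 h2.2.2

theorem cutSize_eq_cutForm (G : SimpleGraph V) (S : Finset V) :
    (cutSize G S : ℤ) = cutForm G S := by
  classical
  rw [cutSize_eq_card, cutForm, neg_mulVec, dotProduct_neg, dotProduct_comm, ← sub_eq_add_neg,
    ← dotProduct_sub, ← mulVec_sub, card_filter, Fintype.sum_prod_type]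
  push_cast
  refine Finset.sum_congr rfl fun u _ => ?_
  rw [mulVec, dotProduct, Finset.mul_sum]
  refine Finset.sum_congr rfl fun v _ => ?_
  by_cases h1 : G.Adj u v <;> by_cases h2 : u ∈ S <;> by_cases h3 : v ∈ S <;>
    simp [charVec, h1, h2, h3]

section Swap

variable {G : SimpleGraph V} {S : Finset V}

open Classical in
/-- For twins `u ∈ S` and `u' ∉ S`, the vertex `u'` has one more neighbour in `S` than `u`. -/
theorem adjMatrix_mulVec_charVec {u u' : V} (h : closedNbhd G u = closedNbhd G u') (hu : u ∈ S)
    (hu' : u' ∉ S) : (G.adjMatrix ℤ *ᵥ charVec S) u' = (G.adjMatrix ℤ *ᵥ charVec S) u + 1 := by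
  have hne : u ≠ u' := fun e => hu' (e ▸ hu)
  have hadj := adj_of_closedNbhd_eq h hne
  have e : (1 : ℤ) = ∑ w, if w = u then 1 else 0 := by simp
  rw [mulVec, mulVec, dotProduct, dotProduct, e, ← Finset.sum_add_distrib]
  refine Finset.sum_congr rfl fun w _ => ?_
  by_cases h1 : w = u
  · subst h1
    simp [hadj.symm, charVec, hu]
  by_cases h2 : w = u'
  · subst h2
    simp [charVec, hu', h1]
  simp [SimpleGraph.adjMatrix_apply, adj_iff_of_closedNbhd_eq h h1 h2, h1]

open Classical in
theorem adjMatrix_mulVec_one {u u' : V} (h : closedNbhd G u = closedNbhd G u') :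
    (G.adjMatrix ℤ *ᵥ 1) u' = (G.adjMatrix ℤ *ᵥ 1) u := by
  by_cases hne : u = u'
  · rw [hne]
  have hadj := adj_of_closedNbhd_eq h hne
  rw [mulVec, mulVec, dotProduct, dotProduct]
  refine Fintype.sum_equiv (Equiv.swap u u') _ _ fun w => ?_
  by_cases h1 : w = u
  · subst h1
    simp [hadj.symm, hadj]
  by_cases h2 : w = u'
  · subst h2
    simp
  simp [SimpleGraph.adjMatrix_apply, Equiv.swap_apply_of_ne_of_ne h1 h2,
    adj_iff_of_closedNbhd_eq h h1 h2]

omit [DecidableEq V] in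
theorem bubbleMatrix_mulVec {u u' : V} (h : closedNbhd G u = closedNbhd G u') (x : V → ℤ) :
    (bubbleMatrix G *ᵥ x) u' = (bubbleMatrix G *ᵥ x) u := by
  rw [mulVec, mulVec]
  congr 1
  ext w
  simp [bubbleMatrix, h]

open Classical in
theorem cutForm_swap {a b : V} (ha : a ∈ S) (hb : b ∉ S) :
    cutForm G (insert b (S.erase a)) = cutForm G S +
      ((G.adjMatrix ℤ *ᵥ 1) b - (G.adjMatrix ℤ *ᵥ 1) a) -
      2 * ((G.adjMatrix ℤ *ᵥ charVec S) b - (G.adjMatrix ℤ *ᵥ charVec S) a) +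
      2 * G.adjMatrix ℤ a b := by
  rw [cutForm, charVec_swap ha hb, quadratic_swap]
  · simp only [cutForm, neg_mulVec, Pi.neg_apply, Matrix.neg_apply, SimpleGraph.adjMatrix_apply,
      G.irrefl, if_false]
    ring
  · exact G.isSymm_adjMatrix.neg

theorem bubbleForm_swap {a b : V} (ha : a ∈ S) (hb : b ∉ S) :
    bubbleForm G (insert b (S.erase a)) = bubbleForm G S +
      2 * ((bubbleMatrix G *ᵥ charVec S) b - (bubbleMatrix G *ᵥ charVec S) a) + 2 -
      2 * bubbleMatrix G a b := by
  rw [bubbleForm, charVec_swap ha hb, quadratic_swap]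
  · simp only [bubbleForm, bubbleMatrix, Pi.zero_apply]
    simp
    ring
  · ext u v
    simp [bubbleMatrix, eq_comm]

end Swap

/-- There is a maximum cut that consists of the last vertices in each bubble, and whose mixed
bubbles are pairwise nonadjacent. Among all maximum cuts one chooses first a cut with the maximum
number of pairs in the same bubble, and then one with the maximum sum of positions: if vertices `u`
and `v` in two mixed bubbles were adjacent, then one of the two ways of moving a vertex of the cut
from one of these bubbles to the other would preserve the size of the cut and increase the number
of pairs. -/
theorem exists_normalized_maxCut {n : ℕ} (G : SimpleGraph (Fin n)) :
    ∃ S : Finset (Fin n), IsMaxCut G (S : Set (Fin n)) ∧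
      (∀ u v, u < v → closedNbhd G u = closedNbhd G v → u ∈ S → v ∈ S) ∧
      ∀ u u' v v', closedNbhd G u = closedNbhd G u' → u ∈ S → u' ∉ S →
        closedNbhd G v = closedNbhd G v' → v ∈ S → v' ∉ S → G.Adj u v →
        closedNbhd G u = closedNbhd G v := by
  classical
  obtain ⟨S, hS⟩ := Finite.exists_max fun S : Finset (Fin n) =>
    toLex (cutForm G S, toLex (bubbleForm G S, ∑ v ∈ S, (v : ℕ)))
  simp only [Prod.Lex.toLex_le_toLex] at hS
  have h1 : ∀ S', cutForm G S' ≤ cutForm G S := fun S' => by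
    rcases hS S' with h | h
    exacts [h.le, h.1.le]
  have h2 : ∀ S', cutForm G S' = cutForm G S → bubbleForm G S' ≤ bubbleForm G S := fun S' h' => by
    rcases hS S' with h | ⟨-, h | h⟩
    exacts [absurd h h'.not_lt, h.le, h.1.le]
  have h3 : ∀ S', cutForm G S' = cutForm G S → bubbleForm G S' = bubbleForm G S →
      ∑ v ∈ S', (v : ℕ) ≤ ∑ v ∈ S, (v : ℕ) := fun S' h' h'' => by
    rcases hS S' with h | ⟨-, h | h⟩
    exacts [absurd h h'.not_lt, absurd h h''.not_lt, h.2]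
  refine ⟨S, fun S' => ?_, fun u v huv h hu => ?_, fun u u' v v' h hu hu' h' hv hv' hadj => ?_⟩
  · have := h1 S'.toFinite.toFinset
    rw [← cutSize_eq_cutForm, ← cutSize_eq_cutForm] at this
    simpa using this
  · by_contra hv
    have e1 : cutForm G (insert v (S.erase u)) = cutForm G S := by
      rw [cutForm_swap hu hv, adjMatrix_mulVec_charVec h hu hv, adjMatrix_mulVec_one h]
      simp [adj_of_closedNbhd_eq h huv.ne]
    have e2 : bubbleForm G (insert v (S.erase u)) = bubbleForm G S := by
      rw [bubbleForm_swap hu hv, bubbleMatrix_mulVec h]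
      simp [bubbleMatrix, h]
    have := h3 _ e1 e2
    rw [Finset.sum_insert (by simp [hv]), ← Finset.add_sum_erase S _ hu] at this
    have huv' : (u : ℕ) < v := huv
    omega
  · by_contra hne
    have adj1 : ∀ {x y : Fin n}, G.Adj x y → closedNbhd G x ≠ closedNbhd G y →
        ∀ y', closedNbhd G y = closedNbhd G y' → G.Adj x y' := by
      intro x y hxy hne y' hy
      have h4 : x ∈ closedNbhd G y' := hy ▸ Or.inr hxy.symm
      rcases h4 with rfl | h4
      · exact absurd hy.symm hne
      · exact h4.symm
    have a1 : G.Adj u v' := adj1 hadj hne v' h'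
    have a2 : G.Adj v u' := adj1 hadj.symm (Ne.symm hne) u' h
    have b1 : bubbleMatrix G u v' = 0 := by simp [bubbleMatrix, ← h', hne]
    have b2 : bubbleMatrix G v u' = 0 := by simp [bubbleMatrix, ← h, Ne.symm hne]
    have c1 := cutForm_swap (G := G) hu hv'
    have c2 := cutForm_swap (G := G) hv hu'
    rw [adjMatrix_mulVec_charVec h' hv hv', adjMatrix_mulVec_one h'] at c1
    rw [adjMatrix_mulVec_charVec h hu hu', adjMatrix_mulVec_one h] at c2
    simp only [SimpleGraph.adjMatrix_apply, a1, a2, if_true] at c1 c2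
    have d1 := bubbleForm_swap (G := G) hu hv'
    have d2 := bubbleForm_swap (G := G) hv hu'
    rw [bubbleMatrix_mulVec h', b1] at d1
    rw [bubbleMatrix_mulVec h, b2] at d2
    have e1 := h1 (insert v' (S.erase u))
    have e2 := h1 (insert u' (S.erase v))
    have e3 := h2 (insert v' (S.erase u)) (by omega)
    have e4 := h2 (insert u' (S.erase v)) (by omega)
    omega

end MaxCutCW

/-! ### Decompositions and their linear representations -/

namespace MaxCutCW

/-- The adjacency matrix of a graph. -/
noncomputable def adjRows {n : ℕ} (G : SimpleGraph (Fin n)) : List (List Bool) := by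
  classical
  exact (List.finRange n).map fun u => (List.finRange n).map fun v => decide (G.Adj u v)

theorem enc_adjRows {n : ℕ} (G : SimpleGraph (Fin n)) : Enc.enc (adjRows G) = encGraph G := by
  change encList ((adjRows G).map fun l => encList (l.map encBool)) = _
  simp only [adjRows, encGraph, List.map_map, Function.comp_def]

theorem mem_edgeList_adjRows {n : ℕ} {G : SimpleGraph (Fin n)} {u v : ℕ} :
    (u, v) ∈ edgeList (adjRows G) ↔ ∃ (hu : u < n) (hv : v < n), G.Adj ⟨u, hu⟩ ⟨v, hv⟩ := by
  simp only [edgeList, List.mem_flatMap, Prod.exists, List.mem_zipIdx_iff_getElem?]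
  constructor
  · rintro ⟨r, i, h1, b, j, h2, h3⟩
    cases b
    · simp at h3
    simp only [if_true, List.mem_singleton, Prod.mk.injEq] at h3
    obtain ⟨rfl, rfl⟩ := h3
    simp only [adjRows, List.getElem?_map, Option.map_eq_some_iff, List.getElem?_eq_some_iff,
      List.length_finRange, List.getElem_finRange] at h1
    obtain ⟨_, ⟨hu, rfl⟩, rfl⟩ := h1
    simp only [List.getElem?_map, Option.map_eq_some_iff, List.getElem?_eq_some_iff,
      List.length_finRange, List.getElem_finRange, decide_eq_true_eq] at h2
    obtain ⟨_, ⟨hv, rfl⟩, h⟩ := h2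
    exact ⟨hu, hv, by simpa using h⟩
  · rintro ⟨hu, hv, h⟩
    refine ⟨(List.finRange n).map fun v => @decide (G.Adj ⟨u, hu⟩ v) (Classical.propDecidable _), u,
      ?_, true, v, ?_, by simp⟩
    · simp only [adjRows, List.getElem?_map, Option.map_eq_some_iff, List.getElem?_eq_some_iff,
        List.length_finRange, List.getElem_finRange]
      exact ⟨_, ⟨hu, rfl⟩, rfl⟩
    · simp only [List.getElem?_map, Option.map_eq_some_iff, List.getElem?_eq_some_iff,
        List.length_finRange, List.getElem_finRange, decide_eq_true_eq]
      exact ⟨_, ⟨hv, rfl⟩, by simpa using h⟩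

theorem same_iff {n : ℕ} {G : SimpleGraph (Fin n)} {u v : ℕ} :
    same (edgeList (adjRows G)) u v = true ↔ u = v ∨ ∃ (hu : u < n) (hv : v < n),
      closedNbhd G ⟨u, hu⟩ = closedNbhd G ⟨v, hv⟩ := by
  by_cases huv : u = v
  · simp [same, huv]
  simp only [same, huv, decide_false, Bool.false_or, false_or, twin, Bool.and_eq_true,
    decide_eq_true_eq, List.all_eq_true, Bool.or_eq_true, Bool.not_eq_true',
    decide_eq_false_iff_not, Prod.forall, mem_edgeList_adjRows]
  constructor
  · rintro ⟨⟨hu, hv, h⟩, h'⟩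
    refine ⟨hu, hv, Set.ext fun x => ?_⟩
    have h1 := fun hx => (h' u x ⟨hu, x.2, hx⟩).1
    have h2 := fun hx => (h' v x ⟨hv, x.2, hx⟩).2
    simp only [not_true_eq_false, false_or] at h1 h2
    constructor
    · rintro (rfl | hx)
      · exact .inr h.symm
      · rcases h1 hx with e | ⟨_, _, e⟩
        exacts [.inl (Fin.ext e), .inr e]
    · rintro (rfl | hx)
      · exact .inr h
      · rcases h2 hx with e | ⟨_, _, e⟩
        exacts [.inl (Fin.ext e), .inr e]
  · rintro ⟨hu, hv, h⟩
    refine ⟨⟨hu, hv, adj_of_closedNbhd_eq h (by simpa using huv)⟩,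
      fun a b ⟨ha, hb, hab⟩ => ⟨?_, ?_⟩⟩
    · rw [or_iff_not_imp_left, not_not]
      rintro rfl
      have : (⟨b, hb⟩ : Fin n) ∈ closedNbhd G ⟨v, hv⟩ := h ▸ Or.inr hab
      rcases this with e | e
      exacts [.inl (Fin.ext_iff.1 e), .inr ⟨hv, hb, e⟩]
    · rw [or_iff_not_imp_left, not_not]
      rintro rfl
      have : (⟨b, hb⟩ : Fin n) ∈ closedNbhd G ⟨u, hu⟩ := h ▸ Or.inr hab
      rcases this with e | e
      exacts [.inl (Fin.ext_iff.1 e), .inr ⟨hu, hb, e⟩]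

section Decomp

variable {n : ℕ} {T t : Decomp (Fin n)}

theorem mem_usedLabels (T : Decomp (Fin n)) (l : ℕ) : l ∈ usedLabels (lin T) ↔ l ∈ T.labels := by
  rw [usedLabels, List.mem_dedup]
  induction T with
  | vertex l v => simp [lin, instrLabels, Decomp.labels]
  | union s t ihs iht =>
    simp only [lin, List.flatMap_append, List.mem_append, ihs, iht, Decomp.labels,
      Finset.mem_union]
    simp [instrLabels, or_comm]
  | join i j t ih =>
    simp only [lin, List.flatMap_append, List.mem_append, ih, Decomp.labels, Finset.mem_union]
    simp [instrLabels, or_comm]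
  | relabel i j t ih =>
    simp only [lin, List.flatMap_append, List.mem_append, ih, Decomp.labels, Finset.mem_union]
    simp [instrLabels, or_comm]

theorem length_usedLabels (T : Decomp (Fin n)) : (usedLabels (lin T)).length = T.width := by
  rw [Decomp.width, usedLabels, ← List.card_toFinset]
  congr 1
  ext l
  rw [List.mem_toFinset, ← mem_usedLabels, usedLabels, List.mem_dedup]

theorem self_mem_nodes (T : Decomp (Fin n)) : T ∈ T.nodes := by
  cases T <;> simp [Decomp.nodes]

theorem mem_nodes_trans {s : Decomp (Fin n)} (hs : s ∈ t.nodes) (ht : t ∈ T.nodes) :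
    s ∈ T.nodes := by
  induction T with
  | vertex l v => rwa [Set.mem_singleton_iff.1 ht] at hs
  | union a b iha ihb =>
    rcases ht with (rfl | ht) | ht
    exacts [hs, .inl (.inr (iha ht)), .inr (ihb ht)]
  | join i j a ih =>
    rcases ht with rfl | ht
    exacts [hs, .inr (ih ht)]
  | relabel i j a ih =>
    rcases ht with rfl | ht
    exacts [hs, .inr (ih ht)]

theorem mem_labels_of_label_eq_some {u : Fin n} {l : ℕ} (h : T.label u = some l) :
    l ∈ T.labels := by
  induction T generalizing l with
  | vertex l' v =>
    by_cases e : u = v <;> simp_all [Decomp.label, Decomp.labels]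
  | union s t ihs iht =>
    simp only [Decomp.label, Option.or_eq_some_iff] at h
    simp only [Decomp.labels, Finset.mem_union]
    rcases h with h | h
    exacts [.inl (ihs h), .inr (iht h.2)]
  | join i j t ih => exact Finset.mem_union_right _ (ih h)
  | relabel i j t ih =>
    simp only [Decomp.label, Option.map_eq_some_iff] at h
    obtain ⟨l', h1, rfl⟩ := h
    have := ih h1
    simp only [Decomp.labels, Finset.mem_union, Finset.mem_insert, Finset.mem_singleton]
    split_ifs <;> simp_all

theorem labels_subset_of_mem_nodes (h : t ∈ T.nodes) : t.labels ⊆ T.labels := by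
  induction T with
  | vertex l v => rw [Set.mem_singleton_iff.1 h]
  | union s s' ihs iht =>
    rcases h with (rfl | h) | h
    exacts [subset_rfl, (ihs h).trans Finset.subset_union_left,
      (iht h).trans Finset.subset_union_right]
  | join i j s ih =>
    rcases h with rfl | h
    exacts [subset_rfl, (ih h).trans Finset.subset_union_right]
  | relabel i j s ih =>
    rcases h with rfl | h
    exacts [subset_rfl, (ih h).trans Finset.subset_union_right]

theorem wellFormed_of_mem_nodes (hT : T.WellFormed) (h : t ∈ T.nodes) : t.WellFormed := by
  induction T with
  | vertex l v => rw [Set.mem_singleton_iff.1 h]; trivial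
  | union s s' ihs iht =>
    rcases h with (rfl | h) | h
    exacts [hT, ihs hT.1 h, iht hT.2.1 h]
  | join i j s ih =>
    rcases h with rfl | h
    exacts [hT, ih hT h]
  | relabel i j s ih =>
    rcases h with rfl | h
    exacts [hT, ih hT h]

theorem label_ne_none_of_mem_nodes {u : Fin n} (h : t ∈ T.nodes) (hu : t.label u ≠ none) :
    T.label u ≠ none := by
  induction T with
  | vertex l v => rwa [← Set.mem_singleton_iff.1 h]
  | union s s' ihs iht =>
    rcases h with (rfl | h) | h
    · exact hu
    · simp [Decomp.label, ihs h]
    · simp [Decomp.label, iht h]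
  | join i j s ih =>
    rcases h with rfl | h
    exacts [hu, ih h]
  | relabel i j s ih =>
    rcases h with rfl | h
    · exact hu
    · simpa [Decomp.label] using ih h

theorem label_ne_none_of_adj {x u : Fin n} (h : T.graph.Adj x u) : T.label x ≠ none := by
  induction T generalizing x u with
  | vertex l v => exact h.elim
  | union s t ihs iht =>
    rcases h with h | h
    · simp [Decomp.label, ihs h]
    · simp [Decomp.label, iht h]
  | join i j t ih =>
    rcases h with h | h
    · exact ih h
    · simp only [SimpleGraph.fromRel_adj] at h
      rcases h.2 with h | h
      · simp [Decomp.label, h.1]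
      · simp [Decomp.label, h.2]
  | relabel i j t ih => simpa [Decomp.label] using ih h

/-- Vertices with the same label at a node have the same neighbours outside of the value of the
node. -/
theorem adj_iff_of_label_eq {u v x : Fin n} (hT : T.WellFormed) (ht : t ∈ T.nodes)
    (huv : t.label u = t.label v) (hu : t.label u ≠ none) (hx : t.label x = none) :
    T.label u = T.label v ∧ (T.graph.Adj x u ↔ T.graph.Adj x v) := by
  have hself : ∀ T : Decomp (Fin n), t = T → T.label u = T.label v ∧
      (T.graph.Adj x u ↔ T.graph.Adj x v) := by
    rintro T rfl
    exact ⟨huv, fun h => absurd hx (label_ne_none_of_adj h),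
      fun h => absurd hx (label_ne_none_of_adj h)⟩
  have hv : t.label v ≠ none := huv ▸ hu
  have hnone : ∀ {s : Decomp (Fin n)} {w : Fin n}, s.label w = none → ¬ s.graph.Adj x w :=
    fun h h' => label_ne_none_of_adj h'.symm h
  induction T with
  | vertex l v => exact hself _ ht
  | union s s' ihs iht =>
    rcases ht with (h | h) | h
    · exact hself _ h
    · obtain ⟨h1, h2⟩ := ihs hT.1 h
      have hu' := (hT.2.2 u).resolve_left (label_ne_none_of_mem_nodes h hu)
      have hv' := (hT.2.2 v).resolve_left (label_ne_none_of_mem_nodes h hv)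
      simp [Decomp.label, Decomp.graph, h1, h2, hu', hv', hnone]
    · obtain ⟨h1, h2⟩ := iht hT.2.1 h
      have hu' := (hT.2.2 u).resolve_right (label_ne_none_of_mem_nodes h hu)
      have hv' := (hT.2.2 v).resolve_right (label_ne_none_of_mem_nodes h hv)
      simp [Decomp.label, Decomp.graph, h1, h2, hu', hv', hnone]
  | join i j s ih =>
    rcases ht with h | h
    · exact hself _ h
    · obtain ⟨h1, h2⟩ := ih hT h
      have hxu : x ≠ u := fun e => hu (e ▸ hx)
      have hxv : x ≠ v := fun e => hv (e ▸ hx)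
      simp [Decomp.label, Decomp.graph, h1, h2, hxu, hxv]
  | relabel i j s ih =>
    rcases ht with h | h
    · exact hself _ h
    · obtain ⟨h1, h2⟩ := ih hT h
      simp [Decomp.label, Decomp.graph, h1, h2]

theorem mem_nodeLab (hT : T.WellFormed) {x l : ℕ} :
    (x, l) ∈ nodeLab T ↔ ∃ h : x < n, T.label ⟨x, h⟩ = some l := by
  induction T generalizing l with
  | vertex l' v =>
    simp only [nodeLab, List.mem_singleton, Prod.mk.injEq, Decomp.label, ite_eq_iff,
      Option.some.injEq, reduceCtorEq, and_false, or_false, Fin.ext_iff]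
    constructor
    · rintro ⟨rfl, rfl⟩
      exact ⟨v.2, rfl, rfl⟩
    · rintro ⟨-, h1, h2⟩
      exact ⟨h1, h2.symm⟩
  | union s t ihs iht =>
    rw [nodeLab, List.mem_append, ihs hT.1, iht hT.2.1, ← exists_or]
    refine exists_congr fun h => ?_
    rw [Decomp.label, Option.or_eq_some_iff]
    have := hT.2.2 ⟨x, h⟩
    refine or_congr_right ⟨fun h' => ⟨this.resolve_right (by simp [h']), h'⟩, fun h' => h'.2⟩
  | join i j t ih => exact ih hT
  | relabel i j t ih =>
    simp only [nodeLab, List.mem_map, Prod.exists, Prod.mk.injEq, Decomp.label,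
      Option.map_eq_some_iff]
    constructor
    · rintro ⟨a, b, h, rfl, rfl⟩
      obtain ⟨h1, h2⟩ := (ih hT).1 h
      exact ⟨h1, b, h2, rfl⟩
    · rintro ⟨h, b, h2, rfl⟩
      exact ⟨x, b, (ih hT).2 ⟨h, h2⟩, rfl, rfl⟩

theorem disjoint_nodeLab {s t : Decomp (Fin n)} (h : (Decomp.union s t).WellFormed) :
    ((nodeLab s).map Prod.fst).Disjoint ((nodeLab t).map Prod.fst) := by
  intro x h1 h2
  simp only [List.mem_map, Prod.exists, exists_and_right, exists_eq_right] at h1 h2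
  obtain ⟨l, h1⟩ := h1
  obtain ⟨l', h2⟩ := h2
  obtain ⟨hx, h1⟩ := (mem_nodeLab h.1).1 h1
  obtain ⟨_, h2⟩ := (mem_nodeLab h.2.1).1 h2
  have := h.2.2 ⟨x, hx⟩
  simp [h1, h2] at this

theorem nodup_nodeLab (hT : T.WellFormed) : ((nodeLab T).map Prod.fst).Nodup := by
  induction T with
  | vertex l v => simp [nodeLab]
  | union s t ihs iht =>
    rw [nodeLab, List.map_append]
    exact (ihs hT.1).append (iht hT.2.1) (disjoint_nodeLab hT)
  | join i j t ih => exact ih hT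
  | relabel i j t ih =>
    have := ih hT
    simpa [nodeLab, Function.comp_def] using this

/-- Adjacency between two nodes of which neither contains a vertex of the other is determined by
the labels. -/
theorem labelAdj_nodeLab {G : SimpleGraph (Fin n)} {s t : Decomp (Fin n)} (hT : T.WellFormed)
    (hG : T.graph = G) (hs : s ∈ T.nodes) (ht : t ∈ T.nodes)
    (hst : ∀ u, s.label u = none ∨ t.label u = none) :
    LabelAdj (edgeList (adjRows G)) (nodeLab s) (nodeLab t) := by
  classical
  have ms {x l} := mem_nodeLab (x := x) (l := l) (wellFormed_of_mem_nodes hT hs)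
  have mt {x l} := mem_nodeLab (x := x) (l := l) (wellFormed_of_mem_nodes hT ht)
  refine ⟨fun l l' => decide (∃ u v, s.label u = some l ∧ t.label v = some l' ∧ G.Adj u v), ?_⟩
  rintro ⟨x, l⟩ hx ⟨y, l'⟩ hy
  obtain ⟨hx1, hx2⟩ := ms.1 hx
  obtain ⟨hy1, hy2⟩ := mt.1 hy
  rw [Bool.eq_iff_iff, decide_eq_true_eq, decide_eq_true_eq, mem_edgeList_adjRows]
  refine ⟨fun ⟨_, _, h⟩ => ⟨_, _, hx2, hy2, h⟩, fun ⟨u, v, hu, hv, h⟩ => ⟨hx1, hy1, ?_⟩⟩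
  have h1 : t.label u = none := (hst u).resolve_left (by simp [hu])
  have h2 : s.label ⟨y, hy1⟩ = none := (hst _).resolve_right (by simp [hy2])
  have h3 := (adj_iff_of_label_eq hT ht (hv.trans hy2.symm) (by simp [hv]) h1).2
  have h4 := (adj_iff_of_label_eq hT hs (hu.trans hx2.symm) (by simp [hu]) h2).2
  rw [hG] at h3 h4
  exact (h4.1 (h3.1 h).symm).symm

end Decomp

end MaxCutCW

/-! ### Correctness of the algorithm -/

namespace MaxCutCW

section Union

variable {n α β δ : ℕ} {G : SimpleGraph (Fin n)} {T t : Decomp (Fin n)}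

theorem mem_outside_nodeLab (ht : t.WellFormed) {L : Finset ℕ} {x : ℕ} :
    x ∈ outside (List.range n) (nodeLab t) L.toList ↔
      ∃ (h : x < n) (l : ℕ), t.label ⟨x, h⟩ = some l ∧ l ∉ L := by
  simp only [mem_outside, mem_nodeLab ht, List.mem_range, Finset.mem_toList]
  exact ⟨fun ⟨_, l, ⟨h1, h2⟩, h3⟩ => ⟨h1, l, h2, h3⟩, fun ⟨h1, l, h2, h3⟩ => ⟨h1, l, ⟨h1, h2⟩, h3⟩⟩

/-- Each label class outside of `L` meets at most `β` bubbles, and every bubble that is considered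
meets such a class. -/
theorem length_bubbles_le (hT : T.WellFormed) (ht : t ∈ T.nodes) {L : Finset ℕ}
    (hL : ∀ l ∈ T.labels \ L, numBubbles G (t.labelClass l) ≤ β) :
    (bubbles (edgeList (adjRows G)) (outside (List.range n) (nodeLab t) L.toList)).length ≤
      T.width * β := by
  classical
  set O := outside (List.range n) (nodeLab t) L.toList with hO
  have mO {x} := mem_outside_nodeLab (x := x) (L := L) (wellFormed_of_mem_nodes hT ht)
  rw [← hO] at mO
  let f : Set (Fin n) → List ℕ := fun B => O.filter fun x => decide (∃ h : x < n, ⟨x, h⟩ ∈ B)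
  let F : ℕ → Finset (List ℕ) := fun l =>
    {B : Set (Fin n) | IsBubble G B ∧ (B ∩ t.labelClass l).Nonempty}.toFinite.toFinset.image f
  have h1 : (bubbles (edgeList (adjRows G)) O).toFinset ⊆ (T.labels \ L).biUnion F := by
    intro B hB
    obtain ⟨u, hu, rfl⟩ := mem_bubbles.1 (List.mem_toFinset.1 hB)
    obtain ⟨hun, l, hl, hlL⟩ := mO.1 hu
    simp only [Finset.mem_biUnion, Finset.mem_sdiff, F, Finset.mem_image, Set.Finite.mem_toFinset]
    refine ⟨l, ⟨labels_subset_of_mem_nodes ht (mem_labels_of_label_eq_some hl), hlL⟩,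
      {x | closedNbhd G ⟨u, hun⟩ = closedNbhd G x}, ⟨isBubble_setOf_closedNbhd_eq _, ⟨u, hun⟩, rfl,
      hl⟩, List.filter_congr fun x hx => ?_⟩
    obtain ⟨hxn, -⟩ := mO.1 hx
    rw [Bool.eq_iff_iff, decide_eq_true_eq, same_iff]
    constructor
    · rintro ⟨_, h⟩
      exact .inr ⟨hun, hxn, h⟩
    · rintro (rfl | ⟨_, _, h⟩)
      exacts [⟨hun, rfl⟩, ⟨hxn, h⟩]
  have h2 : (bubbles (edgeList (adjRows G)) O).length =
      (bubbles (edgeList (adjRows G)) O).toFinset.card :=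
    (List.toFinset_card_of_nodup (List.nodup_dedup _)).symm
  rw [h2]
  refine (Finset.card_le_card h1).trans
    ((Finset.card_biUnion_le_card_mul _ _ β fun l hl => ?_).trans
      (Nat.mul_le_mul_right β (Finset.card_le_card Finset.sdiff_subset)))
  refine Finset.card_image_le.trans ?_
  rw [← Set.ncard_eq_toFinset_card]
  exact hL l hl

open Classical in
/-- Membership in a set of vertices, as a Boolean predicate on natural numbers. -/
noncomputable def toPred (S : Finset (Fin n)) (x : ℕ) : Bool :=
  decide (∃ h : x < n, (⟨x, h⟩ : Fin n) ∈ S)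

theorem toPred_iff {S : Finset (Fin n)} {x : ℕ} :
    toPred S x = true ↔ ∃ h : x < n, (⟨x, h⟩ : Fin n) ∈ S := by
  simp [toPred]

/-- If mixed bubbles are pairwise nonadjacent, then there are at most as many of them as the
independence number permits. -/
theorem exists_representatives {U : Set (Fin n)} {S : Finset (Fin n)}
    (hS : ∀ u u' v v', closedNbhd G u = closedNbhd G u' → u ∈ S → u' ∉ S →
        closedNbhd G v = closedNbhd G v' → v ∈ S → v' ∉ S → G.Adj u v →
        closedNbhd G u = closedNbhd G v) :
    ∃ R : Finset (Fin n), R.card ≤ (G.induce U).indepNum ∧ (R : Set (Fin n)) ⊆ U ∧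
      ∀ u ∈ U, ∀ u', closedNbhd G u = closedNbhd G u' → u ∈ S → u' ∉ S →
        ∃ r ∈ R, closedNbhd G r = closedNbhd G u := by
  classical
  set M : Set (Fin n) := {u | u ∈ U ∧ u ∈ S ∧ ∃ u', closedNbhd G u = closedNbhd G u' ∧ u' ∉ S}
  obtain ⟨R, hRM, hR⟩ := (Set.surjOn_image (closedNbhd G) M).exists_bijOn_subset
  obtain ⟨R, rfl⟩ := R.toFinite.exists_finset_coe
  refine ⟨R, ?_, fun r hr => (hRM hr).1, fun u hu u' h hu1 hu2 => ?_⟩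
  · have h1 : (R.subtype (· ∈ U)).card = R.card := by
      rw [Finset.card_subtype, Finset.filter_true_of_mem fun r hr => (hRM hr).1]
    rw [← h1]
    refine SimpleGraph.IsIndepSet.card_le_indepNum ?_
    rintro ⟨r, hrU⟩ hr ⟨s, hsU⟩ hs hne hadj
    simp only [Finset.mem_coe, Finset.mem_subtype] at hr hs
    obtain ⟨-, hr1, r', hr2, hr3⟩ := hRM hr
    obtain ⟨-, hs1, s', hs2, hs3⟩ := hRM hs
    have h2 := hS r r' s s' hr2 hr1 hr3 hs2 hs1 hs3 hadj
    exact hne (Subtype.ext (hR.injOn hr hs h2))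
  · exact hR.surjOn ⟨u, ⟨hu, hu1, u', h, hu2⟩, rfl⟩

theorem range_eq_mkGlob (G : SimpleGraph (Fin n)) (p : List Instr) :
    (mkGlob β (adjRows G) p).1 = List.range n := by
  have : (mkGlob β (adjRows G) p).1 = (adjRows G).zipIdx.map Prod.snd := rfl
  rw [this, List.zipIdx_map_snd, adjRows, List.length_map, List.length_finRange,
    List.range_eq_range']

/-- For a normalized cut, the guesses at every union contain a suitable one. -/
theorem unionGood (hT : T.IsABDDecompOf G α β δ) {S : Finset (Fin n)}
    (hS₁ : ∀ u v, u < v → closedNbhd G u = closedNbhd G v → u ∈ S → v ∈ S)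
    (hS₂ : ∀ u u' v v', closedNbhd G u = closedNbhd G u' → u ∈ S → u' ∉ S →
        closedNbhd G v = closedNbhd G v' → v ∈ S → v' ∉ S → G.Adj u v →
        closedNbhd G u = closedNbhd G v)
    {s t : Decomp (Fin n)} (hst : Decomp.union s t ∈ T.nodes) :
    UnionGood α δ (mkGlob β (adjRows G) (lin T)) (toPred S) (nodeLab s) (nodeLab t) := by
  obtain ⟨⟨hwf, -, hG⟩, hn⟩ := hT
  have hwf' := wellFormed_of_mem_nodes hwf hst
  have hs : s ∈ T.nodes := mem_nodes_trans (t := .union s t) (.inl (.inr (self_mem_nodes s))) hst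
  have ht : t ∈ T.nodes := mem_nodes_trans (t := .union s t) (.inr (self_mem_nodes t)) hst
  obtain ⟨L, hLT, hLδ, hLα, hLβ⟩ := hn _ hst
  obtain ⟨R, hR1, hR2, hR3⟩ := exists_representatives hS₂
    (U := ⋃ l ∈ T.labels \ L, (Decomp.union s t).labelClass l)
  have mO {x} := mem_outside_nodeLab (x := x) (L := L) hwf'
  rw [nodeLab] at mO
  have mU : ∀ x : Fin n, (x : ℕ) ∈ outside (List.range n) (nodeLab s ++ nodeLab t) L.toList ↔
      x ∈ ⋃ l ∈ T.labels \ L, (Decomp.union s t).labelClass l := by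
    intro x
    simp only [mO, Set.mem_iUnion, exists_prop, Finset.mem_sdiff]
    constructor
    · rintro ⟨_, l, h1, h2⟩
      exact ⟨l, ⟨labels_subset_of_mem_nodes hst (mem_labels_of_label_eq_some h1), h2⟩, h1⟩
    · rintro ⟨l, ⟨-, h2⟩, h1⟩
      exact ⟨x.2, l, h1, h2⟩
  refine ⟨disjoint_nodeLab hwf', labelAdj_nodeLab hwf hG hs ht hwf'.2.2,
    labelAdj_nodeLab hwf hG ht hs fun u => (hwf'.2.2 u).symm, ?_⟩
  rw [range_eq_mkGlob]
  refine exists_guess (L := L.toList) (R := R.toList.map Fin.val)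
    ?_ ?_ ?_ ?_ ?_ ?_ ?_ ?_ ?_ ?_ ?_ ?_
  · exact nodup_nodeLab hwf'
  · intro p hp
    obtain ⟨h, -⟩ := (mem_nodeLab (l := p.2) hwf').1 hp
    exact List.mem_range.2 h
  · simpa using hLδ
  · intro l hl
    exact (mem_usedLabels T l).2 (hLT (Finset.mem_toList.1 hl))
  · refine (length_bubbles_le hwf hst hLβ).trans_eq ?_
    simp [mkGlob, length_usedLabels, Nat.mul_comm]
  · simpa using hR1.trans hLα
  · intro x hx
    simp only [List.mem_map, Finset.mem_toList] at hx
    obtain ⟨r, hr, rfl⟩ := hx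
    exact (mU r).2 (hR2 hr)
  · intro x hx y hy hxy hSx hSy
    obtain ⟨hxn, hx1⟩ := mO.1 hx
    obtain ⟨hyn, hy1⟩ := mO.1 hy
    obtain ⟨_, hSx'⟩ := toPred_iff.1 hSx
    have hSy' : (⟨y, hyn⟩ : Fin n) ∉ S := fun h => by
      rw [toPred_iff.2 ⟨hyn, h⟩] at hSy
      cases hSy
    have h1 : closedNbhd G ⟨x, hxn⟩ = closedNbhd G ⟨y, hyn⟩ := by
      rcases same_iff.1 hxy with rfl | ⟨_, _, h⟩
      exacts [rfl, h]
    obtain ⟨r, hr, hr'⟩ := hR3 ⟨x, hxn⟩ ((mU _).1 hx) _ h1 hSx' hSy'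
    exact ⟨r, List.mem_map_of_mem (Finset.mem_toList.2 hr), same_iff.2 (.inr ⟨r.2, hxn, hr'⟩)⟩
  · refine List.pairwise_lt_range.imp fun {x y} hlt hxy hSx => ?_
    obtain ⟨hxn, hSx⟩ := toPred_iff.1 hSx
    rcases same_iff.1 hxy with rfl | ⟨_, hyn, h⟩
    · exact absurd hlt (lt_irrefl _)
    · exact toPred_iff.2 ⟨hyn, hS₁ _ _ hlt h hSx⟩
  · intro x
    exact same_iff.2 (.inl rfl)
  · intro x y h
    rcases same_iff.1 h with rfl | ⟨h1, h2, h⟩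
    exacts [same_iff.2 (.inl rfl), same_iff.2 (.inr ⟨h2, h1, h.symm⟩)]
  · intro x y z h h'
    rcases same_iff.1 h with rfl | ⟨h1, h2, h⟩
    · exact h'
    rcases same_iff.1 h' with rfl | ⟨h3, h4, h'⟩
    exacts [same_iff.2 (.inr ⟨h1, h2, h⟩), same_iff.2 (.inr ⟨h1, h4, h.trans h'⟩)]

end Union

theorem length_filter_eq_sum {γ : Type} (l : List γ) (p : γ → Bool) :
    (l.filter p).length = (l.map fun x => if p x then 1 else 0).sum := by
  induction l with
  | nil => rfl
  | cons x l ih => cases h : p x <;> simp [h, ih, Nat.add_comm]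

/-- If the labelled set consists of all vertices, then the number of cut edges within it is the size
of the cut. -/
theorem cross_eq_cutSize {n : ℕ} {G : SimpleGraph (Fin n)} {lab : List (ℕ × ℕ)}
    (h : (lab.map Prod.fst).Perm (List.range n)) {P : ℕ → Bool} {S : Finset (Fin n)}
    (hP : ∀ x : Fin n, P x = true ↔ x ∈ S) :
    cross (edgeList (adjRows G)) lab lab P P = cutSize G (S : Set (Fin n)) := by
  classical
  have h1 : ∀ f : ℕ → ℕ, (lab.map fun p => f p.1).sum = ∑ u : Fin n, f u := by
    intro f
    have e : (lab.map fun p => f p.1) = (lab.map Prod.fst).map f := by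
      rw [List.map_map]
      rfl
    rw [e, (h.map f).sum_eq, ← List.map_coe_finRange_eq_range, List.map_map, Fin.sum_univ_def]
    rfl
  rw [cross, List.length_flatMap, cutSize_eq_card, Finset.card_filter, Fintype.sum_prod_type]
  simp only [length_filter_eq_sum]
  rw [h1 fun u => (lab.map fun q =>
    if (P u && (!P q.1 && decide ((u, q.1) ∈ edgeList (adjRows G)))) = true then 1 else 0).sum]
  refine Finset.sum_congr rfl fun u _ => ?_
  rw [h1 fun v => if (P u && (!P v && decide (((u : ℕ), v) ∈ edgeList (adjRows G)))) = true
    then 1 else 0]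
  refine Finset.sum_congr rfl fun v _ => if_congr ?_ rfl rfl
  have h2 : ((u : ℕ), (v : ℕ)) ∈ edgeList (adjRows G) ↔ G.Adj u v := by
    simp [mem_edgeList_adjRows]
  rw [Bool.and_eq_true, Bool.and_eq_true, decide_eq_true_eq, h2, hP, Bool.not_eq_true',
    ← Bool.not_eq_true, hP]
  tauto

/-- The algorithm computes a maximum cut. -/
theorem solve_spec {n α β δ : ℕ} {G : SimpleGraph (Fin n)} {T : Decomp (Fin n)}
    (hT : T.IsABDDecompOf G α β δ) :
    ∃ W : List (Fin n), (solve α β δ (adjRows G, ⟨n, T⟩)).2 = W.map Fin.val ∧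
      IsMaxCut G {v | v ∈ W} ∧
      cutCount (edgeList (adjRows G)) (nodeLab T) (W.map Fin.val) = cutSize G {v | v ∈ W} := by
  classical
  obtain ⟨⟨hwf, hall, hG⟩, -⟩ := id hT
  have hperm : ((nodeLab T).map Prod.fst).Perm (List.range n) := by
    rw [List.perm_ext_iff_of_nodup (nodup_nodeLab hwf) List.nodup_range]
    intro x
    simp only [List.mem_map, Prod.exists, exists_and_right, exists_eq_right, mem_nodeLab hwf,
      List.mem_range]
    refine ⟨fun ⟨_, h, _⟩ => h, fun h => ?_⟩
    obtain ⟨l, hl⟩ := Option.ne_none_iff_exists'.1 (hall ⟨x, h⟩)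
    exact ⟨l, h, hl⟩
  obtain ⟨S, hS, hS₁, hS₂⟩ := exists_normalized_maxCut G
  set g := mkGlob β (adjRows G) (lin T) with hg
  obtain ⟨D, hD, -, hD'⟩ := exists_dominates (α := α) (δ := δ) (g := g) T
    fun s t => unionGood hT hS₁ hS₂
  have hgE : g.2.1 = edgeList (adjRows G) := rfl
  rw [hgE] at hD'
  set F := (nodeTable α δ g T).foldl (better (edgeList (adjRows G)) (nodeLab T)) [] with hF
  obtain ⟨f1, f2, f3⟩ := foldl_better (E := edgeList (adjRows G)) (lab := nodeLab T)
    (nodeTable α δ g T)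
  rw [← hF] at f1 f2 f3
  obtain ⟨Z, hZ, hDZ⟩ := f3 D hD
  have hsolve : (solve α β δ (adjRows G, ⟨n, T⟩)).2 = Z := by
    change F.headD [] = Z
    match F, f1, hZ with
    | [A], _, hZ => exact (List.mem_singleton.1 hZ).symm
  rw [hsolve]
  have hZn : ∀ x ∈ Z, x < n := fun x hx =>
    List.mem_range.1 (hperm.subset ((sublist_of_mem_nodeTable (f2 Z hZ)).subset hx))
  lift Z to List (Fin n) using hZn
  have hc : ∀ W : List (Fin n), cutCount (edgeList (adjRows G)) (nodeLab T) (W.map Fin.val) =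
      cutSize G {v | v ∈ W} := by
    intro W
    rw [cutCount_eq_cross, cross_eq_cutSize hperm (S := W.toFinset) fun x => by
      simp [isMem, Fin.val_inj]]
    simp
  refine ⟨Z, rfl, fun S' => (hS S').trans ?_, hc Z⟩
  rw [← hc Z, ← cross_eq_cutSize hperm (P := toPred S) fun x => by simp [toPred_iff]]
  exact hD'.trans hDZ

end MaxCutCW

/-! ### The programs -/

namespace MaxCutCW

open Enc (enc)

theorem enc_input {n : ℕ} (G : SimpleGraph (Fin n)) (T : Decomp (Fin n)) :
    enc (adjRows G, ((⟨n, T⟩ : SDecomp), ())) = encInput G T := by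
  rw [encInput, ← enc_adjRows]
  rfl

theorem enc_map_val {n : ℕ} (W : List (Fin n)) : enc (W.map Fin.val) = encVertices W := by
  change encList ((W.map Fin.val).map encNat) = _
  rw [encVertices, List.map_eq_flatMap (f := Fin.val)]
  rfl

/-- A program that computes a maximum cut. -/
theorem exists_program_maxCut (α β δ : ℕ) : ∃ (p : Program) (C d : ℕ),
    ∀ (n : ℕ) (G : SimpleGraph (Fin n)) (T : Decomp (Fin n)), T.IsABDDecompOf G α β δ →
      ∃ (S : List (Fin n)) (time : ℕ), p.Outputs (encInput G T) (encVertices S) time ∧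
        IsMaxCut G {v | v ∈ S} ∧ time ≤ C * 2 ^ (β * T.width) * (encInput G T).size ^ d := by
  obtain ⟨t, P, ht, hP⟩ := ct_solve α β δ
  obtain ⟨k, hk⟩ : ConstTime fun x : List (List Bool) × (SDecomp × Unit) => (x.1, x.2.1) := by
    fun_prop
  obtain ⟨k', hk'⟩ : ConstTime fun x : (List (ℕ × ℕ) × List (ℕ × ℕ)) × List ℕ => x.2 := by
    fun_prop
  obtain ⟨p, hp⟩ := (hk'.comp (ht.comp hk)).outputs
  set Q : Polynomial ℕ := P + .C (k + k' + 20) with hQ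
  refine ⟨p, Q.eval 1, Q.natDegree, fun n G T hT => ?_⟩
  obtain ⟨W, hW, hmax, -⟩ := solve_spec hT
  obtain ⟨m, hm, hout⟩ := hp (adjRows G, (⟨n, T⟩, ()))
  rw [enc_input, hW, enc_map_val] at hout
  refine ⟨W, m, hout, hmax, ?_⟩
  have h1 : t (adjRows G, ⟨n, T⟩) ≤
      2 ^ (β * T.width) * P.eval (sz (adjRows G, (⟨n, T⟩ : SDecomp))) := by
    have := hP (adjRows G, ⟨n, T⟩)
    rwa [length_usedLabels] at this
  have h2 : sz (adjRows G, (⟨n, T⟩ : SDecomp)) ≤ (encInput G T).size := by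
    rw [← enc_input]
    change sz (adjRows G, (⟨n, T⟩ : SDecomp)) ≤ sz (adjRows G, ((⟨n, T⟩ : SDecomp), ()))
    simp only [sz_pair]
    omega
  have h3 := Nat.mul_le_mul_left (2 ^ (β * T.width)) (eval_mono P h2)
  have h4 := Nat.mul_le_mul_left (2 ^ (β * T.width))
    (eval_le_pow Q (s := (encInput G T).size) (BinaryTree.numLeaves_pos _))
  have h5 : k + k' + 20 ≤ 2 ^ (β * T.width) * (k + k' + 20) :=
    Nat.le_mul_of_pos_left _ (by positivity)
  have h6 : Q.eval (encInput G T).size = P.eval (encInput G T).size + (k + k' + 20) := by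
    simp [hQ]
  replace hm : m ≤ k + t (adjRows G, ⟨n, T⟩) + k' + 20 := hm
  rw [h6, Nat.mul_add] at h4
  calc m ≤ _ := by omega
    _ ≤ _ := h4
    _ = _ := by ring

theorem enc_instance {α β δ : ℕ} (I : MaxCutInstance α β δ) :
    enc (adjRows I.G, ((⟨I.n, I.T⟩ : SDecomp), (I.m, ()))) = (maxCutByCW α β δ).encode I := by
  change _ = encList [encGraph I.G, encDecomp I.T, encNat I.m]
  rw [← enc_adjRows]
  rfl

theorem param_eq_width {α β δ : ℕ} (I : MaxCutInstance α β δ) :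
    (maxCutByCW α β δ).param I = I.T.width := by
  change (cw α β δ I.G).toNat = _
  rw [← I.optimal, ENat.toNat_natCast]

theorem computable_two_pow (C β : ℕ) : Computable fun k => C * 2 ^ (β * k) := by
  have h1 : Primrec₂ ((· ^ ·) : ℕ → ℕ → ℕ) := Primrec₂.unpaired'.1 Nat.Primrec.pow
  have h2 : Primrec fun k => β * k := Primrec.nat_mul.comp (.const β) .id
  exact (Primrec.nat_mul.comp (.const C) (h1.comp (.const 2) h2)).to_comp

/-- The decision problem is fixed-parameter tractable: one computes a maximum cut and compares its
size with the target. -/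
theorem inFPT_maxCutByCW (α β δ : ℕ) : (maxCutByCW α β δ).InFPT := by
  obtain ⟨t, P, ht, hP⟩ := ct_solve α β δ
  obtain ⟨A, hA⟩ := sz_solve α β δ
  obtain ⟨R, hR, -⟩ := poly_reaches
  obtain ⟨k, hk⟩ : ConstTime fun x : List (List Bool) × (SDecomp × (ℕ × Unit)) =>
    (x.1, x.2.1) := by fun_prop
  obtain ⟨k', hk'⟩ : ConstTime fun x : List (List Bool) × (SDecomp × (ℕ × Unit)) =>
    x.2.2.1 := by fun_prop
  obtain ⟨p, hp⟩ := (hR.comp ((ht.comp hk).pair hk')).outputs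
  set Q : Polynomial ℕ := P + R.comp (A + .X) + .C (k + k' + 60) with hQ
  refine ⟨p, fun w => Q.eval 1 * 2 ^ (β * w), Q.natDegree, computable_two_pow _ _, ?_⟩
  change ∀ I : MaxCutInstance α β δ, _
  intro I
  obtain ⟨W, hW, hmax, hcount⟩ := solve_spec I.isDecomp
  obtain ⟨m, hm, hout⟩ := hp (adjRows I.G, (⟨I.n, I.T⟩, (I.m, ())))
  rw [enc_instance] at hout
  refine ⟨_, m, hout, ?_, ?_⟩
  · have h1 : ∀ b : Bool, enc b ≠ .nil ↔ b = true := by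
      intro b
      cases b <;> simp [enc, encBool]
    have e : (solve α β δ (adjRows I.G, ⟨I.n, I.T⟩)).1 =
      (edgeList (adjRows I.G), nodeLab I.T) := rfl
    rw [h1, reaches_iff]
    simp only [e, hW, hcount]
    exact ⟨fun h => ⟨_, h⟩, fun ⟨S, hS⟩ => hS.trans (hmax S)⟩
  · rw [param_eq_width]
    set s := ((maxCutByCW α β δ).encode I).size with hs
    have h1 : t (adjRows I.G, ⟨I.n, I.T⟩) ≤
        2 ^ (β * I.T.width) * P.eval (sz (adjRows I.G, (⟨I.n, I.T⟩ : SDecomp))) := by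
      have := hP (adjRows I.G, ⟨I.n, I.T⟩)
      rwa [length_usedLabels] at this
    have hsz : sz (adjRows I.G, ((⟨I.n, I.T⟩ : SDecomp), (I.m, ()))) = s := by
      rw [hs, ← enc_instance]
      rfl
    have h2 : sz (adjRows I.G, (⟨I.n, I.T⟩ : SDecomp)) ≤ s ∧ sz I.m ≤ s := by
      rw [← hsz]
      simp only [sz_pair]
      omega
    have h3 := Nat.mul_le_mul_left (2 ^ (β * I.T.width)) (eval_mono P h2.1)
    have h4 := Nat.mul_le_mul_left (2 ^ (β * I.T.width))
      (eval_le_pow Q (s := s) (BinaryTree.numLeaves_pos _))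
    have h5 : k + k' + 60 ≤ 2 ^ (β * I.T.width) * (k + k' + 60) :=
      Nat.le_mul_of_pos_left _ (by positivity)
    have h6 : R.eval (A.eval s + s) ≤ 2 ^ (β * I.T.width) * R.eval (A.eval s + s) :=
      Nat.le_mul_of_pos_left _ (by positivity)
    have h7 : R.eval (sz (solve α β δ (adjRows I.G, ⟨I.n, I.T⟩), I.m)) ≤
        R.eval (A.eval s + s) := by
      refine eval_mono R ?_
      have := (hA (adjRows I.G, ⟨I.n, I.T⟩)).trans (eval_mono A h2.1)
      have := h2.2
      rw [sz_pair]
      omega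
    have h8 : Q.eval s = P.eval s + R.eval (A.eval s + s) + (k + k' + 60) := by
      simp [hQ, Polynomial.eval_comp]
    rw [h8, Nat.mul_add, Nat.mul_add] at h4
    replace hm : m ≤ k + t (adjRows I.G, ⟨I.n, I.T⟩) + k' + 40 +
      R.eval (sz (solve α β δ (adjRows I.G, ⟨I.n, I.T⟩), I.m)) + 20 := hm
    calc m ≤ _ := by omega
      _ ≤ _ := h4
      _ = _ := by ring

end MaxCutCW

theorem mainTheorem2 :
    ∃ c : ℕ, ∀ α β δ : ℕ, 0 < α → 0 < β → 0 < δ →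
      (MaxCutCW.maxCutByCW α β δ).InFPT ∧
      ∃ (p : MaxCutCW.Program) (C d : ℕ),
        ∀ (n : ℕ) (G : SimpleGraph (Fin n)) (T : MaxCutCW.Decomp (Fin n)),
          T.IsABDDecompOf G α β δ →
          ∃ (S : List (Fin n)) (time : ℕ),
            p.Outputs (MaxCutCW.encInput G T) (MaxCutCW.encVertices S) time ∧
            MaxCutCW.IsMaxCut G {v | v ∈ S} ∧
            time ≤ C * (β * T.width) ^ (c * α) * 2 ^ (β * T.width) *
              (MaxCutCW.encInput G T).size ^ d := by
  -- the polynomial factor absorbs `(β * T.width) ^ O(α)`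
  refine ⟨0, fun α β δ _ _ _ => ⟨MaxCutCW.inFPT_maxCutByCW α β δ, ?_⟩⟩
  obtain ⟨p, C, d, h⟩ := MaxCutCW.exists_program_maxCut α β δ
  refine ⟨p, C, d, fun n G T hT => ?_⟩
  obtain ⟨S, time, h1, h2, h3⟩ := h n G T hT
  exact ⟨S, time, h1, h2, by simpa using h3⟩
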